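/- Let $\mathbf k$ be a field, $\Gamma$ a finite abelian group, $t\ge 1$ and $n_1,\dots,n_t\ge 1$. Let $(a_{ij})_{1\le i,j\le\theta}$, $\theta=n_1+\dots+n_t$, be the Cartan matrix of type $A_{n_1}\times\dots\times A_{n_t}$, put $S_k=n_1+\dots+n_{k-1}$, and number the vertices of the Dynkin diagram so that the $k$-th component consists, in its linear order, of $S_k+1,\dots,S_k+n_k$. Write $i\sim j$ if $i,j$ lie in the same component. A linking datum $\mathcal D$ of this type for $\Gamma$ consists of elements $g_1,\dots,g_\theta\in\Gamma$, characters $\chi_1,\dots,\chi_\theta:\Gamma\to\mathbf k^\times$ and scalars $\lambda_{ij}\in\mathbf k$ such that: the order of $\chi_i(g_i)$ is odd and greater than $3$ for all $i$; $\chi_i(g_j)\chi_j(g_i)=\chi_i(g_i)^{a_{ij}}$ for all $i,j$; $\lambda_{ij}=0$ if $i\sim j$; for $i\nsim j$, $\lambda_{ij}=0$ unless $g_ig_j\ne1$ and $\chi_i\chi_j=1$; and $\lambda_{ij}=-\chi_j(g_i)\lambda_{ji}$ for all $i,j$. Then $q_k:=\chi_i(g_i)$ is the same for all $i$ in the $k$-th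 component; let $N_k$ be its order. Let $\mathfrak U(\mathcal D)$ be the $\mathbf k$-algebra generated by the group $\Gamma$ (with its relations) and $a_1,\dots,a_\theta$, subject to $ga_i=\chi_i(g)a_ig$ for $g\in\Gamma$; $(\mathrm{ad}\,a_i)^{1-a_{ij}}a_j=0$ for $i\ne j$, $i\sim j$, where $(\mathrm{ad}\,a_i)x=a_ix-g_ixg_i^{-1}a_i$; and $a_ia_j-\chi_j(g_i)a_ja_i=\lambda_{ij}(1-g_ig_j)$ for $i\nsim j$. For $S_k+1\le i<j\le S_k+n_k+1$ put $g_{i,j}=\prod_{i\le l<j}g_l$, $\chi_{i,j}=\prod_{i\le l<j}\chi_l$, $h_{i,j}=g_{i,j}^{N_k}$, and define root vectors by $e_{i,i+1}=a_i$ and $e_{i,j}=e_{i,j-1}a_{j-1}-\chi_{j-1}(g_{i,j-1})\,a_{j-1}e_{i,j-1}$ for $j-i\ge2$. A family $\gamma=(\gamma_k)_{1\le k\le t}$, $\gamma_k=(\gamma_{i,j})_{S_k+1\le i<j\le S_k+n_k+1}$, of scalars is called admissible if $\gamma_{i,j}=0$ whenever $\chi_{i,j}^{N_k}\neq 1$ or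 $h_{i,j}=1$. For such a family define recursively in the group algebra $\mathbf k\Gamma$ $$u_{i,j}(\gamma_k)=\gamma_{i,j}(1-h_{i,j})+\sum_{i<p<j}C^j_{i,p}\,\gamma_{i,p}\,u_{p,j}(\gamma_k),\qquad C^j_{i,p}=(1-q_k^{-1})^{N_k}\,\chi_{i,p}(g_{p,j})^{\binom{N_k}2}.$$ Let $\mathcal A(\mathcal D,\gamma)$ be the quotient of $\mathfrak U(\mathcal D)$ by the two-sided ideal generated by the root vector relations $e_{i,j}^{N_k}=u_{i,j}(\gamma_k)$, for $1\le k\le t$ and $S_k+1\le i<j\le S_k+n_k+1$. Theorem. For every linking datum $\mathcal D$ of type $A_{n_1}\times\dots\times A_{n_t}$ and every admissible $\gamma$, the algebra $\mathcal A(\mathcal D,\gamma)$ is a Hopf algebra, with comultiplication determined by $\Delta(g)=g\otimes g$ for $g\in\Gamma$ and $\Delta(a_i)=a_i\otimes1+g_i\otimes a_i$ for all $i$, and it is finite-dimensional of dimension $$\dim_{\mathbf k}\mathcal A(\mathcal D,\gamma)=|\Gamma|\cdot N_1^{\binom{n_1+1}2}\cdots N_t^{\binom{n_t+1}2}.$$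 -/

import Mathlib

open scoped TensorProduct

/-- The vertices of the Dynkin diagram of type `A_{n_1} × ⋯ × A_{n_t}`: the vertex `⟨k, l⟩` is the
`l`-th vertex of the `k`-th connected component. Two vertices lie in the same connected component
iff their first coordinates agree. -/
abbrev DiagramVertex {t : ℕ} (n : Fin t → ℕ) : Type := Σ k : Fin t, Fin (n k)

/-- The Cartan matrix of type `A_{n_1} × ⋯ × A_{n_t}`. -/
def cartanTypeA {t : ℕ} (n : Fin t → ℕ) : Matrix (DiagramVertex n) (DiagramVertex n) ℤ :=
  Matrix.blockDiagonal' fun k => CartanMatrix.A (n k)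

/-- A linking datum of type `A_{n_1} × ⋯ × A_{n_t}` for the abelian group `Γ` over the field `K`. -/
structure LinkingDatum (K Γ : Type*) [Field K] [CommGroup Γ] {t : ℕ} (n : Fin t → ℕ) where
  /-- the group elements `g_i` -/
  g : DiagramVertex n → Γ
  /-- the characters `χ_i` -/
  χ : DiagramVertex n → (Γ →* Kˣ)
  /-- the linking parameters `λ_{ij}` (extended by zero to `i ∼ j`) -/
  lam : DiagramVertex n → DiagramVertex n → K
  odd_order : ∀ i, Odd (orderOf (χ i (g i)))
  three_lt_order : ∀ i, 3 < orderOf (χ i (g i))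
  cartan_condition : ∀ i j, χ i (g j) * χ j (g i) = χ i (g i) ^ cartanTypeA n i j
  lam_eq_zero_of_connected : ∀ i j, i.1 = j.1 → lam i j = 0
  lam_eq_zero : ∀ i j, i.1 ≠ j.1 → ¬ (g i * g j ≠ 1 ∧ χ i * χ j = 1) → lam i j = 0
  lam_symm : ∀ i j, lam i j = -((χ j (g i) : Kˣ) : K) * lam j i

namespace LinkingDatum

section

variable {K Γ : Type*} [Field K] [CommGroup Γ] {t : ℕ} {n : Fin t → ℕ} (D : LinkingDatum K Γ n)

/-- The free algebra on the symbols `g ∈ Γ` and `a_i`, `i` a vertex. -/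
abbrev Free (_D : LinkingDatum K Γ n) : Type _ := FreeAlgebra K (Γ ⊕ DiagramVertex n)

/-- The group element `x` as a generator of the free algebra. -/
def freeGrp (x : Γ) : D.Free := FreeAlgebra.ι K (Sum.inl x)

/-- The generator `a_i` of the free algebra. -/
def freeGen (i : DiagramVertex n) : D.Free := FreeAlgebra.ι K (Sum.inr i)

/-- The adjoint action `(ad a_i) x = a_i x - g_i x g_i⁻¹ a_i`, written in the free algebra. -/
def freeAd (i : DiagramVertex n) (x : D.Free) : D.Free :=
  D.freeGen i * x - D.freeGrp (D.g i) * x * D.freeGrp (D.g i)⁻¹ * D.freeGen i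

/-- The defining relations of `𝔘(𝓓)`: those of the group `Γ`, the action of `Γ` on the `a_i`, the
quantum Serre relations inside the components and the linking relations between them. -/
inductive Rel : D.Free → D.Free → Prop
  | grp_one : Rel (D.freeGrp 1) 1
  | grp_mul (x y : Γ) : Rel (D.freeGrp x * D.freeGrp y) (D.freeGrp (x * y))
  | grp_gen (x : Γ) (i : DiagramVertex n) :
      Rel (D.freeGrp x * D.freeGen i) (((D.χ i x : Kˣ) : K) • (D.freeGen i * D.freeGrp x))
  | serre (i j : DiagramVertex n) (hne : i ≠ j) (hij : i.1 = j.1) :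
      Rel ((D.freeAd i)^[(1 - cartanTypeA n i j).toNat] (D.freeGen j)) 0
  | link (i j : DiagramVertex n) (hij : i.1 ≠ j.1) :
      Rel (D.freeGen i * D.freeGen j - ((D.χ j (D.g i) : Kˣ) : K) • (D.freeGen j * D.freeGen i))
        (D.lam i j • (1 - D.freeGrp (D.g i * D.g j)))

/-- The algebra `𝔘(𝓓)`. -/
abbrev U : Type _ := RingQuot D.Rel

/-- The canonical map from the free algebra onto `𝔘(𝓓)`. -/
def toU : D.Free →ₐ[K] D.U := RingQuot.mkAlgHom K D.Rel

/-- The generator `a_i` of `𝔘(𝓓)`. -/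
def a (i : DiagramVertex n) : D.U := D.toU (D.freeGen i)

/-- The canonical group homomorphism `Γ → 𝔘(𝓓)`. -/
def grp : Γ →* D.U where
  toFun x := D.toU (D.freeGrp x)
  map_one' := by
    have h := RingQuot.mkAlgHom_rel K (Rel.grp_one (D := D))
    simpa [toU] using h
  map_mul' x y := by
    have h := RingQuot.mkAlgHom_rel K (Rel.grp_mul (D := D) x y)
    simpa [toU] using h.symm

/-- The canonical map `K[Γ] → 𝔘(𝓓)`. -/
noncomputable def groupAlgebraToU : MonoidAlgebra K Γ →ₐ[K] D.U :=
  MonoidAlgebra.lift K D.U Γ D.grp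

/-- `g_{i,j} = ∏_{i ≤ l < j} g_l` in the `k`-th component. The vertices of that component are
numbered from `0` to `n_k - 1`, so that here `0 ≤ i < j ≤ n_k`. -/
def gRoot (k : Fin t) (i j : Fin (n k + 1)) : Γ :=
  ∏ l : Fin (n k) with i ≤ l.castSucc ∧ l.castSucc < j, D.g ⟨k, l⟩

/-- `χ_{i,j} = ∏_{i ≤ l < j} χ_l` in the `k`-th component. -/
def χRoot (k : Fin t) (i j : Fin (n k + 1)) : Γ →* Kˣ :=
  ∏ l : Fin (n k) with i ≤ l.castSucc ∧ l.castSucc < j, D.χ ⟨k, l⟩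

/-- The root vectors of the `k`-th component, `0 ≤ i < j ≤ n_k`, by recursion on the upper index:
`e_{l,l+1} = a_l` and `e_{i,l+1} = e_{i,l} a_l - χ_l(g_{i,l}) a_l e_{i,l}` for `i < l`.
(The value for `j ≤ i` is irrelevant; it is `0`.) -/
def e (k : Fin t) (i : Fin (n k + 1)) : Fin (n k + 1) → D.U :=
  Fin.induction (motive := fun _ => D.U) 0 fun l x =>
    if i = l.castSucc then D.a ⟨k, l⟩
    else if i < l.castSucc then
      x * D.a ⟨k, l⟩ - ((D.χ ⟨k, l⟩ (D.gRoot k i l.castSucc) : Kˣ) : K) • (D.a ⟨k, l⟩ * x)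
    else 0

variable [∀ k, NeZero (n k)]

/-- The common value `q = χ_i(g_i)` on the `k`-th component, read off at its first vertex. -/
def q (k : Fin t) : Kˣ := D.χ ⟨k, 0⟩ (D.g ⟨k, 0⟩)

/-- `N_k`, the common order of the `χ_i(g_i)` on the `k`-th component. -/
noncomputable def N (k : Fin t) : ℕ := orderOf (D.q k)

/-- `h_{i,j} = g_{i,j} ^ N_k`. -/
noncomputable def h (k : Fin t) (i j : Fin (n k + 1)) : Γ := D.gRoot k i j ^ D.N k

/-- `C^j_{i,p} = (1 - q⁻¹) ^ N_k * χ_{i,p}(g_{p,j}) ^ (N_k choose 2)`. -/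
noncomputable def C (k : Fin t) (i p j : Fin (n k + 1)) : K :=
  (1 - ((D.q k)⁻¹ : Kˣ)) ^ D.N k * ((D.χRoot k i p (D.gRoot k p j) : Kˣ) : K) ^ (D.N k).choose 2

/-- The elements `u_{i,j}(γ_k)` of the group algebra, where `γ_k = c`:
`u_{i,j} = γ_{i,j} (1 - h_{i,j}) + ∑_{i < p < j} C^j_{i,p} γ_{i,p} u_{p,j}`. -/
noncomputable def u (k : Fin t) (c : Fin (n k + 1) → Fin (n k + 1) → K)
    (i j : Fin (n k + 1)) : MonoidAlgebra K Γ :=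
  c i j • (1 - MonoidAlgebra.of K Γ (D.h k i j)) +
    ∑ p : Fin (n k + 1), if _hp : i < p ∧ p < j then (D.C k i p j * c i p) • u k c p j else 0
termination_by n k + 1 - i.val
decreasing_by
  have := _hp.1
  have := p.isLt
  omega

/-- A family of scalars `γ = (γ_k)_k` is admissible if, in each component,
`γ_{i,j} = 0` whenever `χ_{i,j} ^ N_k ≠ ε` or `h_{i,j} = 1`. -/
def Admissible (γ : ∀ k : Fin t, Fin (n k + 1) → Fin (n k + 1) → K) : Prop :=
  ∀ (k : Fin t) (i j : Fin (n k + 1)), i < j →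
    (D.χRoot k i j ^ D.N k ≠ 1 ∨ D.h k i j = 1) → γ k i j = 0

variable (γ : ∀ k : Fin t, Fin (n k + 1) → Fin (n k + 1) → K)

/-- The root vector relations `e_{i,j} ^ N_k = u_{i,j}(γ_k)`. -/
inductive RootRel : D.U → D.U → Prop
  | root (k : Fin t) (i j : Fin (n k + 1)) (hij : i < j) :
      RootRel (D.e k i j ^ D.N k) (D.groupAlgebraToU (D.u k (γ k) i j))

/-- The algebra `𝓐(𝓓, γ)`, the quotient of `𝔘(𝓓)` by the ideal generated by the root vector
relations. -/
abbrev A : Type _ := RingQuot (D.RootRel γ)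

/-- The projection `𝔘(𝓓) → 𝓐(𝓓, γ)`. -/
def proj : D.U →ₐ[K] D.A γ := RingQuot.mkAlgHom K (D.RootRel γ)

end

end LinkingDatum

/-- For elements `y_x` (`x ∈ Γ`) and `a_i` (`i` a vertex) of a Hopf algebra `B`, the coproduct
formulas `Δ(y_x) = y_x ⊗ y_x` and `Δ(a_i) = a_i ⊗ 1 + y_{g_i} ⊗ a_i`. -/
structure LinkingDatum.CoproductFormulas {K Γ : Type*} [Field K] [CommGroup Γ] {t : ℕ}
    {n : Fin t → ℕ} (D : LinkingDatum K Γ n) {B : Type*} [Semiring B] [HopfAlgebra K B]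
    (y : Γ → B) (a : DiagramVertex n → B) : Prop where
  comul_grp : ∀ x : Γ, Coalgebra.comul (R := K) (y x) = y x ⊗ₜ[K] y x
  comul_gen : ∀ i, Coalgebra.comul (R := K) (a i) = a i ⊗ₜ[K] (1 : B) + y (D.g i) ⊗ₜ[K] a i

/-! Hopf structure. Almost every relation used says that two elements commute up to a scalar. The
coproduct of a root vector is $\Delta(e_{i,j})=\sum_{i\le m\le j}c_m\,e_{i,m}g_{m,j}\otimes e_{m,j}$
with $c_m=1-q^{-1}$ for $i<m<j$ and $c_m=1$ at the ends (`rootVec_add`). Its summands $q$-commute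
and $q$ has order $N$, so the $N$-th power is the sum of the $N$-th powers
(`SerreA.rootVec_add_pow`); its coefficients are the $C^j_{i,m}$. The recursion for $u_{i,j}$ gives
the coproduct of $u_{i,j}$ the same shape (`comul_u`), so the relations $e_{i,j}^N=u_{i,j}$ are
compatible with $\Delta$. The antipode respects them too: its defining identity, applied to both
sides, determines its values by induction.

Basis of $\mathfrak U(\mathcal D)$. The ordered monomials in the root vectors, times $\Gamma$, span
by straightening (`span_mono_mul_grp`). Their independence (`linearIndependent_mono`) is proved with
explicit representations, all assembled by one principle, `Rep.add`: if two families satisfy the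
relations and skew-commute with each other in the right way, so does their sum. (a) Without linking,
take one variable $x_s$ of a skew polynomial ring for each positive root $s$, and let $a_i$ be the
sum of the $x_s$ over the roots $s$ with lowest vertex $i$, weighted by powers of an auxiliary
indeterminate. The leading coefficient of $e_{i,j}$ is then a nonzero multiple of the monomial
$x_{i,j}x_{i+1,j}\cdots x_{j-1,j}$, and the exponents of these monomials are triangular
(`linearIndependent_shift`). (b) The relations with constant right-hand side $\lambda_{ij}$ in place
of $\lambda_{ij}(1-g_ig_j)$ have a Fock representation on the unlinked algebra: some components act
by multiplication, the others by skew derivations (`exists_rep_const`). (c) If $E$ is the algebra of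
(b) and $R_0$ that of (a), then $a_i\otimes1\otimes1+g_i\otimes a_i\otimes1+g_i\otimes g_i\otimes
S(a_i)$ in $E\otimes R_0\otimes E^{op}$ satisfies the relations of $\mathfrak U(\mathcal D)$, where
$S(a)=-g^{-1}a$. Scaling the middle summand by an indeterminate and taking leading coefficients
reduces independence to (a).

Passage to $\mathcal A(\mathcal D,\gamma)$. Each $e_\alpha^N$ skew-commutes with all generators,
also with linked ones (`Rep.gen_rv_pow`). By admissibility $u_\alpha$ is central, and it vanishes if
$\chi_\alpha^N\ne1$. Hence each $e_\alpha^N-u_\alpha$ is a normal element, and reducing exponents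
modulo $N$ is a well-defined linear map that kills the ideal. The monomials with all exponents below
$N$ therefore form a basis of the quotient, and there is one root for each pair $i<j$ in each
component. -/

open Finset

/-! ### Elements that commute up to a scalar. -/

section QComm

variable {K R S : Type*} [Field K] [Ring R] [Algebra K R] [Ring S] [Algebra K S]

/-- `x` and `y` commute up to the scalar `c`: `x y = c y x`. -/
def QComm (c : K) (x y : R) : Prop := x * y = c • (y * x)

namespace QComm

variable {c d : K} {x y z : R}

theorem mul_right (h : QComm c x y) (h' : QComm d x z) : QComm (c * d) x (y * z) := by
  unfold QComm at *
  rw [← mul_assoc, h, smul_mul_assoc, mul_assoc, h', mul_smul_comm, smul_smul, mul_assoc]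

theorem mul_left (h : QComm c x z) (h' : QComm d y z) : QComm (c * d) (x * y) z := by
  unfold QComm at *
  rw [mul_assoc, h', mul_smul_comm, ← mul_assoc, h, smul_mul_assoc, smul_smul, mul_assoc, mul_comm]

theorem one_right (x : R) : QComm (1 : K) x 1 := by simp [QComm]

theorem one_left (x : R) : QComm (1 : K) 1 x := by simp [QComm]

theorem refl (x : R) : QComm (1 : K) x x := by simp [QComm]

theorem zero_left (c : K) (x : R) : QComm c 0 x := by simp [QComm]

theorem zero_right (c : K) (x : R) : QComm c x 0 := by simp [QComm]

theorem pow_right (h : QComm c x y) (n : ℕ) : QComm (c ^ n) x (y ^ n) := by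
  induction n with
  | zero => simpa using one_right x
  | succ n ih => simpa only [pow_succ] using ih.mul_right h

theorem pow_left (h : QComm c x y) (n : ℕ) : QComm (c ^ n) (x ^ n) y := by
  induction n with
  | zero => simpa using one_left y
  | succ n ih => simpa only [pow_succ] using ih.mul_left h

theorem symm (hc : c ≠ 0) (h : QComm c x y) : QComm c⁻¹ y x := by
  unfold QComm at *
  rw [h, smul_smul, inv_mul_cancel₀ hc, one_smul]

theorem sub_right (h : QComm c x y) (h' : QComm c x z) : QComm c x (y - z) := by
  unfold QComm at *
  rw [mul_sub, sub_mul, h, h', smul_sub]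

theorem sub_left (h : QComm c x z) (h' : QComm c y z) : QComm c (x - y) z := by
  unfold QComm at *
  rw [mul_sub, sub_mul, h, h', smul_sub]

theorem smul_right (h : QComm c x y) (a : K) : QComm c x (a • y) := by
  unfold QComm at *
  rw [mul_smul_comm, smul_mul_assoc, h, smul_comm]

theorem smul_left (h : QComm c x y) (a : K) : QComm c (a • x) y := by
  unfold QComm at *
  rw [mul_smul_comm, smul_mul_assoc, h, smul_comm]

theorem sum_left {ι : Type*} {s : Finset ι} {f : ι → R} (h : ∀ i ∈ s, QComm c (f i) y) :
    QComm c (∑ i ∈ s, f i) y := by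
  unfold QComm at *
  rw [sum_mul, mul_sum, smul_sum]
  exact sum_congr rfl h

theorem sum_right {ι : Type*} {s : Finset ι} {f : ι → R} (h : ∀ i ∈ s, QComm c x (f i)) :
    QComm c x (∑ i ∈ s, f i) := by
  unfold QComm at *
  rw [sum_mul, mul_sum, smul_sum]
  exact sum_congr rfl h

theorem map (f : R →ₐ[K] S) (h : QComm c x y) : QComm c (f x) (f y) := by
  unfold QComm at *
  rw [← map_mul, h, map_smul, map_mul]

theorem of_eq (h : QComm c x y) (hc : c = d) : QComm d x y := hc ▸ h

/-- `(xy)^n = c^(n choose 2) x^n y^n` when `y x = c x y`. -/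
theorem mul_pow (h : QComm c y x) (n : ℕ) :
    (x * y) ^ n = c ^ n.choose 2 • (x ^ n * y ^ n) := by
  induction n with
  | zero => simp
  | succ n ih =>
    have h1 : y ^ n * x = c ^ n • (x * y ^ n) := h.pow_left n
    rw [pow_succ, ih, smul_mul_assoc, mul_assoc, ← mul_assoc (y ^ n), h1, smul_mul_assoc,
      mul_smul_comm, smul_smul, ← pow_add, Nat.choose_succ_succ' n 1, Nat.choose_one_right,
      add_comm n, pow_succ x, pow_succ y]
    simp only [mul_assoc]

end QComm

/-! ### Gaussian binomials and powers of sums at a root of unity. -/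

/-- The Gaussian binomial coefficients. -/
def gaussBinom (q : K) : ℕ → ℕ → K
  | _, 0 => 1
  | 0, _ + 1 => 0
  | n + 1, k + 1 => gaussBinom q n k + q ^ (k + 1) * gaussBinom q n (k + 1)

@[simp] theorem gaussBinom_zero_right (q : K) (n : ℕ) : gaussBinom q n 0 = 1 := by
  cases n <;> rfl

theorem gaussBinom_eq_zero (q : K) : ∀ {n k : ℕ}, n < k → gaussBinom q n k = 0
  | 0, k + 1, _ => rfl
  | n + 1, k + 1, h => by
    rw [gaussBinom, gaussBinom_eq_zero q (Nat.lt_of_succ_lt_succ h),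
      gaussBinom_eq_zero q (Nat.lt_of_succ_lt h)]
    simp

theorem gaussBinom_self (q : K) (n : ℕ) : gaussBinom q n n = 1 := by
  induction n with
  | zero => rfl
  | succ n ih => rw [gaussBinom, ih, gaussBinom_eq_zero q n.lt_succ_self]; simp

/-- The ratio of consecutive Gaussian binomials, multiplied by $q^k$ to avoid the exponent $n-k$.
For $q^N=1$ it propagates the vanishing from one inner coefficient to the next. -/
theorem gaussBinom_step (q : K) (n : ℕ) : ∀ k : ℕ,
    q ^ k * (1 - q ^ (k + 1)) * gaussBinom q n (k + 1) = (q ^ k - q ^ n) * gaussBinom q n k := by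
  induction n with
  | zero =>
    intro k
    cases k <;> simp [gaussBinom]
  | succ n ih =>
    intro k
    cases k with
    | zero =>
      have h := ih 0
      simp only [gaussBinom, gaussBinom_zero_right] at h ⊢
      linear_combination q * h
    | succ k =>
      have h0 := ih k
      have h1 := ih (k + 1)
      simp only [gaussBinom] at h0 h1 ⊢
      linear_combination q ^ (k + 2) * h1 + q * h0

theorem gaussBinom_eq_zero_of_orderOf {q : K} {N : ℕ} (hq : orderOf q = N) {k : ℕ} (hk : k + 1 < N) :
    gaussBinom q N (k + 1) = 0 := by
  have hN : q ^ N = 1 := hq ▸ pow_orderOf_eq_one q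
  have hq0 : q ≠ 0 := by
    rintro rfl
    rw [zero_pow (by omega)] at hN
    exact zero_ne_one hN
  induction k with
  | zero =>
    have h := gaussBinom_step q N 0
    have h1 : (1 : K) - q ^ 1 ≠ 0 := fun e => by
      have := orderOf_le_of_pow_eq_one one_pos (sub_eq_zero.mp e).symm
      omega
    rw [hN] at h
    simp only [pow_zero, sub_self, zero_mul, one_mul] at h
    exact (mul_eq_zero.mp h).resolve_left h1
  | succ k ih =>
    have h := gaussBinom_step q N (k + 1)
    rw [ih (by omega), mul_zero] at h
    refine (mul_eq_zero.mp h).resolve_left (mul_ne_zero (pow_ne_zero _ hq0) fun e => ?_)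
    have := orderOf_le_of_pow_eq_one (Nat.succ_pos _) (sub_eq_zero.mp e).symm
    omega

/-- The new factor is put on the left: moving $y$ past $x^{k+1}$ produces the $q^{k+1}$ of the
Pascal rule. -/
theorem QComm.add_pow {q : K} {x y : R} (h : QComm q y x) (n : ℕ) :
    (x + y) ^ n = ∑ k ∈ range (n + 1), gaussBinom q n k • (x ^ k * y ^ (n - k)) := by
  induction n with
  | zero => simp
  | succ n ih =>
    have hx : ∀ k, y * (x ^ k * y ^ (n - k)) = q ^ k • (x ^ k * (y * y ^ (n - k))) := fun k => by
      have h1 : y * x ^ k = q ^ k • (x ^ k * y) := h.pow_right k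
      rw [← mul_assoc, h1, smul_mul_assoc, mul_assoc]
    rw [_root_.pow_succ', ih, add_mul, mul_sum, mul_sum, sum_range_succ' _ (n + 1)]
    have e1 : ∀ k ∈ range (n + 1), gaussBinom q (n + 1) (k + 1) • (x ^ (k + 1) * y ^ (n + 1 - (k + 1)))
        = x * gaussBinom q n k • (x ^ k * y ^ (n - k)) +
          (q ^ (k + 1) * gaussBinom q n (k + 1)) • (x ^ (k + 1) * y ^ (n - k)) := fun k _ => by
      rw [gaussBinom, add_smul, mul_smul_comm, ← mul_assoc, ← _root_.pow_succ', Nat.add_sub_add_right]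
    rw [sum_congr rfl e1, sum_add_distrib, add_assoc]
    congr 1
    have e2 := sum_range_succ (fun k => (q ^ (k + 1) * gaussBinom q n (k + 1)) •
      (x ^ (k + 1) * y ^ (n - k))) n
    rw [e2, gaussBinom_eq_zero q n.lt_succ_self, sum_range_succ' _ n]
    simp only [mul_zero, zero_smul, add_zero, gaussBinom_zero_right, pow_zero, one_mul, one_smul,
      Nat.sub_zero, ← _root_.pow_succ']
    congr 1
    refine sum_congr rfl fun k hk => ?_
    have hk' : n - k = n - (k + 1) + 1 := by have := mem_range.mp hk; omega
    rw [mul_smul_comm, hx, smul_smul, ← _root_.pow_succ', hk', mul_comm]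

/-- The freshman's dream for `q`-commuting elements at a root of unity. -/
theorem QComm.add_pow_orderOf {q : K} {N : ℕ} (hq : orderOf q = N) (hN : 0 < N) {x y : R}
    (h : QComm q y x) : (x + y) ^ N = x ^ N + y ^ N := by
  obtain ⟨M, rfl⟩ : ∃ M, N = M + 1 := ⟨N - 1, by omega⟩
  rw [h.add_pow, sum_range_succ, sum_range_succ', sum_eq_zero]
  · simp [gaussBinom_self, add_comm]
  · intro k hk
    rw [gaussBinom_eq_zero_of_orderOf hq (by have := mem_range.mp hk; omega), zero_smul]

theorem QComm.sum_pow_orderOf {q : K} {N : ℕ} (hq : orderOf q = N) (hN : 0 < N) (f : ℕ → R) (m : ℕ)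
    (h : ∀ a b, a < b → b < m → QComm q (f a) (f b)) :
    (∑ a ∈ range m, f a) ^ N = ∑ a ∈ range m, f a ^ N := by
  induction m with
  | zero => simp [zero_pow hN.ne']
  | succ m ih =>
    rw [sum_range_succ, add_comm, QComm.add_pow_orderOf hq hN, ih, sum_range_succ, add_comm]
    · exact fun a b hab hb => h a b hab (by omega)
    · exact QComm.sum_left fun a ha => h a m (mem_range.mp ha) (by omega)

/-- While $b$ moves through $e^n$, the term $v_i$ created after $k$ steps carries $s^k$ and must
still pass $n-1-k$ factors $e$. The coefficient collected is a geometric sum, which vanishes in the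
applications. -/
theorem mul_pow_eq_of_mul_eq {s : K} {b e : R} (n : ℕ) {ι : Type*} {t : Finset ι} {v : ι → R}
    {o : ι → K} (h : b * e = s • (e * b) + ∑ i ∈ t, v i) (hv : ∀ i ∈ t, QComm (o i) (v i) e) :
    b * e ^ n = s ^ n • (e ^ n * b) +
      ∑ i ∈ t, (∑ k ∈ range n, s ^ k * o i ^ (n - 1 - k)) • (e ^ (n - 1) * v i) := by
  induction n with
  | zero => simp
  | succ n ih =>
    rw [pow_succ, ← mul_assoc, ih, add_mul, smul_mul_assoc, mul_assoc, h, mul_add, mul_smul_comm,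
      smul_add, smul_smul, ← pow_succ, ← mul_assoc, ← pow_succ, add_assoc, Finset.sum_mul, mul_sum,
      smul_sum, ← sum_add_distrib]
    congr 1
    refine sum_congr rfl fun i hi => ?_
    have h1 : v i * e = o i • (e * v i) := hv i hi
    rw [sum_range_succ]
    simp only [Nat.add_sub_cancel, Nat.sub_self, pow_zero, mul_one, smul_mul_assoc, mul_assoc, h1,
      mul_smul_comm, smul_smul]
    rw [add_smul, add_comm]
    congr 1
    rw [sum_mul]
    cases n with
    | zero => simp
    | succ n =>
      rw [← mul_assoc, Nat.add_sub_cancel, ← pow_succ]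
      congr 1
      refine sum_congr rfl fun k hk => ?_
      have hk' : n + 1 - k = n - k + 1 := by have := mem_range.mp hk; omega
      rw [hk', mul_assoc, ← pow_succ]

/-- If `b e = s e b + ∑ v_i`, where each `v_i` commutes with `e` up to a scalar `o_i ≠ s` with
`o_i ^ N = s ^ N`, then `b` commutes with `e ^ N` up to the scalar `s ^ N`. -/
theorem QComm.pow_right_of_sum {s : K} {b e : R} {N : ℕ} {ι : Type*} {t : Finset ι} {v : ι → R}
    {o : ι → K} (h : b * e = s • (e * b) + ∑ i ∈ t, v i) (hv : ∀ i ∈ t, QComm (o i) (v i) e)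
    (hne : ∀ i ∈ t, o i ≠ s) (hN : ∀ i ∈ t, o i ^ N = s ^ N) : QComm (s ^ N) b (e ^ N) := by
  unfold QComm
  rw [mul_pow_eq_of_mul_eq N h hv, sum_eq_zero, add_zero]
  intro i hi
  -- The coefficient equals $(s^N-o_i^N)/(s-o_i)$.
  rw [(Commute.all s (o i)).geom_sum₂ (sub_ne_zero.mp (sub_ne_zero.mpr (hne i hi).symm)), hN i hi,
    sub_self, zero_div, zero_smul]

theorem QComm.pow_right_of_add {s o : K} {b e v : R} {N : ℕ} (h : b * e = s • (e * b) + v)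
    (hv : QComm o v e) (hne : o ≠ s) (hN : o ^ N = s ^ N) : QComm (s ^ N) b (e ^ N) :=
  QComm.pow_right_of_sum (t := ({()} : Finset Unit)) (v := fun _ => v) (o := fun _ => o)
    (by simpa using h) (by simpa using hv) (by simpa using hne) (by simpa using hN)

end QComm

/-! ### The bicharacter of a braiding of type A. -/

section Bichar

variable {K : Type*} [Field K]

/-- The bicharacter with matrix `p`, evaluated on the sums of the simple roots in `[i, j)` and
in `[k, l)`. -/
def bichar (p : ℕ → ℕ → K) (i j k l : ℕ) : K := ∏ a ∈ Ico i j, ∏ b ∈ Ico k l, p a b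

variable {p : ℕ → ℕ → K}

@[simp] theorem bichar_self_left (i k l : ℕ) : bichar p i i k l = 1 := by simp [bichar]

@[simp] theorem bichar_self_right (i j k : ℕ) : bichar p i j k k = 1 := by simp [bichar]

@[simp] theorem bichar_single (i k : ℕ) : bichar p i (i + 1) k (k + 1) = p i k := by simp [bichar]

theorem bichar_left {i m j : ℕ} (h : i ≤ m) (h' : m ≤ j) (k l : ℕ) :
    bichar p i j k l = bichar p i m k l * bichar p m j k l :=
  (prod_Ico_consecutive _ h h').symm

theorem bichar_right {k m l : ℕ} (h : k ≤ m) (h' : m ≤ l) (i j : ℕ) :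
    bichar p i j k l = bichar p i j k m * bichar p i j m l := by
  simp only [bichar, ← prod_mul_distrib, prod_Ico_consecutive _ h h']

theorem bichar_eq_prod_left (i j m : ℕ) : bichar p i j m (m + 1) = ∏ a ∈ Ico i j, p a m := by
  simp [bichar]

theorem bichar_eq_prod_right (i j m : ℕ) : bichar p m (m + 1) i j = ∏ a ∈ Ico i j, p m a := by
  simp [bichar]

theorem bichar_eq_prod_bichar_left (i j k l : ℕ) :
    bichar p i j k l = ∏ a ∈ Ico i j, bichar p a (a + 1) k l := by
  simp [bichar]

theorem bichar_eq_prod_bichar_right (i j k l : ℕ) :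
    bichar p i j k l = ∏ a ∈ Ico k l, bichar p i j a (a + 1) := by
  simp only [bichar, Nat.Ico_succ_singleton, prod_singleton]
  exact prod_comm

/-- The braiding matrix `p` is of type `A_∞` with parameter `q`. -/
structure BraidA (q : K) (p : ℕ → ℕ → K) : Prop where
  ne_zero : ∀ l m, p l m ≠ 0
  one_add_ne_zero : 1 + q ≠ 0
  diag : ∀ l, p l l = q
  adj : ∀ l, p l (l + 1) * p (l + 1) l = q⁻¹
  far : ∀ l m, l + 2 ≤ m → p l m * p m l = 1

namespace BraidA

variable {q : K} (B : BraidA q p)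
include B

theorem q_ne_zero : q ≠ 0 := B.diag 0 ▸ B.ne_zero 0 0

theorem bichar_ne_zero (i j k l : ℕ) : bichar p i j k l ≠ 0 :=
  prod_ne_zero_iff.mpr fun _ _ => prod_ne_zero_iff.mpr fun _ _ => B.ne_zero _ _

theorem bichar_far {i j k l : ℕ} (h : j < k) : bichar p i j k l * bichar p k l i j = 1 := by
  have e : bichar p k l i j = ∏ a ∈ Ico i j, ∏ b ∈ Ico k l, p b a := prod_comm
  rw [e, bichar, ← prod_mul_distrib]
  refine prod_eq_one fun a ha => ?_
  rw [← prod_mul_distrib]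
  refine prod_eq_one fun b hb => B.far a b ?_
  have := mem_Ico.mp ha
  have := mem_Ico.mp hb
  omega

/-- Only the two simple roots that meet at $j$ are adjacent in the diagram; all other pairs
contribute $1$. -/
theorem bichar_adj {i j k : ℕ} (h : i < j) (h' : j < k) :
    bichar p i j j k * bichar p j k i j = q⁻¹ := by
  obtain ⟨m, rfl⟩ : ∃ m, j = m + 1 := ⟨j - 1, by omega⟩
  have h1 : i ≤ m := by omega
  rw [bichar_left h1 (by omega : m ≤ m + 1) (m + 1) k, bichar_right h1 (by omega : m ≤ m + 1) _ _,
    bichar_right (by omega : m + 1 ≤ m + 1 + 1) (by omega : m + 1 + 1 ≤ k) m (m + 1),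
    bichar_left (by omega : m + 1 ≤ m + 1 + 1) (by omega : m + 1 + 1 ≤ k) m (m + 1), bichar_single,
    bichar_single]
  have e1 := B.bichar_far (i := i) (j := m) (k := m + 1) (l := k) (by omega)
  have e2 := B.bichar_far (i := m) (j := m + 1) (k := m + 1 + 1) (l := k) (by omega)
  have e3 := B.adj m
  calc _ = (bichar p i m (m + 1) k * bichar p (m + 1) k i m) *
      (bichar p m (m + 1) (m + 1 + 1) k * bichar p (m + 1 + 1) k m (m + 1)) *
      (p m (m + 1) * p (m + 1) m) := by ring
    _ = _ := by rw [e1, e2, e3, one_mul, one_mul]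

/-- The $j-i$ diagonal factors $q$ are compensated, all but one, by the $j-i-1$ adjacent pairs, each
contributing $q^{-1}$. -/
theorem bichar_self {i j : ℕ} (h : i < j) : bichar p i j i j = q := by
  induction j, h using Nat.le_induction with
  | base => rw [bichar_single, B.diag]
  | succ j hj ih =>
    rw [bichar_left (by omega : i ≤ j) (by omega : j ≤ j + 1),
      bichar_right (by omega : i ≤ j) (by omega : j ≤ j + 1) i,
      bichar_right (by omega : i ≤ j) (by omega : j ≤ j + 1) j, ih, bichar_single, B.diag]
    have e := B.bichar_adj (by omega : i < j) (by omega : j < j + 1)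
    have hq := B.q_ne_zero
    calc _ = q * q * (bichar p i j j (j + 1) * bichar p j (j + 1) i j) := by ring
      _ = _ := by rw [e]; field_simp

end BraidA

end Bichar

/-! ### Root vectors, quantum Serre relations, and the coproduct formula. -/

section RootVec

variable {K R S : Type*} [Field K] [Ring R] [Algebra K R] [Ring S] [Algebra K S]

/-- The root vectors `e_{i,j}` of type `A` attached to the braiding matrix `p` and the elements
`x_l`; the value for `j ≤ i` is `1`. -/
def rootVec (p : ℕ → ℕ → K) (x : ℕ → R) (i : ℕ) : ℕ → R
  | 0 => 1
  | j + 1 => if j < i then 1 else if i = j then x j else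
      rootVec p x i j * x j - bichar p i j j (j + 1) • (x j * rootVec p x i j)

variable {p : ℕ → ℕ → K} {x : ℕ → R}

theorem rootVec_of_le {i j : ℕ} (h : j ≤ i) : rootVec p x i j = 1 := by
  cases j with
  | zero => rfl
  | succ j => rw [rootVec, if_pos (by omega)]

@[simp] theorem rootVec_self (i : ℕ) : rootVec p x i i = 1 := rootVec_of_le le_rfl

@[simp] theorem rootVec_single (i : ℕ) : rootVec p x i (i + 1) = x i := by simp [rootVec]

theorem rootVec_succ {i j : ℕ} (h : i < j) : rootVec p x i (j + 1) =
    rootVec p x i j * x j - bichar p i j j (j + 1) • (x j * rootVec p x i j) := by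
  rw [rootVec, if_neg (by omega), if_neg (by omega)]

theorem rootVec_map (f : R →ₐ[K] S) (i j : ℕ) :
    f (rootVec p x i j) = rootVec p (fun l => f (x l)) i j := by
  induction j with
  | zero => simp [rootVec]
  | succ j ih =>
    rw [rootVec, rootVec]
    split_ifs <;> simp [ih]

theorem rootVec_eq_zero {i j : ℕ} (h : i ≤ j) (hx : x j = 0) : rootVec p x i (j + 1) = 0 := by
  rw [rootVec, if_neg (by omega), hx]
  simp

theorem rootVec_qcomm_left {c : ℕ → K} {y : R} {i j : ℕ}
    (h : ∀ l, i ≤ l → l < j → QComm (c l) (x l) y) :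
    QComm (∏ l ∈ Ico i j, c l) (rootVec p x i j) y := by
  rcases le_or_gt j i with hij | hij
  · rw [rootVec_of_le hij, Ico_eq_empty (by omega), prod_empty]
    exact QComm.one_left y
  induction j, hij using Nat.le_induction with
  | base => simpa using h i le_rfl (by omega)
  | succ j hj ih =>
    have h1 := ih fun l hl hl' => h l hl (by omega)
    have h2 := h j (by omega) (by omega)
    rw [prod_Ico_succ_top (by omega), rootVec_succ (by omega)]
    exact (h1.mul_left h2).sub_left (((h2.mul_left h1).of_eq (mul_comm _ _)).smul_left _)

theorem rootVec_qcomm_right {c : ℕ → K} {y : R} {i j : ℕ}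
    (h : ∀ l, i ≤ l → l < j → QComm (c l) y (x l)) :
    QComm (∏ l ∈ Ico i j, c l) y (rootVec p x i j) := by
  rcases le_or_gt j i with hij | hij
  · rw [rootVec_of_le hij, Ico_eq_empty (by omega), prod_empty]
    exact QComm.one_right y
  induction j, hij using Nat.le_induction with
  | base => simpa using h i le_rfl (by omega)
  | succ j hj ih =>
    have h1 := ih fun l hl hl' => h l hl (by omega)
    have h2 := h j (by omega) (by omega)
    rw [prod_Ico_succ_top (by omega), rootVec_succ (by omega)]
    exact (h1.mul_right h2).sub_right (((h2.mul_right h1).of_eq (mul_comm _ _)).smul_right _)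

/-- The quantum Serre relations of type `A_∞`. -/
structure SerreA (q : K) (p : ℕ → ℕ → K) (x : ℕ → R) : Prop where
  far : ∀ l m, l + 2 ≤ m → QComm (p l m) (x l) (x m)
  up : ∀ l, x l * x l * x (l + 1) - ((1 + q) * p l (l + 1)) • (x l * x (l + 1) * x l) +
    (q * p l (l + 1) ^ 2) • (x (l + 1) * x l * x l) = 0
  down : ∀ l, x (l + 1) * x (l + 1) * x l -
    ((1 + q) * p (l + 1) l) • (x (l + 1) * x l * x (l + 1)) +
    (q * p (l + 1) l ^ 2) • (x l * x (l + 1) * x (l + 1)) = 0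

/-- The rank three computation on which all commutation relations of root vectors rest: the triple
bracket of $x,y,z$ commutes with its middle letter up to a scalar. The Serre relations give only
$(1+q)$ times the identity, hence the condition $1+q\ne0$. -/
theorem qcomm_of_serre_triple {q a b c : K} {x y z : R} (hq : 1 + q ≠ 0) (hb : b ≠ 0)
    (hC : QComm (q * a) (x * y - a • (y * x)) y) (hD : QComm (q * b) y (y * z - b • (z * y)))
    (hF : QComm c x z) :
    QComm (a * b⁻¹) ((x * y - a • (y * x)) * z - (c * b) • (z * (x * y - a • (y * x)))) y := by
  unfold QComm at *
  have h1 := congrArg (fun t => z * t) hC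
  have h2 := congrArg (fun t => t * z) hC
  have h3 := congrArg (fun t => x * t) hD
  have h4 := congrArg (fun t => t * x) hD
  have h5 := congrArg (fun t => y * y * t) hF
  have h6 := congrArg (fun t => y * t * y) hF
  have h7 := congrArg (fun t => t * y * y) hF
  simp only [mul_sub, sub_mul, mul_smul_comm, smul_mul_assoc, mul_assoc, smul_sub, smul_smul]
    at h1 h2 h3 h4 h5 h6 h7 ⊢
  rw [← sub_eq_zero]
  refine (smul_eq_zero_iff_right hq).mp ?_
  linear_combination (norm := (match_scalars <;> field_simp <;> ring))
    (-(c * b)) • h1 + b⁻¹ • h2 - b⁻¹ • h3 + (a ^ 2 * c * b⁻¹) • h4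
    + (a ^ 2 * b⁻¹) • h5 - (a * (1 + q)) • h6 + (q * b) • h7

namespace SerreA

variable {q : K}

theorem qcomm_row_two (H : SerreA q p x) (l : ℕ) : QComm (q * p l (l + 1)) (x l) (rootVec p x l (l + 1 + 1)) := by
  have h := H.up l
  rw [rootVec_succ (by omega), rootVec_single, bichar_single, QComm]
  simp only [mul_sub, sub_mul, mul_smul_comm, smul_mul_assoc, mul_assoc, smul_sub, smul_smul] at h ⊢
  linear_combination (norm := module) h

variable (B : BraidA q p) (H : SerreA q p x)
include B H

theorem qcomm_far_left {i j m : ℕ} (h : m + 1 < i ∨ j < m) :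
    QComm (bichar p i j m (m + 1)) (rootVec p x i j) (x m) := by
  rw [bichar_eq_prod_left]
  refine rootVec_qcomm_left fun l hl hl' => ?_
  rcases h with h | h
  · have h1 := B.far m l (by omega)
    refine ((H.far m l (by omega)).symm (B.ne_zero _ _)).of_eq ?_
    exact inv_eq_of_mul_eq_one_right h1
  · exact H.far l m (by omega)

theorem qcomm_far_right {i j m : ℕ} (h : m + 1 < i ∨ j < m) :
    QComm (bichar p m (m + 1) i j) (x m) (rootVec p x i j) := by
  refine ((H.qcomm_far_left B h).symm (B.bichar_ne_zero _ _ _ _)).of_eq ?_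
  refine inv_eq_of_mul_eq_one_right ?_
  rcases h with h | h
  · rw [mul_comm]; exact B.bichar_far h
  · exact B.bichar_far h

/-- `e_{i,j} = e_{i,m} e_{m,j} - χ_{m,j}(g_{i,m}) e_{m,j} e_{i,m}`. -/
theorem rootVec_split {i m j : ℕ} (h : i < m) (h' : m < j) : rootVec p x i j =
    rootVec p x i m * rootVec p x m j -
      bichar p i m m j • (rootVec p x m j * rootVec p x i m) := by
  induction j, h' using Nat.le_induction with
  | base => rw [rootVec_succ h, rootVec_single]
  | succ j hj ih =>
    have hj' : m < j := hj
    rw [rootVec_succ (by omega), ih, rootVec_succ hj', bichar_left h.le hj'.le,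
      bichar_right hj'.le j.le_succ i m]
    have h1 : rootVec p x i m * x j = bichar p i m j (j + 1) • (x j * rootVec p x i m) :=
      H.qcomm_far_left B (Or.inr hj')
    have h2 := congrArg (fun t => rootVec p x m j * t) h1
    have h3 := congrArg (fun t => t * rootVec p x m j) h1
    simp only [mul_sub, sub_mul, mul_smul_comm, smul_mul_assoc, mul_assoc, smul_sub, smul_smul]
      at h2 h3 ⊢
    linear_combination (norm := module) (-bichar p i m m j) • h2 + bichar p m j j (j + 1) • h3

theorem qcomm_col_two (l : ℕ) : QComm (q * p l (l + 1)) (rootVec p x l (l + 1 + 1)) (x (l + 1)) := by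
  have hq := B.q_ne_zero
  have hp := B.ne_zero l (l + 1)
  have hp' := B.ne_zero (l + 1) l
  have h := H.down l
  have e : p (l + 1) l = q⁻¹ * (p l (l + 1))⁻¹ := by
    rw [← B.adj l]; field_simp
  rw [rootVec_succ (by omega), rootVec_single, bichar_single, QComm]
  rw [e] at h
  simp only [mul_sub, sub_mul, mul_smul_comm, smul_mul_assoc, mul_assoc, smul_sub, smul_smul] at h ⊢
  -- As $p_{l+1,l}=q^{-1}p_{l,l+1}^{-1}$, multiplication by $q\,p_{l,l+1}^2$ turns the coefficients
  -- of the second Serre relation into polynomials in $q$ and $p_{l,l+1}$.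
  have h2 := congrArg (fun t => (q * p l (l + 1) ^ 2) • t) h
  simp only [smul_sub, smul_add, smul_smul, smul_zero] at h2
  have e1 : q * p l (l + 1) ^ 2 * ((1 + q) * (q⁻¹ * (p l (l + 1))⁻¹)) = (1 + q) * p l (l + 1) := by
    field_simp
  have e2 : q * p l (l + 1) ^ 2 * (q * (q⁻¹ * (p l (l + 1))⁻¹) ^ 2) = 1 := by
    field_simp
  rw [e1, e2] at h2
  linear_combination (norm := module) h2

theorem qcomm_middle (l : ℕ) : QComm (p l (l + 1) * q * p (l + 2) (l + 1))
    (rootVec p x l (l + 3)) (x (l + 1)) := by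
  have h1 := H.qcomm_col_two B l
  have h2 := H.qcomm_row_two (l + 1)
  rw [rootVec_succ (by omega), rootVec_single, bichar_single] at h1 h2
  have h3 := H.far l (l + 2) le_rfl
  have h4 := qcomm_of_serre_triple B.one_add_ne_zero (B.ne_zero _ _) h1 h2 h3
  rw [rootVec_succ (by omega), rootVec_succ (by omega), rootVec_single, bichar_single,
    bichar_left (by omega : l ≤ l + 1) (by omega : l + 1 ≤ l + 2), bichar_single, bichar_single]
  refine h4.of_eq ?_
  have hq := B.q_ne_zero
  have hp := B.ne_zero (l + 1) (l + 2)
  have e := B.adj (l + 1)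
  have hp' : p (l + 2) (l + 1) = q⁻¹ * (p (l + 1) (l + 2))⁻¹ := by
    rw [← e]; field_simp
  rw [hp']
  field_simp

/-- `e_{i,j} x_l = χ_l(g_{i,j}) x_l e_{i,j}` for `i < l < j`. -/
theorem qcomm_col {i l j : ℕ} (h : i < l) (h' : l < j) :
    QComm (bichar p i j l (l + 1)) (rootVec p x i j) (x l) := by
  -- By `rootVec_split` the relation passes from two adjacent segments to their union. It remains to
  -- treat $e_{l-1,l+1}$ and $e_{l-1,l+2}$ against $x_l$; all other segments are far from $l$.
  have aux : ∀ {y : R} {i m j : ℕ}, i < m → m < j →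
      QComm (bichar p i m l (l + 1)) (rootVec p x i m) y →
      QComm (bichar p m j l (l + 1)) (rootVec p x m j) y →
      QComm (bichar p i j l (l + 1)) (rootVec p x i j) y := fun h h' h1 h2 => by
    rw [H.rootVec_split B h h', bichar_left h.le h'.le]
    exact (h1.mul_left h2).sub_left (((h2.mul_left h1).of_eq (mul_comm _ _)).smul_left _)
  obtain ⟨m, rfl⟩ : ∃ m, l = m + 1 := ⟨l - 1, by omega⟩
  have hstart : ∀ {j}, m + 1 < j →
      QComm (bichar p m j (m + 1) (m + 1 + 1)) (rootVec p x m j) (x (m + 1)) := fun {j} hj => by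
    rcases Nat.lt_or_ge j (m + 3) with h1 | h1
    · obtain rfl : j = m + 2 := by omega
      refine (H.qcomm_col_two B m).of_eq ?_
      rw [bichar_left (by omega : m ≤ m + 1) (by omega : m + 1 ≤ m + 2), bichar_single,
        bichar_single, B.diag, mul_comm]
    have h3 : QComm (bichar p m (m + 3) (m + 1) (m + 1 + 1)) (rootVec p x m (m + 3)) (x (m + 1)) := by
      refine (H.qcomm_middle B m).of_eq ?_
      rw [bichar_left (by omega : m ≤ m + 1) (by omega : m + 1 ≤ m + 3),
        bichar_left (by omega : m + 1 ≤ m + 2) (by omega : m + 2 ≤ m + 3), bichar_single,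
        bichar_single, bichar_single, B.diag, mul_assoc]
    rcases Nat.lt_or_ge (m + 3) j with h2 | h2
    · exact aux (by omega) h2 h3 (H.qcomm_far_left B (Or.inl (by omega)))
    · obtain rfl : j = m + 3 := by omega
      exact h3
  rcases Nat.lt_or_ge i m with h1 | h1
  · exact aux h1 (by omega) (H.qcomm_far_left B (Or.inr (by omega))) (hstart h')
  · obtain rfl : i = m := by omega
    exact hstart h'

/-- `x_l e_{i,j} = χ_{i,j}(g_l) e_{i,j} x_l` for `i ≤ l < j - 1`. -/
theorem qcomm_row {i l j : ℕ} (h : i ≤ l) (h' : l + 1 < j) :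
    QComm (bichar p l (l + 1) i j) (x l) (rootVec p x i j) := by
  rcases h.lt_or_eq with h | rfl
  · refine ((H.qcomm_col B h (by omega)).symm (B.bichar_ne_zero _ _ _ _)).of_eq ?_
    refine inv_eq_of_mul_eq_one_right ?_
    have e1 := B.bichar_adj h (by omega : l < l + 1)
    have e2 := B.bichar_adj (by omega : l < l + 1) h'
    have e3 := B.diag l
    have hq := B.q_ne_zero
    rw [bichar_left h.le (by omega : l ≤ j), bichar_right h.le (by omega : l ≤ j),
      bichar_left (by omega : l ≤ l + 1) (by omega : l + 1 ≤ j),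
      bichar_right (by omega : l ≤ l + 1) (by omega : l + 1 ≤ j) l (l + 1), bichar_single, e3]
    -- Two diagonal factors $q$ cancel against the neighbours of $l$ on either side, each
    -- contributing $q^{-1}$.
    calc _ = q * q * (bichar p i l l (l + 1) * bichar p l (l + 1) i l) *
        (bichar p l (l + 1) (l + 1) j * bichar p (l + 1) j l (l + 1)) := by ring
      _ = 1 := by rw [e1, e2]; field_simp
  · have h2 : QComm (bichar p i (i + 1) i (i + 2)) (x i) (rootVec p x i (i + 2)) := by
      refine (H.qcomm_row_two i).of_eq ?_
      rw [bichar_right (by omega : i ≤ i + 1) (by omega : i + 1 ≤ i + 2), bichar_single,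
        bichar_single, B.diag]
    rcases Nat.lt_or_ge (i + 2) j with h3 | h3
    · have h4 := H.qcomm_far_right B (i := i + 2) (j := j) (m := i) (Or.inl (by omega))
      rw [H.rootVec_split B (by omega : i < i + 2) h3,
        bichar_right (by omega : i ≤ i + 2) h3.le i (i + 1)]
      exact (h2.mul_right h4).sub_right (((h4.mul_right h2).of_eq (mul_comm _ _)).smul_right _)
    · obtain rfl : j = i + 2 := by omega
      exact h2

/-- `e_{i,j} e_{m,j} = χ_{m,j}(g_{i,j}) e_{m,j} e_{i,j}` for `i < m ≤ j`. -/
theorem qcomm_same_col {i m j : ℕ} (h : i < m) :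
    QComm (bichar p i j m j) (rootVec p x i j) (rootVec p x m j) := by
  rw [bichar_eq_prod_bichar_right]
  exact rootVec_qcomm_right fun l hl hl' => H.qcomm_col B (by omega) hl'

/-- `e_{i,m} e_{i,j} = χ_{i,j}(g_{i,m}) e_{i,j} e_{i,m}` for `i ≤ m < j`. -/
theorem qcomm_same_row {i m j : ℕ} (h : m < j) :
    QComm (bichar p i m i j) (rootVec p x i m) (rootVec p x i j) := by
  rw [bichar_eq_prod_bichar_left]
  exact rootVec_qcomm_left fun l hl hl' => H.qcomm_row B hl (by omega)

end SerreA

/-- The coefficients in the coproduct formula for root vectors. -/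
def comulCoeff (q : K) (i j m : ℕ) : K := if m = i ∨ m = j then 1 else 1 - q⁻¹

/-- The coproduct formula for root vectors. -/
theorem rootVec_add {q : K} (B : BraidA q p) {P Q : ℕ → R}
    (hP : ∀ l m, l + 2 ≤ m → QComm (p l m) (P l) (P m))
    (hQP : ∀ l m, QComm (p m l) (Q m) (P l)) {i j : ℕ} (hij : i < j) :
    rootVec p (fun l => P l + Q l) i j =
      ∑ m ∈ Ico i (j + 1), comulCoeff q i j m • (rootVec p P i m * rootVec p Q m j) := by
  induction j, hij using Nat.le_induction with
  | base =>
    rw [sum_Ico_succ_top (by omega), sum_Ico_succ_top (by omega)]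
    simp [comulCoeff, add_comm]
  | succ j hj ih =>
    have hij : i < j := hj
    rw [rootVec_succ hij, ih, sum_Ico_succ_top (by omega : i ≤ j + 1),
      sum_Ico_succ_top (by omega : i ≤ j), sum_Ico_succ_top (by omega : i ≤ j)]
    simp only [rootVec_self, rootVec_single, mul_one, mul_add, add_mul, sum_mul, mul_sum, smul_add,
      smul_sum]
    have hjP : ∀ m, m ≤ j → rootVec p Q m j * P j = bichar p m j j (j + 1) • (P j * rootVec p Q m j) :=
      fun m _ => by
        rw [bichar_eq_prod_left]
        exact rootVec_qcomm_left fun l _ _ => hQP j l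
    have hQj : ∀ m, Q j * rootVec p P i m = bichar p j (j + 1) i m • (rootVec p P i m * Q j) :=
      fun m => by
        rw [bichar_eq_prod_right]
        exact rootVec_qcomm_right fun l _ _ => hQP l j
    have hPj : ∀ m, m < j → rootVec p P i m * P j = bichar p i m j (j + 1) • (P j * rootVec p P i m) :=
      fun m hm => by
        rw [bichar_eq_prod_left]
        exact rootVec_qcomm_left fun l _ _ => hP l j (by omega)
    -- For $m<j$ the letter $P_j$ skew-commutes with the whole summand and drops out of the bracket,
    -- while $Q_j$ prolongs $e_{m,j}$ to $e_{m,j+1}$. The summand $m=j$, treated at the end, yields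
    -- the new summand $m=j+1$ and a multiple $1-q^{-1}$ of the summand $m=j$.
    have key : ∀ m ∈ Ico i j,
        comulCoeff q i j m • (rootVec p P i m * rootVec p Q m j) * P j +
        comulCoeff q i j m • (rootVec p P i m * rootVec p Q m j) * Q j -
        (bichar p i j j (j + 1) • (P j * comulCoeff q i j m • (rootVec p P i m * rootVec p Q m j)) +
        bichar p i j j (j + 1) • (Q j * comulCoeff q i j m • (rootVec p P i m * rootVec p Q m j))) =
        comulCoeff q i (j + 1) m • (rootVec p P i m * rootVec p Q m (j + 1)) := fun m hm => by
      obtain ⟨hm1, hm2⟩ := mem_Ico.mp hm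
      have ec : comulCoeff q i (j + 1) m = comulCoeff q i j m := by
        simp only [comulCoeff]
        congr 1
        simp only [eq_iff_iff]
        omega
      have e1 : rootVec p P i m * rootVec p Q m j * P j =
          bichar p i j j (j + 1) • (P j * (rootVec p P i m * rootVec p Q m j)) := by
        rw [mul_assoc, hjP m hm2.le, mul_smul_comm, ← mul_assoc, hPj m hm2, smul_mul_assoc,
          smul_smul, mul_assoc, bichar_left hm1 hm2.le, mul_comm (bichar p i m _ _)]
      have e2 : bichar p i j j (j + 1) • (Q j * (rootVec p P i m * rootVec p Q m j)) =
          bichar p m j j (j + 1) • (rootVec p P i m * (Q j * rootVec p Q m j)) := by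
        rw [← mul_assoc, hQj, smul_mul_assoc, smul_smul, mul_assoc, bichar_left hm1 hm2.le]
        congr 1
        linear_combination bichar p m j j (j + 1) * B.bichar_far hm2
      rw [ec, rootVec_succ hm2, mul_sub, mul_smul_comm (bichar p m j j (j + 1)), ← e2,
        smul_mul_assoc, smul_mul_assoc, e1]
      simp only [mul_smul_comm, smul_comm (bichar p i j j (j + 1)) (comulCoeff q i j m), smul_sub,
        mul_assoc]
      abel
    rw [← sum_congr rfl key, sum_sub_distrib, sum_add_distrib, sum_add_distrib]
    have c1 : comulCoeff q i j j = 1 := by simp [comulCoeff]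
    have c2 : comulCoeff q i (j + 1) (j + 1) = 1 := by simp [comulCoeff]
    have c3 : comulCoeff q i (j + 1) j = 1 - q⁻¹ := by
      rw [comulCoeff, if_neg (by omega)]
    rw [c1, c2, c3, one_smul, one_smul, rootVec_succ hij, hQj j]
    have e := B.bichar_adj hij (Nat.lt_succ_self j)
    rw [← e]
    module

end RootVec

/-! ### The powers $e_{i,j}^N$: their coproducts and commutation relations. -/

section RootVecPow

variable {K R : Type*} [Field K] [Ring R] [Algebra K R] {p : ℕ → ℕ → K} {q : K}

/-- This makes the $N$-th power additive on the coproduct. The four braidings involved combine to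
$q$, because a root braids with itself by $q$ and two adjacent roots contribute $q^{-1}$. -/
theorem SerreA.qcomm_comul_terms (B : BraidA q p) {P Q : ℕ → R} (HP : SerreA q p P)
    (HQ : SerreA q p Q) (hQP : ∀ l m, QComm (p m l) (Q m) (P l)) {i j a b : ℕ} (hia : i ≤ a)
    (hab : a < b) (hbj : b ≤ j) :
    QComm q (rootVec p P i a * rootVec p Q a j) (rootVec p P i b * rootVec p Q b j) := by
  have hx : ∀ c d, QComm (bichar p c j i d) (rootVec p Q c j) (rootVec p P i d) := fun c d => by
    rw [bichar_eq_prod_bichar_left]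
    refine rootVec_qcomm_left fun l _ _ => ?_
    rw [bichar_eq_prod_right]
    exact rootVec_qcomm_right fun m _ _ => hQP m l
  have h1 := HP.qcomm_same_row B (i := i) hab
  have h2 := (hx b a).symm (B.bichar_ne_zero _ _ _ _)
  have h3 := hx a b
  have h4 := HQ.qcomm_same_col B (j := j) hab
  refine ((h1.mul_right h2).mul_left (h3.mul_right h4)).of_eq ?_
  have hne := B.bichar_ne_zero b j i a
  have hq := B.q_ne_zero
  suffices h : bichar p i a i b * bichar p a j i b * bichar p a j b j = q * bichar p b j i a by
    field_simp
    linear_combination h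
  rw [← bichar_left hia (by omega : a ≤ j), bichar_left (by omega : i ≤ b) hbj,
    B.bichar_self (by omega : i < b), bichar_right hia hab.le b j, bichar_left hab.le hbj b j]
  rcases hbj.lt_or_eq with h | rfl
  · rw [B.bichar_self h]
    have e := B.bichar_adj hab h
    calc _ = q * bichar p b j i a * q * (bichar p a b b j * bichar p b j a b) := by ring
      _ = _ := by rw [e]; field_simp
  · simp

/-- The coproduct formula for the powers `e_{i,j} ^ N`. -/
theorem SerreA.rootVec_add_pow (B : BraidA q p) {P Q : ℕ → R} (HP : SerreA q p P)
    (HQ : SerreA q p Q) (hQP : ∀ l m, QComm (p m l) (Q m) (P l)) {N : ℕ} (hN : orderOf q = N)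
    (hN0 : 0 < N) {i j : ℕ} (hij : i < j) :
    rootVec p (fun l => P l + Q l) i j ^ N =
      ∑ m ∈ Ico i (j + 1), (comulCoeff q i j m ^ N * bichar p m j i m ^ N.choose 2) •
        (rootVec p P i m ^ N * rootVec p Q m j ^ N) := by
  rw [rootVec_add B HP.far hQP hij, sum_Ico_eq_sum_range,
    QComm.sum_pow_orderOf hN hN0, sum_Ico_eq_sum_range]
  · refine sum_congr rfl fun a ha => ?_
    have h : QComm (bichar p (i + a) j i (i + a)) (rootVec p Q (i + a) j)
        (rootVec p P i (i + a)) := by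
      rw [bichar_eq_prod_bichar_left]
      refine rootVec_qcomm_left fun l _ _ => ?_
      rw [bichar_eq_prod_right]
      exact rootVec_qcomm_right fun m _ _ => hQP m l
    rw [smul_pow, h.mul_pow, smul_smul]
  · intro a b hab hb
    exact ((HP.qcomm_comul_terms B HQ hQP (by omega) (by omega) (by omega)).smul_left _).smul_right _

namespace SerreA

variable (B : BraidA q p) {x : ℕ → R} (H : SerreA q p x)
include B H

/-- The powers `e_{i,j} ^ N` commute with the generators up to scalars. -/
theorem qcomm_pow {N : ℕ} (hN : q ^ N = 1) (hq1 : q ≠ 1) {i j : ℕ} (hij : i < j) (l : ℕ) :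
    QComm (bichar p l (l + 1) i j ^ N) (x l) (rootVec p x i j ^ N) := by
  have hq := B.q_ne_zero
  by_cases hfar : l + 1 < i ∨ j < l
  · exact (H.qcomm_far_right B hfar).pow_right N
  by_cases h1 : l + 1 = i
  -- Here $x_le_{l+1,j}=s\,e_{l+1,j}x_l+e_{l,j}$. The correction $e_{l,j}$ commutes with $e_{l+1,j}$
  -- up to $qs$, and $(qs)^N=s^N$, so it disappears from the $N$-th power. The case $l=j$ is
  -- similar, with $q^{-1}s$.
  · subst h1
    have h := H.rootVec_split B (i := l) (m := l + 1) (j := j) (by omega) hij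
    rw [rootVec_single] at h
    have h' : x l * rootVec p x (l + 1) j = bichar p l (l + 1) (l + 1) j •
        (rootVec p x (l + 1) j * x l) + rootVec p x l j := by rw [h]; abel
    have hne := B.bichar_ne_zero l (l + 1) (l + 1) j
    refine QComm.pow_right_of_add h' (H.qcomm_same_col B (by omega)) ?_ ?_
    · rw [bichar_left (by omega : l ≤ l + 1) (by omega : l + 1 ≤ j), B.bichar_self hij]
      intro e
      exact hq1 (mul_left_cancel₀ hne (by rw [e, mul_one]))
    · rw [bichar_left (by omega : l ≤ l + 1) (by omega : l + 1 ≤ j), B.bichar_self hij, mul_pow, hN,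
        mul_one]
  by_cases h2 : l = j
  · subst h2
    have hne := B.bichar_ne_zero i l l (l + 1)
    have h := rootVec_succ (p := p) (x := x) hij
    have h' : x l * rootVec p x i l = (bichar p i l l (l + 1))⁻¹ • (rootVec p x i l * x l) +
        (-(bichar p i l l (l + 1))⁻¹) • rootVec p x i (l + 1) := by
      rw [h, neg_smul, smul_sub, inv_smul_smul₀ hne]; abel
    have h3 := (H.qcomm_same_row B (i := i) (by omega : l < l + 1)).symm (B.bichar_ne_zero _ _ _ _)
    have e1 : bichar p i l i (l + 1) = q * bichar p i l l (l + 1) := by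
      rw [bichar_right hij.le (by omega : l ≤ l + 1), B.bichar_self hij]
    have h4 : (bichar p i l l (l + 1))⁻¹ ^ N = bichar p l (l + 1) i l ^ N := by
      have e := congrArg (· ^ N) (B.bichar_adj hij (by omega : l < l + 1))
      simp only [mul_pow, inv_pow, hN, inv_one] at e
      rw [inv_pow]
      exact inv_eq_of_mul_eq_one_right e
    rw [← h4]
    refine QComm.pow_right_of_add h' (h3.smul_left _) ?_ ?_
    · rw [e1]
      intro e
      rw [inv_inj] at e
      exact hq1 (mul_right_cancel₀ hne (by rw [e, one_mul]))
    · rw [e1, mul_inv, mul_pow, inv_pow q, hN, inv_one, one_mul]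
  by_cases h3 : l + 1 < j
  · exact (H.qcomm_row B (by omega) h3).pow_right N
  obtain rfl : j = l + 1 := by omega
  rcases (by omega : i = l ∨ i < l) with rfl | h4
  · rw [bichar_single, B.diag, hN, rootVec_single]
    exact ((QComm.refl (K := K) (x i)).pow_right N).of_eq (one_pow N)
  -- For the last letter $x_l$ of $e_{i,l+1}$ the commutation is exact already; its scalar agrees
  -- with the expected one only after raising to the power $N$.
  · refine ((((H.qcomm_col B h4 (by omega)).symm (B.bichar_ne_zero _ _ _ _)).pow_right N)).of_eq ?_
    have e := congrArg (· ^ N) (B.bichar_adj h4 (by omega : l < l + 1))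
    simp only [mul_pow, inv_pow, hN, inv_one] at e
    rw [inv_pow, bichar_left h4.le (by omega : l ≤ l + 1), bichar_right h4.le (by omega : l ≤ l + 1),
      bichar_single, B.diag, mul_pow, mul_pow, hN, mul_one, mul_one]
    exact inv_eq_of_mul_eq_one_right e

/-- This is the straightening rule for a generator to the left of column $j$: the correction term is
again a root vector of the column $j$. -/
theorem rootVec_mul_eq {i j l : ℕ} (hij : i < j) (hl : l + 1 < j) :
    ∃ c d : K, rootVec p x i j * x l = c • (x l * rootVec p x i j) + d • rootVec p x l j := by
  by_cases h1 : l + 1 = i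
  · subst h1
    have h := H.rootVec_split B (i := l) (m := l + 1) (j := j) (by omega) hij
    have hne := B.bichar_ne_zero l (l + 1) (l + 1) j
    refine ⟨(bichar p l (l + 1) (l + 1) j)⁻¹, -(bichar p l (l + 1) (l + 1) j)⁻¹, ?_⟩
    rw [h, rootVec_single, neg_smul, smul_sub, inv_smul_smul₀ hne]
    abel
  by_cases h2 : l + 1 < i
  · refine ⟨bichar p i j l (l + 1), 0, ?_⟩
    rw [zero_smul, add_zero]
    exact H.qcomm_far_left B (Or.inl h2)
  · refine ⟨(bichar p l (l + 1) i j)⁻¹, 0, ?_⟩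
    rw [zero_smul, add_zero]
    exact (H.qcomm_row B (by omega) hl).symm (B.bichar_ne_zero _ _ _ _)

/-- Commuting a linked generator `b` past a root vector: if `b x_l = s_l x_l b + c_l (1 - h_l)`,
where `h_l` acts as the product of `b` and `x_l`. -/
theorem linked_rootVec {b : R} {s c : ℕ → K} {h : ℕ → R}
    (hb : ∀ l, b * x l = s l • (x l * b) + c l • (1 - h l))
    (hh : ∀ l m, c l ≠ 0 → QComm (p l m * s m) (h l) (x m))
    (hs : ∀ l m, c l ≠ 0 → p m l = s m) {i j : ℕ} (hij : i < j) :
    ∃ A C : K, (c (j - 1) = 0 → A = 0) ∧ (c i = 0 → C = 0) ∧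
      b * rootVec p x i j = (∏ l ∈ Ico i j, s l) • (rootVec p x i j * b) +
        (A • (rootVec p x i (j - 1) * h (j - 1)) + C • rootVec p x (i + 1) j) := by
  induction j, hij using Nat.le_induction with
  | base =>
    -- For a single letter both corrections come from $c_i(1-h_i)$, since the empty root vectors are
    -- $1$.
    refine ⟨-c i, c i, fun e => by simpa using e, id, ?_⟩
    have hs : i.succ - 1 = i := rfl
    rw [Nat.succ_eq_add_one] at *
    rw [Nat.Ico_succ_singleton, prod_singleton, rootVec_single, hb, hs, rootVec_self,
      rootVec_of_le le_rfl, one_mul]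
    module
  | succ j hj ih =>
    have hij : i < j := hj
    obtain ⟨A, C, hA, hC, e⟩ := ih
    set σ := ∏ l ∈ Ico i j, s l with hσ
    -- The correction created by the new last letter $x_j$. If $c_j\ne0$, the two scalars agree, so
    -- the constant part of $1-h_j$ cancels in the bracket and only $h_j$ remains.
    have key1 : ∃ A' : K, (c j = 0 → A' = 0) ∧
        (σ * c j) • (rootVec p x i j * (1 - h j)) -
          (bichar p i j j (j + 1) * c j) • ((1 - h j) * rootVec p x i j) =
        A' • (rootVec p x i j * h j) := by
      by_cases hcj : c j = 0
      · exact ⟨0, fun _ => rfl, by simp [hcj]⟩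
      have h1 : h j * rootVec p x i j = (∏ m ∈ Ico i j, p j m * s m) • (rootVec p x i j * h j) :=
        rootVec_qcomm_right fun m _ _ => hh j m hcj
      have h2 : bichar p i j j (j + 1) = σ := by
        rw [bichar_eq_prod_left, hσ]
        exact prod_congr rfl fun m _ => hs j m hcj
      refine ⟨σ * c j * ((∏ m ∈ Ico i j, p j m * s m) - 1), fun e => absurd e hcj, ?_⟩
      rw [h2, mul_sub, sub_mul, h1]
      simp only [mul_one, one_mul]
      module
    -- The correction at the previous last letter skew-commutes with $x_j$, hence drops out of the
    -- bracket.
    have key2 : A • (rootVec p x i (j - 1) * h (j - 1)) * x j =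
        (bichar p i j j (j + 1) * s j * A) • (x j * (rootVec p x i (j - 1) * h (j - 1))) := by
      by_cases hcj : c (j - 1) = 0
      · simp [hA hcj]
      obtain ⟨m, rfl⟩ : ∃ m, j = m + 1 := ⟨j - 1, by omega⟩
      rw [Nat.add_sub_cancel] at hcj ⊢
      have h1 := (H.qcomm_far_left B (i := i) (j := m) (m := m + 1) (Or.inr (by omega))).mul_left
        (hh m (m + 1) hcj)
      unfold QComm at h1
      rw [smul_mul_assoc, h1, smul_smul, bichar_left (by omega : i ≤ m) (by omega : m ≤ m + 1),
        bichar_single]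
      congr 1
      ring
    -- The correction at the first letter is prolonged: bracketing $e_{i+1,j}$ with $x_j$ gives
    -- $e_{i+1,j+1}$. When $j=i+1$ it is the empty vector, and a factor $1-q^{-1}$ appears.
    have key3 : ∃ C' : K, (c i = 0 → C' = 0) ∧ C • rootVec p x (i + 1) j * x j -
        (bichar p i j j (j + 1) * s j * C) • (x j * rootVec p x (i + 1) j) =
        C' • rootVec p x (i + 1) (j + 1) := by
      by_cases hci : c i = 0
      · exact ⟨0, fun _ => rfl, by simp [hC hci]⟩
      have e1 : bichar p i j j (j + 1) * s j =
          bichar p (i + 1) j j (j + 1) * (p i j * p j i) := by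
        rw [← hs i j hci, bichar_left (by omega : i ≤ i + 1) hij, bichar_single]
        ring
      rcases (Nat.succ_le_of_lt hij).lt_or_eq with h1 | h1
      · refine ⟨C, fun e => absurd e hci, ?_⟩
        rw [e1, B.far i j (by omega), mul_one, rootVec_succ (by omega), smul_mul_assoc]
        module
      · subst h1
        refine ⟨C * (1 - q⁻¹), fun e => absurd e hci, ?_⟩
        rw [e1, B.adj, bichar_self_left, Nat.succ_eq_add_one, rootVec_self, rootVec_single]
        simp only [smul_mul_assoc, one_mul, mul_one]
        module
    obtain ⟨A', hA', k1⟩ := key1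
    obtain ⟨C', hC', k3⟩ := key3
    refine ⟨A', C', hA', hC', ?_⟩
    rw [Nat.add_sub_cancel, ← k1, ← k3, rootVec_succ hij, mul_sub, ← mul_assoc, e, mul_smul_comm,
      ← mul_assoc b, hb, add_mul, add_mul (A • _), key2, prod_Ico_succ_top hij.le, ← hσ]
    have e2 := congrArg (fun t => rootVec p x i j * t) (hb j)
    have e3 := congrArg (fun t => x j * t) e
    simp only [mul_add, add_mul, mul_sub, sub_mul, mul_smul_comm, smul_mul_assoc, mul_assoc,
      smul_sub, smul_add, smul_smul, mul_one, one_mul] at e2 e3 ⊢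
    rw [e2, e3]
    module

/-- The powers `e_{i,j} ^ N` commute with linked generators up to scalars. -/
theorem qcomm_pow_linked {N : ℕ} (hN : q ^ N = 1) (hq1 : q ≠ 1) {b : R} {s c : ℕ → K} {h : ℕ → R}
    (hb : ∀ l, b * x l = s l • (x l * b) + c l • (1 - h l)) (hs0 : ∀ l, s l ≠ 0)
    (hh : ∀ l m, c l ≠ 0 → QComm (p l m * s m) (h l) (x m))
    (hs : ∀ l m, c l ≠ 0 → p m l = s m) {i j : ℕ} (hij : i < j) :
    QComm ((∏ l ∈ Ico i j, s l) ^ N) b (rootVec p x i j ^ N) := by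
  obtain ⟨A, C, hA, hC, e⟩ := H.linked_rootVec B hb hh hs hij
  set σ := ∏ l ∈ Ico i j, s l with hσ
  have hσ0 : σ ≠ 0 := prod_ne_zero_iff.mpr fun l _ => hs0 l
  have hq := B.q_ne_zero
  -- The two corrections of `linked_rootVec` commute with $e_{i,j}$ up to $q\sigma$ and
  -- $q^{-1}\sigma$. These scalars differ from $\sigma$ but have the same $N$-th power.
  refine QComm.pow_right_of_sum (t := univ) (v := ![A • (rootVec p x i (j - 1) * h (j - 1)),
    C • rootVec p x (i + 1) j]) (o := ![q * σ, q⁻¹ * σ]) ?_ ?_ ?_ ?_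
  · rw [e, Fin.sum_univ_two]
    simp
  · intro m _
    fin_cases m
    · change QComm (q * σ) (A • (rootVec p x i (j - 1) * h (j - 1))) _
      by_cases hcj : c (j - 1) = 0
      · simp [hA hcj, QComm.zero_left]
      refine QComm.smul_left ?_ A
      have h1 := H.qcomm_same_row B (i := i) (by omega : j - 1 < j)
      have h2 : QComm (∏ m ∈ Ico i j, p (j - 1) m * s m) (h (j - 1)) (rootVec p x i j) :=
        rootVec_qcomm_right fun m _ _ => hh (j - 1) m hcj
      refine (h1.mul_left h2).of_eq ?_
      have e1 := bichar_left (p := p) (by omega : i ≤ j - 1) (by omega : j - 1 ≤ j - 1 + 1) i j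
      rw [Nat.sub_add_cancel (by omega), B.bichar_self hij] at e1
      have e2 := bichar_eq_prod_right (p := p) i j (j - 1)
      rw [Nat.sub_add_cancel (by omega)] at e2
      rw [prod_mul_distrib, ← hσ, e1, e2]
      ring
    · change QComm (q⁻¹ * σ) (C • rootVec p x (i + 1) j) _
      by_cases hci : c i = 0
      · simp [hC hci, QComm.zero_left]
      refine QComm.smul_left ?_ C
      refine ((H.qcomm_same_col B (by omega : i < i + 1)).symm (B.bichar_ne_zero _ _ _ _)).of_eq ?_
      have e1 := bichar_right (p := p) (by omega : i ≤ i + 1) (by omega : i + 1 ≤ j) i j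
      have e2 : bichar p i j i (i + 1) = σ := by
        rw [bichar_eq_prod_left, hσ]
        exact prod_congr rfl fun m _ => hs i m hci
      rw [B.bichar_self hij, e2] at e1
      have hne := B.bichar_ne_zero i j (i + 1) j
      rw [e1]
      field_simp
  · intro m _
    fin_cases m
    · change q * σ ≠ σ
      intro e
      exact hq1 (mul_right_cancel₀ hσ0 (by rw [e, one_mul]))
    · change q⁻¹ * σ ≠ σ
      intro e
      exact hq1 (inv_eq_one.mp (mul_right_cancel₀ hσ0 (by rw [e, one_mul])))
  · intro m _
    fin_cases m
    · change (q * σ) ^ N = σ ^ N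
      rw [mul_pow, hN, one_mul]
    · change (q⁻¹ * σ) ^ N = σ ^ N
      rw [mul_pow, inv_pow, hN, inv_one, one_mul]

end SerreA

end RootVecPow

/-! ### Stability of the quantum Serre relation under skew-commuting sums. -/

section QSerre

variable {K R : Type*} [Field K] [Ring R] [Algebra K R]

/-- The quantum Serre polynomial `x²y - (1+q)p xyx + q p² yx²`. -/
def qSerre (q p : K) (x y : R) : R :=
  x * x * y - ((1 + q) * p) • (x * y * x) + (q * p ^ 2) • (y * x * x)

/-- After ordering all monomials with $P,P'$ to the left of $Q,Q'$, every mixed monomial has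
coefficient zero, by $ss'=q^{-1}$. -/
theorem qSerre_add {q s s' : K} {P P' Q Q' : R} (hq : q ≠ 0) (hs : s ≠ 0) (hss : s * s' = q⁻¹)
    (h1 : QComm q Q P) (h2 : QComm s Q P') (h3 : QComm s' Q' P) (hP : qSerre q s P P' = 0)
    (hQ : qSerre q s Q Q' = 0) : qSerre q s (P + Q) (P' + Q') = 0 := by
  have e : s' = q⁻¹ * s⁻¹ := by rw [← hss]; field_simp
  subst e
  unfold QComm at h1 h2 h3
  have r1 : ∀ t, Q * (P * t) = q • (P * (Q * t)) := fun t => by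
    rw [← mul_assoc, h1, smul_mul_assoc, mul_assoc]
  have r2 : ∀ t, Q * (P' * t) = s • (P' * (Q * t)) := fun t => by
    rw [← mul_assoc, h2, smul_mul_assoc, mul_assoc]
  have r3 : ∀ t, Q' * (P * t) = (q⁻¹ * s⁻¹) • (P * (Q' * t)) := fun t => by
    rw [← mul_assoc, h3, smul_mul_assoc, mul_assoc]
  simp only [qSerre, mul_assoc] at hP hQ
  simp only [qSerre, mul_add, add_mul, mul_assoc, r1, r2, r3, h1, h2, h3, mul_smul_comm,
    smul_mul_assoc, smul_smul, smul_add]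
  linear_combination (norm := (match_scalars <;> field_simp <;> ring)) hP + hQ

theorem qSerre_zero_left (q p : K) (y : R) : qSerre q p 0 y = 0 := by simp [qSerre]

theorem qSerre_zero_right (q p : K) (x : R) : qSerre q p x 0 = 0 := by simp [qSerre]

end QSerre

/-! ### Families satisfying the relations, and operations on them. -/

namespace LinkingDatum

section

variable {K Γ : Type*} [Field K] [CommGroup Γ] {t : ℕ} {n : Fin t → ℕ} (D : LinkingDatum K Γ n)
variable {R S : Type*} [Ring R] [Algebra K R] [Ring S] [Algebra K S]

/-- The entries `χ_j(g_i)` of the braiding matrix. -/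
def br (i j : DiagramVertex n) : K := ((D.χ j (D.g i) : Kˣ) : K)

theorem br_ne_zero (i j : DiagramVertex n) : D.br i j ≠ 0 := Units.ne_zero _

theorem br_mul_br (i j : DiagramVertex n) :
    D.br j i * D.br i j = D.br i i ^ cartanTypeA n i j := by
  have h := congrArg (fun u : Kˣ => (u : K)) (D.cartan_condition i j)
  simpa [br] using h

theorem cartanTypeA_same (k : Fin t) (l m : Fin (n k)) :
    cartanTypeA n ⟨k, l⟩ ⟨k, m⟩ =
      if l = m then 2 else if l.val + 1 = m.val ∨ m.val + 1 = l.val then -1 else 0 := by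
  rw [cartanTypeA, Matrix.blockDiagonal'_apply_eq]
  rfl

theorem br_mul_br_of_ne {i j : DiagramVertex n} (h : i.1 ≠ j.1) : D.br i j * D.br j i = 1 := by
  rw [D.br_mul_br, cartanTypeA]
  obtain ⟨k, l⟩ := i
  obtain ⟨k', m⟩ := j
  rw [Matrix.blockDiagonal'_apply_ne _ _ _ (Ne.symm h), zpow_zero]

theorem br_far {k : Fin t} {l m : Fin (n k)} (h : l.val + 2 ≤ m.val) :
    D.br ⟨k, l⟩ ⟨k, m⟩ * D.br ⟨k, m⟩ ⟨k, l⟩ = 1 := by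
  rw [D.br_mul_br, cartanTypeA_same, if_neg (by rintro rfl; omega), if_neg (by omega), zpow_zero]

theorem br_adj {k : Fin t} {l m : Fin (n k)} (h : l.val + 1 = m.val ∨ m.val + 1 = l.val) :
    D.br ⟨k, l⟩ ⟨k, m⟩ * D.br ⟨k, m⟩ ⟨k, l⟩ = (D.br ⟨k, m⟩ ⟨k, m⟩)⁻¹ := by
  rw [D.br_mul_br, cartanTypeA_same, if_neg (by rintro rfl; omega), if_pos (by omega), zpow_neg_one]

theorem br_self_succ {k : Fin t} {l m : Fin (n k)} (h : l.val + 1 = m.val) :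
    D.br ⟨k, l⟩ ⟨k, l⟩ = D.br ⟨k, m⟩ ⟨k, m⟩ := by
  have h1 := D.br_adj (Or.inl h)
  have h2 := D.br_adj (Or.inr h)
  rw [mul_comm, h2] at h1
  exact inv_injective h1

/-- Elements `a_i` of an algebra, with an action `y` of `Γ`, that satisfy the relations of `𝔘(𝓓)`,
except that the linking relations have arbitrary right hand sides `ℓ`. -/
structure Rep (y : Γ →* R) (a : DiagramVertex n → R) (ℓ : DiagramVertex n → DiagramVertex n → R) :
    Prop where
  grp : ∀ x i, QComm ((D.χ i x : Kˣ) : K) (y x) (a i)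
  comm : ∀ (k : Fin t) (l m : Fin (n k)), l.val + 2 ≤ m.val →
    QComm (D.br ⟨k, l⟩ ⟨k, m⟩) (a ⟨k, l⟩) (a ⟨k, m⟩)
  serre : ∀ (k : Fin t) (l m : Fin (n k)), (l.val + 1 = m.val ∨ m.val + 1 = l.val) →
    qSerre (D.br ⟨k, l⟩ ⟨k, l⟩) (D.br ⟨k, l⟩ ⟨k, m⟩) (a ⟨k, l⟩) (a ⟨k, m⟩) = 0
  link : ∀ i j, i.1 ≠ j.1 → a i * a j - D.br i j • (a j * a i) = ℓ i j

variable {D}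

namespace Rep

variable {y : Γ →* R} {a : DiagramVertex n → R} {ℓ : DiagramVertex n → DiagramVertex n → R}

theorem congr (h : D.Rep y a ℓ) {ℓ' : DiagramVertex n → DiagramVertex n → R}
    (hℓ : ∀ i j, i.1 ≠ j.1 → ℓ i j = ℓ' i j) : D.Rep y a ℓ' :=
  ⟨h.grp, h.comm, h.serre, fun i j hij => (h.link i j hij).trans (hℓ i j hij)⟩

theorem map (h : D.Rep y a ℓ) (f : R →ₐ[K] S) :
    D.Rep ((f : R →* S).comp y) (fun i => f (a i)) (fun i j => f (ℓ i j)) where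
  grp x i := (h.grp x i).map f
  comm k l m hlm := (h.comm k l m hlm).map f
  serre k l m hlm := by
    have := congrArg f (h.serre k l m hlm)
    simpa [qSerre] using this
  link i j hij := by
    rw [← h.link i j hij]
    simp

/-- The common principle behind the comultiplication, the skew polynomial realization, the skew
derivations and the threefold tensor product: for this skew-commutation all mixed terms cancel, and
the linking right-hand sides add. -/
theorem add {P Q : DiagramVertex n → R} {ℓ' : DiagramVertex n → DiagramVertex n → R}
    (hP : D.Rep y P ℓ) (hQ : D.Rep y Q ℓ') (h : ∀ i j, QComm (D.br j i) (Q j) (P i)) :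
    D.Rep y (fun i => P i + Q i) (fun i j => ℓ i j + ℓ' i j) where
  grp x i := by
    have h1 := hP.grp x i
    have h2 := hQ.grp x i
    unfold QComm at *
    rw [mul_add, h1, h2, add_mul, smul_add]
  comm k l m hlm := by
    have h1 := hP.comm k l m hlm
    have h2 := hQ.comm k l m hlm
    have h3 := h ⟨k, m⟩ ⟨k, l⟩
    have h4 := ((h ⟨k, l⟩ ⟨k, m⟩).symm (D.br_ne_zero _ _)).of_eq
      (inv_eq_of_mul_eq_one_left (D.br_far hlm))
    unfold QComm at *
    rw [add_mul, mul_add, mul_add, h1, h2, h3, h4, add_mul, mul_add, mul_add]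
    module
  serre k l m hlm := by
    have e : D.br ⟨k, l⟩ ⟨k, m⟩ * D.br ⟨k, m⟩ ⟨k, l⟩ = (D.br ⟨k, l⟩ ⟨k, l⟩)⁻¹ := by
      rw [mul_comm]; exact D.br_adj hlm.symm
    exact qSerre_add (D.br_ne_zero _ _) (D.br_ne_zero _ _) e (h _ _) (h _ _) (h _ _)
      (hP.serre k l m hlm) (hQ.serre k l m hlm)
  link i j hij := by
    have h3 := h j i
    have h4 := h i j
    unfold QComm at *
    rw [← hP.link i j hij, ← hQ.link i j hij, add_mul, mul_add, mul_add, h3, add_mul, mul_add,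
      mul_add, h4]
    have e := D.br_mul_br_of_ne hij
    simp only [smul_add, smul_smul, e]
    module

/-- Multiplying the generators by commuting elements. -/
theorem twist (h : D.Rep y a ℓ) (f : R →ₐ[K] S) (v : DiagramVertex n → S) (w : Γ → S) (Y : Γ →* S)
    (hY : ∀ x, Y x = f (y x) * w x) (hvf : ∀ i r, Commute (v i) (f r))
    (hwf : ∀ x r, Commute (w x) (f r)) (hvv : ∀ i j, Commute (v i) (v j))
    (hwv : ∀ x i, Commute (w x) (v i)) :
    D.Rep Y (fun i => v i * f (a i)) (fun i j => v i * v j * f (ℓ i j)) := by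
  have h2 : ∀ i j r r', v i * f r * (v j * f r') = v i * v j * f (r * r') := fun i j r r' => by
    rw [mul_assoc, ← mul_assoc (f r), ← (hvf j r).eq, map_mul]
    simp only [mul_assoc]
  have h3 : ∀ i j l r r' r'', v i * f r * (v j * f r') * (v l * f r'') =
      v i * v j * v l * f (r * r' * r'') := fun i j l r r' r'' => by
    rw [h2, mul_assoc, ← mul_assoc (f (r * r')), ← (hvf l (r * r')).eq, map_mul f (r * r')]
    simp only [mul_assoc]
  constructor
  · intro x i
    have e : y x * a i = _ := h.grp x i
    change Y x * (v i * f (a i)) = _ • (v i * f (a i) * Y x)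
    rw [hY, mul_assoc, ← mul_assoc (w x), (hwv x i).eq, mul_assoc (v i), (hwf x (a i)).eq,
      ← mul_assoc, ← (hvf i _).eq, mul_assoc, ← mul_assoc (f (y x)), ← map_mul, e, map_smul,
      map_mul]
    simp only [smul_mul_assoc, mul_smul_comm, mul_assoc]
  · intro k l m hlm
    have e : a ⟨k, l⟩ * a ⟨k, m⟩ = _ := h.comm k l m hlm
    change v _ * f _ * (v _ * f _) = _ • (v _ * f _ * (v _ * f _))
    rw [h2, h2, e, map_smul, mul_smul_comm, (hvv _ _).eq]
  · intro k l m hlm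
    have e := congrArg (fun r => v ⟨k, l⟩ * v ⟨k, l⟩ * v ⟨k, m⟩ * f r) (h.serre k l m hlm)
    simp only [qSerre, h3] at e ⊢
    have e1 : v ⟨k, l⟩ * v ⟨k, m⟩ * v ⟨k, l⟩ = v ⟨k, l⟩ * v ⟨k, l⟩ * v ⟨k, m⟩ := by
      rw [mul_assoc, (hvv ⟨k, m⟩ ⟨k, l⟩).eq, mul_assoc]
    have e2 : v ⟨k, m⟩ * v ⟨k, l⟩ * v ⟨k, l⟩ = v ⟨k, l⟩ * v ⟨k, l⟩ * v ⟨k, m⟩ := by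
      rw [(hvv ⟨k, m⟩ ⟨k, l⟩).eq, e1]
    rw [e1, e2]
    simpa [mul_add, mul_sub] using e
  · intro i j hij
    rw [h2, h2, (hvv j i).eq, ← h.link i j hij]
    simp [mul_sub]

/-- The antipode of a family satisfying the relations. -/
theorem anti (h : D.Rep y a ℓ) (y' : Γ →* Rᵐᵒᵖ) (hy' : ∀ x, y' x = MulOpposite.op (y x⁻¹)) :
    D.Rep y' (fun i => -MulOpposite.op (y (D.g i)⁻¹ * a i))
      (fun i j => -MulOpposite.op (y (D.g i * D.g j)⁻¹ * ℓ i j)) := by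
  have hg : ∀ x i, a i * y x⁻¹ = ((D.χ i x : Kˣ) : K) • (y x⁻¹ * a i) := fun x i => by
    have e : y x * a i = _ := h.grp x i
    calc a i * y x⁻¹ = (y x⁻¹ * y x) * a i * y x⁻¹ := by rw [← map_mul]; simp
      _ = y x⁻¹ * (y x * a i) * y x⁻¹ := by simp only [mul_assoc]
      _ = ((D.χ i x : Kˣ) : K) • (y x⁻¹ * a i * (y x * y x⁻¹)) := by
        rw [e]; simp only [mul_smul_comm, smul_mul_assoc, mul_assoc]
      _ = _ := by rw [← map_mul]; simp
  have hb : ∀ i j, a j * y (D.g i)⁻¹ = D.br i j • (y (D.g i)⁻¹ * a j) := fun i j => hg (D.g i) j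
  have hc : ∀ i j, y (D.g i)⁻¹ * y (D.g j)⁻¹ = y (D.g j)⁻¹ * y (D.g i)⁻¹ := fun i j => by
    rw [← map_mul, mul_comm, map_mul]
  have h2 : ∀ i j, y (D.g j)⁻¹ * a j * (y (D.g i)⁻¹ * a i) =
      D.br i j • (y (D.g i * D.g j)⁻¹ * (a j * a i)) := fun i j => by
    rw [mul_assoc, ← mul_assoc (a j), hb, mul_inv, map_mul, hc]
    simp only [smul_mul_assoc, mul_smul_comm, mul_assoc]
  have h3 : ∀ i j l, y (D.g l)⁻¹ * a l * (y (D.g j)⁻¹ * a j * (y (D.g i)⁻¹ * a i)) =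
      (D.br i j * D.br i l * D.br j l) • (y (D.g i * D.g j * D.g l)⁻¹ * (a l * (a j * a i))) :=
    fun i j l => by
    rw [h2, mul_smul_comm, mul_inv, map_mul, mul_assoc, mul_assoc (y (D.g i)⁻¹),
      ← mul_assoc (a l), hb, smul_mul_assoc, mul_assoc (y (D.g i)⁻¹) (a l), ← mul_assoc (a l), hb,
      mul_inv, map_mul, mul_inv, map_mul]
    simp only [smul_mul_assoc, mul_smul_comm, smul_smul]
    congr 1
    · ring
    · simp only [← mul_assoc]
      rw [hc l i, mul_assoc (y (D.g i)⁻¹), hc l j]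
      simp only [← mul_assoc]
  constructor
  · intro x i
    have e := hg x i
    change y' x * -_ = _ • (-_ * y' x)
    rw [hy', mul_neg, neg_mul, ← MulOpposite.op_mul, ← MulOpposite.op_mul, mul_assoc, e,
      mul_smul_comm, MulOpposite.op_smul, smul_neg, ← mul_assoc, ← mul_assoc, ← map_mul, ← map_mul,
      mul_comm]
  · intro k l m hlm
    have e : a ⟨k, l⟩ * a ⟨k, m⟩ = _ := h.comm k l m hlm
    change -_ * -_ = _ • (-_ * -_)
    rw [neg_mul_neg, neg_mul_neg, ← MulOpposite.op_mul, ← MulOpposite.op_mul, h2, h2, e,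
      ← MulOpposite.op_smul, mul_comm (D.g ⟨k, m⟩), mul_smul_comm, smul_smul, smul_smul,
      mul_right_comm, mul_assoc, D.br_far hlm, mul_one]
  · intro k l m hlm
    have e := congrArg (fun r => y (D.g ⟨k, l⟩ * D.g ⟨k, l⟩ * D.g ⟨k, m⟩)⁻¹ * r)
      (h.serre k l m hlm)
    have e0 : D.br ⟨k, m⟩ ⟨k, l⟩ = (D.br ⟨k, l⟩ ⟨k, l⟩)⁻¹ * (D.br ⟨k, l⟩ ⟨k, m⟩)⁻¹ := by
      rw [← D.br_adj hlm.symm]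
      field_simp [D.br_ne_zero ⟨k, l⟩ ⟨k, m⟩]
    have e1 : D.g ⟨k, l⟩ * D.g ⟨k, m⟩ * D.g ⟨k, l⟩ = D.g ⟨k, l⟩ * D.g ⟨k, l⟩ * D.g ⟨k, m⟩ := by
      rw [mul_right_comm]
    have e2 : D.g ⟨k, m⟩ * D.g ⟨k, l⟩ * D.g ⟨k, l⟩ = D.g ⟨k, l⟩ * D.g ⟨k, l⟩ * D.g ⟨k, m⟩ := by
      rw [mul_comm (D.g ⟨k, m⟩), e1]
    have hq := D.br_ne_zero ⟨k, l⟩ ⟨k, l⟩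
    have hp := D.br_ne_zero ⟨k, l⟩ ⟨k, m⟩
    apply MulOpposite.unop_injective
    simp only [qSerre, mul_neg, MulOpposite.unop_add, MulOpposite.unop_sub,
      MulOpposite.unop_neg, MulOpposite.unop_smul, MulOpposite.unop_mul, MulOpposite.unop_op,
      MulOpposite.unop_zero]
    rw [h3, h3, h3, e1, e2, e0]
    simp only [qSerre, mul_add, mul_sub, mul_smul_comm, mul_zero, ← mul_assoc] at e
    have e' := congrArg (fun r => -r) e
    simp only [neg_zero] at e'
    simp only [← mul_assoc]
    rw [← e']
    match_scalars <;> field_simp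
  · intro i j hij
    rw [neg_mul_neg, neg_mul_neg, ← h.link i j hij, ← MulOpposite.op_mul, ← MulOpposite.op_mul, h2,
      h2, ← MulOpposite.op_smul, ← MulOpposite.op_sub, ← MulOpposite.op_neg, smul_smul,
      D.br_mul_br_of_ne hij, mul_comm (D.g j), mul_sub, mul_smul_comm]
    congr 1
    module

end Rep

/-- Group homomorphism into the opposite algebra given by the inverses. -/
def antiGrp (y : Γ →* R) : Γ →* Rᵐᵒᵖ where
  toFun x := MulOpposite.op (y x⁻¹)
  map_one' := by simp
  map_mul' x z := by rw [← MulOpposite.op_mul, ← map_mul, mul_inv_rev]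

end

end LinkingDatum

/-! ### The universal property of $\mathfrak U(\mathcal D)$, and its components as families of type
$A_\infty$. -/

namespace LinkingDatum

section

variable {K Γ : Type*} [Field K] [CommGroup Γ] {t : ℕ} {n : Fin t → ℕ} (D : LinkingDatum K Γ n)
variable {R S : Type*} [Ring R] [Algebra K R] [Ring S] [Algebra K S]

/-- The homomorphism from the free algebra given by the images of the generators. -/
def freeLift (y : Γ → R) (a : DiagramVertex n → R) : D.Free →ₐ[K] R :=
  FreeAlgebra.lift K (Sum.elim y a)

@[simp] theorem freeLift_grp (y : Γ → R) (a : DiagramVertex n → R) (x : Γ) :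
    D.freeLift y a (D.freeGrp x) = y x := by
  simp [freeLift, freeGrp]

@[simp] theorem freeLift_gen (y : Γ → R) (a : DiagramVertex n → R) (i : DiagramVertex n) :
    D.freeLift y a (D.freeGen i) = a i := by
  simp [freeLift, freeGen]

/-- The image of the quantum Serre relations under a homomorphism. -/
theorem map_serre (F : D.Free →ₐ[K] R) {y : Γ →* R} {a : DiagramVertex n → R}
    (hy : ∀ x, F (D.freeGrp x) = y x) (ha : ∀ i, F (D.freeGen i) = a i)
    (h : ∀ x i, QComm ((D.χ i x : Kˣ) : K) (y x) (a i)) {k : Fin t} {l m : Fin (n k)} (hlm : l ≠ m) :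
    F ((D.freeAd ⟨k, l⟩)^[(1 - cartanTypeA n ⟨k, l⟩ ⟨k, m⟩).toNat] (D.freeGen ⟨k, m⟩)) =
      if l.val + 1 = m.val ∨ m.val + 1 = l.val then
        qSerre (D.br ⟨k, l⟩ ⟨k, l⟩) (D.br ⟨k, l⟩ ⟨k, m⟩) (a ⟨k, l⟩) (a ⟨k, m⟩)
      else a ⟨k, l⟩ * a ⟨k, m⟩ - D.br ⟨k, l⟩ ⟨k, m⟩ • (a ⟨k, m⟩ * a ⟨k, l⟩) := by
  have had : ∀ (i : DiagramVertex n) (X : D.Free) (s : K), QComm s (y (D.g i)) (F X) →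
      F (D.freeAd i X) = a i * F X - s • (F X * a i) := fun i X s hs => by
    have hs' : y (D.g i) * F X = _ := hs
    rw [freeAd, map_sub, map_mul, map_mul, map_mul, map_mul, hy, hy, ha, hs', smul_mul_assoc,
      mul_assoc (F X), ← map_mul, mul_inv_cancel, map_one, mul_one, smul_mul_assoc]
  have h1 := had ⟨k, l⟩ (D.freeGen ⟨k, m⟩) (D.br ⟨k, l⟩ ⟨k, m⟩) (by rw [ha]; exact h _ _)
  rw [ha] at h1
  rw [cartanTypeA_same, if_neg hlm]
  split_ifs with hadj
  · change F (D.freeAd ⟨k, l⟩ (D.freeAd ⟨k, l⟩ (D.freeGen ⟨k, m⟩))) = _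
    have hl : QComm (D.br ⟨k, l⟩ ⟨k, l⟩) (y (D.g ⟨k, l⟩)) (a ⟨k, l⟩) := h _ _
    have hm : QComm (D.br ⟨k, l⟩ ⟨k, m⟩) (y (D.g ⟨k, l⟩)) (a ⟨k, m⟩) := h _ _
    rw [had ⟨k, l⟩ _ (D.br ⟨k, l⟩ ⟨k, l⟩ * D.br ⟨k, l⟩ ⟨k, m⟩), h1, qSerre]
    · simp only [mul_sub, sub_mul, mul_smul_comm, smul_mul_assoc, mul_assoc]
      module
    · rw [h1]
      exact (hl.mul_right hm).sub_right (((hm.mul_right hl).of_eq (mul_comm _ _)).smul_right _)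
  · exact h1

variable {D}

/-- The homomorphism from `𝔘(𝓓)` attached to elements that satisfy its relations. -/
def Rep.lift {y : Γ →* R} {a : DiagramVertex n → R}
    (h : D.Rep y a fun i j => D.lam i j • (1 - y (D.g i * D.g j))) : D.U →ₐ[K] R :=
  RingQuot.liftAlgHom K ⟨D.freeLift y a, fun x z hxz => by
    induction hxz with
    | grp_one => simp
    | grp_mul x z => simp
    | grp_gen x i => simpa using (show _ = _ from h.grp x i)
    | serre i j hne hij =>
      obtain ⟨k, l⟩ := i
      obtain ⟨k', m⟩ := j
      obtain rfl : k = k' := hij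
      have hlm : l ≠ m := fun e => hne (by rw [e])
      rw [D.map_serre (D.freeLift y a) (D.freeLift_grp _ _) (D.freeLift_gen _ _) h.grp hlm, map_zero]
      split_ifs with hadj
      · exact h.serre k l m hadj
      · rw [sub_eq_zero]
        rcases lt_or_gt_of_ne (Fin.val_ne_of_ne hlm) with hlt | hlt
        · exact h.comm k l m (by omega)
        · exact ((h.comm k m l (by omega)).symm (D.br_ne_zero _ _)).of_eq
            (inv_eq_of_mul_eq_one_right (D.br_far (by omega)))
    | link i j hij =>
      have := h.link i j hij
      simpa [br] using this⟩

section

variable {y : Γ →* R} {a : DiagramVertex n → R}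
  (h : D.Rep y a fun i j => D.lam i j • (1 - y (D.g i * D.g j)))

@[simp] theorem Rep.lift_grp (x : Γ) : h.lift (D.grp x) = y x := by
  change h.lift (RingQuot.mkAlgHom K D.Rel _) = _
  rw [Rep.lift, RingQuot.liftAlgHom_mkAlgHom_apply, freeLift_grp]

@[simp] theorem Rep.lift_a (i : DiagramVertex n) : h.lift (D.a i) = a i := by
  change h.lift (RingQuot.mkAlgHom K D.Rel _) = _
  rw [Rep.lift, RingQuot.liftAlgHom_mkAlgHom_apply, freeLift_gen]

end

variable (D)

theorem rep_U : D.Rep D.grp D.a fun i j => D.lam i j • (1 - D.grp (D.g i * D.g j)) := by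
  have hgrp : ∀ x i, QComm ((D.χ i x : Kˣ) : K) (D.grp x) (D.a i) := fun x i => by
    have e := RingQuot.mkAlgHom_rel K (Rel.grp_gen (D := D) x i)
    rw [map_mul, map_smul, map_mul] at e
    exact e
  have hs : ∀ (k : Fin t) (l m : Fin (n k)), l ≠ m →
      (if l.val + 1 = m.val ∨ m.val + 1 = l.val then
        qSerre (D.br ⟨k, l⟩ ⟨k, l⟩) (D.br ⟨k, l⟩ ⟨k, m⟩) (D.a ⟨k, l⟩) (D.a ⟨k, m⟩)
      else D.a ⟨k, l⟩ * D.a ⟨k, m⟩ - D.br ⟨k, l⟩ ⟨k, m⟩ • (D.a ⟨k, m⟩ * D.a ⟨k, l⟩)) = 0 :=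
    fun k l m hlm => by
    have e := RingQuot.mkAlgHom_rel K (Rel.serre (D := D) ⟨k, l⟩ ⟨k, m⟩
      (fun e => hlm (by simpa using e)) rfl)
    rw [map_zero] at e
    exact (D.map_serre D.toU (y := D.grp) (a := D.a) (fun _ => rfl) (fun _ => rfl) hgrp
      hlm).symm.trans e
  refine ⟨hgrp, fun k l m hlm => ?_, fun k l m hlm => ?_, fun i j hij => ?_⟩
  · have e := hs k l m (by rintro rfl; omega)
    rw [if_neg (by omega), sub_eq_zero] at e
    exact e
  · have e := hs k l m (by rintro rfl; omega)
    rwa [if_pos hlm] at e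
  · have e := RingQuot.mkAlgHom_rel K (Rel.link (D := D) i j hij)
    rw [map_sub, map_smul, map_smul, map_sub, map_mul, map_mul, map_one] at e
    exact e

/-- Induction on the elements of `𝔘(𝓓)`. -/
theorem U_induction {P : D.U → Prop} (hgrp : ∀ x, P (D.grp x)) (ha : ∀ i, P (D.a i))
    (halg : ∀ c : K, P (algebraMap K D.U c)) (hadd : ∀ u v, P u → P v → P (u + v))
    (hmul : ∀ u v, P u → P v → P (u * v)) (u : D.U) : P u := by
  obtain ⟨f, rfl⟩ := RingQuot.mkAlgHom_surjective K D.Rel u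
  induction f using FreeAlgebra.induction with
  | grade0 c => rw [AlgHom.commutes]; exact halg c
  | grade1 x =>
    cases x with
    | inl x => exact hgrp x
    | inr i => exact ha i
  | mul f g hf hg => rw [map_mul]; exact hmul _ _ hf hg
  | add f g hf hg => rw [map_add]; exact hadd _ _ hf hg

theorem U_hom_ext {f g : D.U →ₐ[K] R} (hgrp : ∀ x, f (D.grp x) = g (D.grp x))
    (ha : ∀ i, f (D.a i) = g (D.a i)) : f = g := by
  refine AlgHom.ext fun u => ?_
  induction u using D.U_induction with
  | hgrp x => exact hgrp x
  | ha i => exact ha i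
  | halg c => simp
  | hadd u v hu hv => rw [map_add, map_add, hu, hv]
  | hmul u v hu hv => rw [map_mul, map_mul, hu, hv]

section seq

/-- The generators of the `k`-th component, extended by zero. -/
def seq (k : Fin t) (a : DiagramVertex n → R) (l : ℕ) : R := if h : l < n k then a ⟨k, l, h⟩ else 0

theorem seq_of_lt {k : Fin t} (a : DiagramVertex n → R) {l : ℕ} (h : l < n k) :
    seq k a l = a ⟨k, l, h⟩ := dif_pos h

@[simp] theorem seq_val {k : Fin t} (a : DiagramVertex n → R) (l : Fin (n k)) :
    seq k a l = a ⟨k, l⟩ := dif_pos l.isLt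

theorem seq_of_le {k : Fin t} (a : DiagramVertex n → R) {l : ℕ} (h : n k ≤ l) : seq k a l = 0 :=
  dif_neg (by omega)

theorem seq_map (f : R →ₐ[K] S) (k : Fin t) (a : DiagramVertex n → R) (l : ℕ) :
    seq k (fun i => f (a i)) l = f (seq k a l) := by
  unfold seq
  split_ifs <;> simp

theorem seq_add (k : Fin t) (a b : DiagramVertex n → R) (l : ℕ) :
    seq k (fun i => a i + b i) l = seq k a l + seq k b l := by
  unfold seq
  split_ifs <;> simp

variable [∀ k, NeZero (n k)]

theorem br_self (k : Fin t) (l : Fin (n k)) : D.br ⟨k, l⟩ ⟨k, l⟩ = (D.q k : K) := by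
  obtain ⟨l, hl⟩ := l
  induction l with
  | zero => rfl
  | succ l ih => rw [← ih (by omega)]; exact (D.br_self_succ rfl).symm

theorem three_lt_N (k : Fin t) : 3 < D.N k := D.three_lt_order ⟨k, 0⟩

theorem orderOf_q (k : Fin t) : orderOf (D.q k : K) = D.N k := orderOf_units

theorem q_pow_N (k : Fin t) : (D.q k : K) ^ D.N k = 1 := D.orderOf_q k ▸ pow_orderOf_eq_one _

theorem q_ne_one (k : Fin t) : (D.q k : K) ≠ 1 := fun e => by
  have := D.three_lt_N k
  rw [← D.orderOf_q, e, orderOf_one] at this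
  omega

theorem q_mul_q_ne_one (k : Fin t) : (D.q k : K) * D.q k ≠ 1 := fun e => by
  have := D.three_lt_N k
  have := orderOf_le_of_pow_eq_one (x := (D.q k : K)) (n := 2) (by omega) (by rw [pow_two, e])
  rw [D.orderOf_q] at this
  omega

/-- The braiding matrix of the `k`-th component, extended to type `A_∞`. -/
def braid (k : Fin t) (l m : ℕ) : K :=
  if h : l < n k ∧ m < n k then D.br ⟨k, l, h.1⟩ ⟨k, m, h.2⟩ else
    -- Outside the component the generators are zero, so any values satisfying `BraidA` serve.
    if l = m then D.q k else if l + 1 = m then ((D.q k)⁻¹ : Kˣ) else 1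

theorem braid_of_lt {k : Fin t} {l m : ℕ} (hl : l < n k) (hm : m < n k) :
    D.braid k l m = D.br ⟨k, l, hl⟩ ⟨k, m, hm⟩ := dif_pos ⟨hl, hm⟩

theorem braidA (k : Fin t) : BraidA (D.q k : K) (D.braid k) where
  ne_zero l m := by
    unfold braid
    split_ifs
    · exact D.br_ne_zero _ _
    · simp
    · simp
    · simp
  one_add_ne_zero e := D.q_mul_q_ne_one k (by linear_combination ((D.q k : K) - 1) * e)
  diag l := by
    unfold braid
    split_ifs with h
    · exact D.br_self k _
    · rfl
    all_goals exact absurd rfl ‹¬l = l›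
  adj l := by
    by_cases h : l + 1 < n k
    · rw [D.braid_of_lt (by omega) h, D.braid_of_lt h (by omega), D.br_adj (Or.inl rfl), br_self]
    · rw [braid, dif_neg (by omega), if_neg (by omega), if_pos rfl, braid, dif_neg (by omega),
        if_neg (by omega), if_neg (by omega)]
      simp
  far l m hlm := by
    by_cases h : m < n k
    · rw [D.braid_of_lt (by omega) h, D.braid_of_lt h (by omega), D.br_far (by simpa using hlm)]
    · rw [braid, dif_neg (by omega), if_neg (by omega), if_neg (by omega), braid,
        dif_neg (by omega), if_neg (by omega), if_neg (by omega), one_mul]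

variable {D}

theorem Rep.serreA {y : Γ →* R} {a : DiagramVertex n → R}
    {ℓ : DiagramVertex n → DiagramVertex n → R} (h : D.Rep y a ℓ) (k : Fin t) :
    SerreA (D.q k : K) (D.braid k) (seq k a) where
  far l m hlm := by
    by_cases hm : m < n k
    · rw [D.braid_of_lt (by omega) hm, seq_of_lt a hm, seq_of_lt a (by omega)]
      exact h.comm k _ _ hlm
    · rw [seq_of_le a (by omega : n k ≤ m)]
      exact QComm.zero_right _ _
  up l := by
    by_cases hm : l + 1 < n k
    · rw [D.braid_of_lt (by omega) hm, seq_of_lt a hm, seq_of_lt a (by omega),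
        ← D.br_self k ⟨l, by omega⟩]
      exact h.serre k ⟨l, by omega⟩ ⟨l + 1, hm⟩ (Or.inl rfl)
    · rw [seq_of_le a (by omega : n k ≤ l + 1)]
      simp
  down l := by
    by_cases hm : l + 1 < n k
    · rw [D.braid_of_lt hm (by omega), seq_of_lt a hm, seq_of_lt a (by omega),
        ← D.br_self k ⟨l + 1, by omega⟩]
      exact h.serre k ⟨l + 1, hm⟩ ⟨l, by omega⟩ (Or.inr rfl)
    · rw [seq_of_le a (by omega : n k ≤ l + 1)]
      simp

theorem seq_qcomm {P Q : DiagramVertex n → R} (h : ∀ i j, QComm (D.br j i) (Q j) (P i)) (k : Fin t)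
    (l m : ℕ) : QComm (D.braid k m l) (seq k Q m) (seq k P l) := by
  by_cases hm : m < n k
  · by_cases hl : l < n k
    · rw [D.braid_of_lt hm hl, seq_of_lt Q hm, seq_of_lt P hl]
      exact h _ _
    · rw [seq_of_le P (by omega : n k ≤ l)]
      exact QComm.zero_right _ _
  · rw [seq_of_le Q (by omega : n k ≤ m)]
    exact QComm.zero_left _ _

end seq

section roots

variable [∀ k, NeZero (n k)]

theorem prod_filter_castSucc {M : Type*} [CommMonoid M] (m : ℕ) (i j : Fin (m + 1)) (f : Fin m → M)
    (f' : ℕ → M) (hf : ∀ l, f l = f' l) :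
    (∏ l : Fin m with i ≤ l.castSucc ∧ l.castSucc < j, f l) = ∏ l ∈ Ico i.val j.val, f' l := by
  refine prod_bij (fun l _ => l.val) ?_ ?_ ?_ ?_
  · intro l hl
    simp only [mem_filter, mem_univ, true_and, Fin.le_def, Fin.lt_def, Fin.val_castSucc] at hl
    exact mem_Ico.mpr hl
  · intro l _ l' _ e
    exact Fin.ext e
  · intro l hl
    have hl := mem_Ico.mp hl
    refine ⟨⟨l, by omega⟩, ?_, rfl⟩
    simpa [Fin.le_def, Fin.lt_def] using hl
  · intro l _
    exact hf l

theorem χRoot_g (k : Fin t) (i j : Fin (n k + 1)) (l : Fin (n k)) :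
    ((D.χRoot k i j (D.g ⟨k, l⟩) : Kˣ) : K) = bichar (D.braid k) l (l + 1) i j := by
  rw [bichar_eq_prod_right, χRoot, MonoidHom.finsetProd_apply, Units.coe_prod]
  exact prod_filter_castSucc _ _ _ _ _ fun m => (D.braid_of_lt l.isLt m.isLt).symm

theorem χ_gRoot (k : Fin t) (i j : Fin (n k + 1)) (l : Fin (n k)) :
    ((D.χ ⟨k, l⟩ (D.gRoot k i j) : Kˣ) : K) = bichar (D.braid k) i j l (l + 1) := by
  rw [bichar_eq_prod_left, gRoot, map_prod, Units.coe_prod]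
  exact prod_filter_castSucc _ _ _ _ _ fun m => (D.braid_of_lt m.isLt l.isLt).symm

theorem χRoot_gRoot (k : Fin t) (i j i' j' : Fin (n k + 1)) :
    ((D.χRoot k i j (D.gRoot k i' j') : Kˣ) : K) = bichar (D.braid k) i' j' i j := by
  rw [bichar_eq_prod_bichar_left, gRoot, map_prod, Units.coe_prod]
  exact prod_filter_castSucc _ _ _ _ _ fun l => D.χRoot_g k i j l

/-- The bridge from the recursion on `Fin` in the statement to `rootVec`, after any homomorphism out
of $\mathfrak U(\mathcal D)$. -/
theorem map_e (f : D.U →ₐ[K] R) {a : DiagramVertex n → R} (ha : ∀ i, f (D.a i) = a i) (k : Fin t)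
    {i j : Fin (n k + 1)} (hij : i < j) :
    f (D.e k i j) = rootVec (D.braid k) (seq k a) i j := by
  induction j using Fin.induction with
  | zero => exact absurd hij (Fin.not_lt_zero i)
  | succ l ih =>
    have e1 : D.e k i l.succ = if i = l.castSucc then D.a ⟨k, l⟩
      else if i < l.castSucc then
        D.e k i l.castSucc * D.a ⟨k, l⟩ - ((D.χ ⟨k, l⟩ (D.gRoot k i l.castSucc) : Kˣ) : K) •
          (D.a ⟨k, l⟩ * D.e k i l.castSucc)
      else 0 := rfl
    rw [e1]
    split_ifs with h1 h2
    · rw [h1, ha, Fin.val_succ, Fin.val_castSucc, rootVec_single, seq_val]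
    · rw [map_sub, map_smul, map_mul, map_mul, ih h2, ha, D.χ_gRoot, Fin.val_succ,
        rootVec_succ (show i.val < l.val from h2), ← seq_val a l]
      rfl
    · exact absurd hij (by
        simp only [Fin.lt_def, Fin.ext_iff, Fin.val_succ, Fin.val_castSucc] at *
        omega)

theorem e_eq (k : Fin t) {i j : Fin (n k + 1)} (hij : i < j) :
    D.e k i j = rootVec (D.braid k) (seq k D.a) i j :=
  D.map_e (AlgHom.id K D.U) (fun _ => rfl) k hij

end roots

end

end LinkingDatum

/-! ### Root vectors indexed by positive roots, and their $N$-th powers. -/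

namespace LinkingDatum

section

variable {K Γ : Type*} [Field K] [CommGroup Γ] {t : ℕ} {n : Fin t → ℕ} (D : LinkingDatum K Γ n)
variable {R S : Type*} [Ring R] [Algebra K R] [Ring S] [Algebra K S]

/-- The positive roots: the component `k`, and `i < j`. -/
abbrev Root (n : Fin t → ℕ) : Type :=
  Σ k : Fin t, {ij : Fin (n k + 1) × Fin (n k + 1) // ij.1 < ij.2}

theorem χRoot_apply (k : Fin t) (i j : Fin (n k + 1)) (x : Γ) : ((D.χRoot k i j x : Kˣ) : K) =
    ∏ l ∈ Ico i.val j.val, if h : l < n k then ((D.χ ⟨k, l, h⟩ x : Kˣ) : K) else 1 := by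
  rw [χRoot, MonoidHom.finsetProd_apply, Units.coe_prod]
  refine prod_filter_castSucc _ _ _ _ _ fun m => ?_
  rw [dif_pos m.isLt]

/-- For linked vertices `i` and `l`, the braiding with `l` is inverse to that with `i`. -/
theorem br_eq_of_lam_ne_zero {i l m : DiagramVertex n} (hil : i.1 ≠ l.1) (him : i.1 ≠ m.1)
    (h : D.lam i l ≠ 0) : D.br m l = D.br i m := by
  have h1 : D.χ i * D.χ l = 1 := by
    by_contra hne
    exact h (D.lam_eq_zero i l hil fun hh => hne hh.2)
  have h2 : D.br m i * D.br m l = 1 := by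
    have := congrArg (fun f : Γ →* Kˣ => ((f (D.g m) : Kˣ) : K)) h1
    simpa [br] using this
  have h3 := D.br_mul_br_of_ne him
  have h4 := D.br_ne_zero m i
  apply mul_left_cancel₀ h4
  rw [h2, mul_comm, h3]

variable [∀ k, NeZero (n k)]

/-- The root vector attached to a positive root and a family `a`. -/
def rv (a : DiagramVertex n → R) (α : Root n) : R :=
  rootVec (D.braid α.1) (seq α.1 a) α.2.1.1 α.2.1.2

/-- The character of a positive root. -/
def rχ (α : Root n) : Γ →* Kˣ := D.χRoot α.1 α.2.1.1 α.2.1.2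

/-- The group element of a positive root. -/
def rg (α : Root n) : Γ := D.gRoot α.1 α.2.1.1 α.2.1.2

theorem map_rv (f : R →ₐ[K] S) (a : DiagramVertex n → R) (α : Root n) :
    f (D.rv a α) = D.rv (fun i => f (a i)) α := by
  rw [rv, rootVec_map, rv]
  congr 1
  funext l
  exact (seq_map f _ _ _).symm

theorem e_eq_rv (α : Root n) : D.e α.1 α.2.1.1 α.2.1.2 = D.rv D.a α := D.e_eq α.1 α.2.2

variable {D}

theorem Rep.grp_rv {y : Γ →* R} {a : DiagramVertex n → R}
    {ℓ : DiagramVertex n → DiagramVertex n → R} (h : D.Rep y a ℓ) (x : Γ) (α : Root n) :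
    QComm ((D.rχ α x : Kˣ) : K) (y x) (D.rv a α) := by
  rw [rχ, χRoot_apply]
  refine rootVec_qcomm_right fun l _ hl => ?_
  have hl' : l < n α.1 := by have := α.2.1.2.isLt; omega
  rw [dif_pos hl', seq_of_lt a hl']
  exact h.grp x _

/-- The `N`-th powers of the root vectors commute with the generators up to scalars. -/
theorem Rep.gen_rv_pow {y : Γ →* R} {a : DiagramVertex n → R}
    (h : D.Rep y a fun i j => D.lam i j • (1 - y (D.g i * D.g j))) (i : DiagramVertex n)
    (α : Root n) :
    QComm (((D.rχ α (D.g i) : Kˣ) : K) ^ D.N α.1) (a i) (D.rv a α ^ D.N α.1) := by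
  obtain ⟨k, ⟨r, s⟩, hrs⟩ := α
  obtain ⟨k', m⟩ := i
  have B := D.braidA k
  have H := h.serreA k
  change QComm (((D.χRoot k r s (D.g ⟨k', m⟩) : Kˣ) : K) ^ D.N k) _
    (rootVec (D.braid k) (seq k a) r s ^ D.N k)
  by_cases hk : k' = k
  · subst hk
    have := H.qcomm_pow B (D.q_pow_N _) (D.q_ne_one _) hrs m
    rwa [seq_val, ← D.χRoot_g] at this
  set i : DiagramVertex n := ⟨k', m⟩ with hi
  -- A generator of another component: the linking relations provide the data $s,c,h$, extended by
  -- neutral values beyond $n_k$.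
  have key := H.qcomm_pow_linked B (D.q_pow_N _) (D.q_ne_one _) (b := a i)
    (s := fun l => if hl : l < n k then D.br i ⟨k, l, hl⟩ else 1)
    (c := fun l => if hl : l < n k then D.lam i ⟨k, l, hl⟩ else 0)
    (h := fun l => if hl : l < n k then y (D.g i * D.g ⟨k, l, hl⟩) else 1) ?_ ?_ ?_ ?_
    (show r.val < s.val from hrs)
  · rw [χRoot_apply]
    exact key
  · intro l
    by_cases hl : l < n k
    · have := h.link i ⟨k, l, hl⟩ hk
      simp only [dif_pos hl]
      rw [seq_of_lt a hl, ← this]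
      abel
    · simp only [dif_neg hl]
      rw [seq_of_le a (by omega)]
      simp
  · intro l
    split_ifs
    · exact D.br_ne_zero _ _
    · exact one_ne_zero
  · intro l l' hc
    by_cases hl' : l' < n k
    · by_cases hl : l < n k
      · simp only [dif_pos hl, dif_pos hl']
        rw [D.braid_of_lt hl hl', seq_of_lt a hl']
        refine (h.grp _ _).of_eq ?_
        rw [map_mul, Units.val_mul, mul_comm]
        rfl
      · simp [dif_neg hl] at hc
    · rw [seq_of_le a (by omega : n k ≤ l')]
      exact QComm.zero_right _ _
  · intro l l' hc
    by_cases hl : l < n k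
    · rw [dif_pos hl] at hc
      by_cases hl' : l' < n k
      · rw [dif_pos hl', D.braid_of_lt hl' hl]
        exact D.br_eq_of_lam_ne_zero hk hk hc
      · rw [dif_neg hl', braid, dif_neg (by omega), if_neg (by omega), if_neg (by omega)]
    · simp [dif_neg hl] at hc

theorem Rep.rv_rv_pow {y : Γ →* R} {a : DiagramVertex n → R}
    (h : D.Rep y a fun i j => D.lam i j • (1 - y (D.g i * D.g j))) (α β : Root n) :
    QComm (((D.rχ α (D.rg β) : Kˣ) : K) ^ D.N α.1) (D.rv a β) (D.rv a α ^ D.N α.1) := by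
  have e : ((D.rχ α (D.rg β) : Kˣ) : K) ^ D.N α.1 = ∏ l ∈ Ico β.2.1.1.val β.2.1.2.val,
      (if hl : l < n β.1 then ((D.rχ α (D.g ⟨β.1, l, hl⟩) : Kˣ) : K) ^ D.N α.1 else 1) := by
    rw [rg, gRoot, map_prod, Units.coe_prod, ← prod_pow]
    refine prod_filter_castSucc _ _ _ _ _ fun m => ?_
    rw [dif_pos m.isLt]
  rw [e]
  refine rootVec_qcomm_left fun l _ hl => ?_
  have hl' : l < n β.1 := by have := β.2.1.2.isLt; omega
  rw [dif_pos hl', seq_of_lt a hl']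
  exact h.gen_rv_pow _ α

/-- If `χ_α ^ N = 1`, then `g_α ^ N` acts trivially on the generators. -/
theorem χ_rg_pow {α : Root n} (hα : D.rχ α ^ D.N α.1 = 1) (i : DiagramVertex n) :
    D.χ i (D.rg α ^ D.N α.1) = 1 := by
  have h1 : ((D.rχ α (D.g i) : Kˣ) : K) ^ D.N α.1 = 1 := by
    have := congrArg (fun f : Γ →* Kˣ => ((f (D.g i) : Kˣ) : K)) hα
    simpa using this
  -- By the Cartan condition $\chi_i(g_\alpha)\chi_\alpha(g_i)$ is a power of $q_k$, or $1$ for a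
  -- vertex of another component.
  have h2 : (((D.χ i (D.rg α) : Kˣ) : K) * ((D.rχ α (D.g i) : Kˣ) : K)) ^ D.N α.1 = 1 := by
    have e1 : ((D.χ i (D.rg α) : Kˣ) : K) = ∏ l ∈ Ico α.2.1.1.val α.2.1.2.val,
        (if hl : l < n α.1 then D.br ⟨α.1, l, hl⟩ i else 1) := by
      rw [rg, gRoot, map_prod, Units.coe_prod]
      refine prod_filter_castSucc _ _ _ _ _ fun m => ?_
      rw [dif_pos m.isLt]
      rfl
    rw [rχ, χRoot_apply, e1, ← prod_mul_distrib, ← prod_pow]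
    refine prod_eq_one fun l hl => ?_
    split_ifs with hl'
    · change (D.br _ _ * D.br _ _) ^ _ = 1
      by_cases hk : α.1 = i.1
      · obtain ⟨k, m⟩ := i
        obtain ⟨k', β⟩ := α
        obtain rfl : k' = k := hk
        rw [D.br_mul_br, br_self, ← zpow_natCast, ← zpow_mul, mul_comm, zpow_mul, zpow_natCast,
          D.q_pow_N, one_zpow]
      · rw [D.br_mul_br_of_ne hk, one_pow]
    · simp
  rw [mul_pow, h1, mul_one] at h2
  ext
  simpa using h2

end

end LinkingDatum

/-! ### Comultiplication and counit of $\mathfrak U(\mathcal D)$; coproducts of $u_{i,j}$ and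
$e_{i,j}^N$. -/

namespace LinkingDatum

section

variable {K Γ : Type*} [Field K] [CommGroup Γ] {t : ℕ} {n : Fin t → ℕ} (D : LinkingDatum K Γ n)
variable {R S : Type*} [Ring R] [Algebra K R] [Ring S] [Algebra K S]

/-- The diagonal action on a tensor product. -/
def tensorGrp (y : Γ →* R) (y' : Γ →* S) : Γ →* R ⊗[K] S where
  toFun x := y x ⊗ₜ y' x
  map_one' := by rw [map_one, map_one, Algebra.TensorProduct.one_def]
  map_mul' x z := by rw [map_mul, map_mul, Algebra.TensorProduct.tmul_mul_tmul]

variable {D}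

section tensor

variable {y : Γ →* R} {a : DiagramVertex n → R} {ℓ : DiagramVertex n → DiagramVertex n → R}
variable {y' : Γ →* S} {a' : DiagramVertex n → S} {ℓ' : DiagramVertex n → DiagramVertex n → S}

theorem Rep.tensor_left (h : D.Rep y a ℓ) (y' : Γ →* S) :
    D.Rep (tensorGrp (K := K) y y') (fun i => a i ⊗ₜ 1) (fun i j => ℓ i j ⊗ₜ 1) := by
  have := h.twist (Algebra.TensorProduct.includeLeft : R →ₐ[K] R ⊗[K] S) (fun _ => 1)
    (fun x => 1 ⊗ₜ y' x) (tensorGrp y y') (fun x => by simp [tensorGrp])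
    (fun i r => Commute.one_left _) (fun x r => by simp [Commute, SemiconjBy])
    (fun i j => Commute.refl _) (fun x i => Commute.one_right _)
  simpa using this

theorem Rep.tensor_right (h' : D.Rep y' a' ℓ') (y : Γ →* R) :
    D.Rep (tensorGrp (K := K) y y') (fun i => y (D.g i) ⊗ₜ a' i)
      (fun i j => y (D.g i * D.g j) ⊗ₜ ℓ' i j) := by
  have hc : ∀ x z, Commute (y x) (y z) := fun x z => by
    rw [Commute, SemiconjBy, ← map_mul, mul_comm, map_mul]
  have := h'.twist (Algebra.TensorProduct.includeRight : S →ₐ[K] R ⊗[K] S)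
    (fun i => y (D.g i) ⊗ₜ 1)
    (fun x => y x ⊗ₜ 1) (tensorGrp y y') (fun x => by simp [tensorGrp])
    (fun i r => by simp [Commute, SemiconjBy]) (fun x r => by simp [Commute, SemiconjBy])
    (fun i j => by simp [Commute, SemiconjBy, (hc _ _).eq])
    (fun x i => by simp [Commute, SemiconjBy, (hc _ _).eq])
  simpa using this

theorem Rep.tensor_qcomm (h : D.Rep y a ℓ) (a' : DiagramVertex n → S) (i j : DiagramVertex n) :
    QComm (D.br j i) (y (D.g j) ⊗ₜ[K] a' j) (a i ⊗ₜ 1) := by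
  have e : y (D.g j) * a i = _ := h.grp (D.g j) i
  rw [QComm, Algebra.TensorProduct.tmul_mul_tmul, e, Algebra.TensorProduct.tmul_mul_tmul, mul_one,
    one_mul, TensorProduct.smul_tmul']
  rfl

theorem Rep.tensor (h : D.Rep y a ℓ) (h' : D.Rep y' a' ℓ') :
    D.Rep (tensorGrp (K := K) y y') (fun i => a i ⊗ₜ 1 + y (D.g i) ⊗ₜ a' i)
      (fun i j => ℓ i j ⊗ₜ 1 + y (D.g i * D.g j) ⊗ₜ ℓ' i j) :=
  (h.tensor_left y').add (h'.tensor_right y) (h.tensor_qcomm a')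

end tensor

theorem Rep.zero (y : Γ →* R) : D.Rep y (fun _ => 0) fun _ _ => 0 where
  grp _ _ := QComm.zero_right _ _
  comm _ _ _ _ := QComm.zero_right _ _
  serre _ _ _ _ := qSerre_zero_left _ _ _
  link _ _ _ := by simp

variable (D)

/-- The right-hand sides telescope: $\lambda(1-g)\otimes1+g\otimes\lambda(1-g)=\lambda(1-g\otimes
g)$. -/
theorem rep_comul : D.Rep (tensorGrp (K := K) D.grp D.grp)
    (fun i => D.a i ⊗ₜ 1 + D.grp (D.g i) ⊗ₜ D.a i)
    (fun i j => D.lam i j • (1 - tensorGrp (K := K) D.grp D.grp (D.g i * D.g j))) :=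
  (D.rep_U.tensor D.rep_U).congr fun i j _ => by
    simp only [tensorGrp, MonoidHom.coe_mk, OneHom.coe_mk, TensorProduct.tmul_smul,
      TensorProduct.tmul_sub, TensorProduct.sub_tmul, ← TensorProduct.smul_tmul',
      Algebra.TensorProduct.one_def]
    rw [← smul_add, sub_add_sub_cancel]

/-- The comultiplication of `𝔘(𝓓)`. -/
def comulU : D.U →ₐ[K] D.U ⊗[K] D.U := D.rep_comul.lift

@[simp] theorem comulU_grp (x : Γ) : D.comulU (D.grp x) = D.grp x ⊗ₜ D.grp x :=
  D.rep_comul.lift_grp x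

@[simp] theorem comulU_a (i : DiagramVertex n) :
    D.comulU (D.a i) = D.a i ⊗ₜ 1 + D.grp (D.g i) ⊗ₜ D.a i :=
  D.rep_comul.lift_a i

theorem rep_counit : D.Rep (1 : Γ →* K) (fun _ => 0)
    (fun i j => D.lam i j • (1 - (1 : Γ →* K) (D.g i * D.g j))) :=
  (Rep.zero _).congr fun i j _ => by simp

/-- The counit of `𝔘(𝓓)`. -/
def counitU : D.U →ₐ[K] K := D.rep_counit.lift

@[simp] theorem counitU_grp (x : Γ) : D.counitU (D.grp x) = 1 := D.rep_counit.lift_grp x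

@[simp] theorem counitU_a (i : DiagramVertex n) : D.counitU (D.a i) = 0 := D.rep_counit.lift_a i

theorem gRoot_mul {k : Fin t} {i m j : Fin (n k + 1)} (h : i ≤ m) (h' : m ≤ j) :
    D.gRoot k i m * D.gRoot k m j = D.gRoot k i j := by
  have e : ∀ i j : Fin (n k + 1), D.gRoot k i j = ∏ l ∈ Ico i.val j.val,
      if h : l < n k then D.g ⟨k, l, h⟩ else 1 := fun i j =>
    prod_filter_castSucc _ _ _ _ _ fun m => by rw [dif_pos m.isLt]
  rw [e, e, e]
  exact prod_Ico_consecutive _ h h'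

theorem χRoot_mul {k : Fin t} {i m j : Fin (n k + 1)} (h : i ≤ m) (h' : m ≤ j) :
    D.χRoot k i m * D.χRoot k m j = D.χRoot k i j := by
  have e : ∀ i j : Fin (n k + 1), D.χRoot k i j = ∏ l ∈ Ico i.val j.val,
      if h : l < n k then D.χ ⟨k, l, h⟩ else 1 := fun i j =>
    prod_filter_castSucc _ _ _ _ _ fun m => by rw [dif_pos m.isLt]
  rw [e, e, e]
  exact prod_Ico_consecutive _ h h'

variable [∀ k, NeZero (n k)]

theorem h_mul {k : Fin t} {i m j : Fin (n k + 1)} (h : i ≤ m) (h' : m ≤ j) :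
    D.h k i m * D.h k m j = D.h k i j := by
  rw [LinkingDatum.h, LinkingDatum.h, ← mul_pow, D.gRoot_mul h h', LinkingDatum.h]

/-- The compatibility of the two ways to cut $[i,j)$ at $p$ and $r$; `comul_u` rests on it. -/
theorem C_mul {k : Fin t} {i p r j : Fin (n k + 1)} (h : i ≤ p) (h' : p ≤ r) (h'' : r ≤ j) :
    D.C k i p j * D.C k p r j = D.C k i r j * D.C k i p r := by
  rw [C, C, C, C, ← D.gRoot_mul h' h'', ← D.χRoot_mul h h', map_mul, MonoidHom.mul_apply]
  push_cast
  ring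

theorem u_eq (k : Fin t) (c : Fin (n k + 1) → Fin (n k + 1) → K) (i j : Fin (n k + 1)) :
    D.u k c i j = c i j • (1 - MonoidAlgebra.of K Γ (D.h k i j)) +
      ∑ p ∈ Ioo i j, (D.C k i p j * c i p) • D.u k c p j := by
  rw [u]
  congr 1
  rw [← sum_filter_add_sum_filter_not univ (fun p => i < p ∧ p < j), add_eq_left.mpr]
  · refine sum_congr (by ext; simp) fun p hp => ?_
    rw [dif_pos (mem_Ioo.mp hp)]
  · refine sum_eq_zero fun p hp => ?_
    rw [dif_neg (mem_filter.mp hp).2]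

/-- The coproduct of `u_{i,j}`. -/
theorem comul_u {T : Type*} [Ring T] [Algebra K T] (Δ ι₁ ι₂ : MonoidAlgebra K Γ →ₐ[K] T)
    (hΔ : ∀ x, Δ (MonoidAlgebra.of K Γ x) = ι₁ (MonoidAlgebra.of K Γ x) * ι₂ (MonoidAlgebra.of K Γ x))
    (k : Fin t) (c : Fin (n k + 1) → Fin (n k + 1) → K) (i j : Fin (n k + 1)) (hij : i < j) :
    Δ (D.u k c i j) = ι₁ (D.u k c i j) +
      ι₁ (MonoidAlgebra.of K Γ (D.h k i j)) * ι₂ (D.u k c i j) +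
      ∑ m ∈ Ioo i j, D.C k i m j • (ι₁ (D.u k c i m) * ι₁ (MonoidAlgebra.of K Γ (D.h k m j)) *
        ι₂ (D.u k c m j)) := by
  induction i using WellFoundedGT.induction with
  | ind i ih =>
  have e1 : ∀ (f : MonoidAlgebra K Γ →ₐ[K] T) m, f (D.u k c i m) =
      c i m • (1 - f (MonoidAlgebra.of K Γ (D.h k i m))) +
      ∑ p ∈ Ioo i m, (D.C k i p m * c i p) • f (D.u k c p m) := fun f m => by
    conv_lhs => rw [u_eq]
    simp only [map_add, map_sum, map_smul, map_sub, map_one]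
  -- Expanding $u_{i,m}$ by its recursion and using $h_{i,m}h_{m,j}=h_{i,j}$. In the double sum the
  -- order of summation is exchanged and `C_mul` rewrites the coefficients, so that the induction
  -- hypothesis for $u_{p,j}$ can absorb it.
  have e2 : ∑ m ∈ Ioo i j, D.C k i m j • (ι₁ (D.u k c i m) *
        ι₁ (MonoidAlgebra.of K Γ (D.h k m j)) * ι₂ (D.u k c m j)) =
      ∑ m ∈ Ioo i j, (D.C k i m j * c i m) • (ι₁ (MonoidAlgebra.of K Γ (D.h k m j)) -
          ι₁ (MonoidAlgebra.of K Γ (D.h k i j))) * ι₂ (D.u k c m j) +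
      ∑ p ∈ Ioo i j, ∑ m ∈ Ioo p j, (D.C k i p j * c i p * D.C k p m j) •
        (ι₁ (D.u k c p m) * ι₁ (MonoidAlgebra.of K Γ (D.h k m j)) * ι₂ (D.u k c m j)) := by
    rw [sum_comm' (t' := Ioo i j) (s' := fun m => Ioo i m), ← sum_add_distrib]
    · refine sum_congr rfl fun m hm => ?_
      obtain ⟨hm1, hm2⟩ := mem_Ioo.mp hm
      have e3 : ι₁ (MonoidAlgebra.of K Γ (D.h k i m)) * ι₁ (MonoidAlgebra.of K Γ (D.h k m j)) =
          ι₁ (MonoidAlgebra.of K Γ (D.h k i j)) := by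
        rw [← map_mul, ← map_mul, D.h_mul hm1.le hm2.le]
      rw [e1 ι₁ m, add_mul, add_mul, smul_mul_assoc, sub_mul, e3, one_mul, smul_add, sum_mul,
        sum_mul, smul_sum]
      congr 1
      · rw [smul_mul_assoc, smul_mul_assoc, smul_smul]
      · refine sum_congr rfl fun p hp => ?_
        obtain ⟨hp1, hp2⟩ := mem_Ioo.mp hp
        rw [smul_mul_assoc, smul_mul_assoc, smul_smul]
        congr 1
        linear_combination - c i p * D.C_mul hp1.le hp2.le hm2.le
    · intro p m
      simp only [mem_Ioo]
      omega
  have e4 : Δ (MonoidAlgebra.of K Γ (D.h k i j)) = _ := hΔ _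
  have e5 : ∑ p ∈ Ioo i j, (D.C k i p j * c i p) • Δ (D.u k c p j) =
      ∑ p ∈ Ioo i j, (D.C k i p j * c i p) • ι₁ (D.u k c p j) +
      (∑ p ∈ Ioo i j, (D.C k i p j * c i p) •
        (ι₁ (MonoidAlgebra.of K Γ (D.h k p j)) * ι₂ (D.u k c p j)) +
      ∑ p ∈ Ioo i j, ∑ m ∈ Ioo p j, (D.C k i p j * c i p * D.C k p m j) •
        (ι₁ (D.u k c p m) * ι₁ (MonoidAlgebra.of K Γ (D.h k m j)) * ι₂ (D.u k c m j))) := by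
    rw [← sum_add_distrib, ← sum_add_distrib]
    refine sum_congr rfl fun p hp => ?_
    obtain ⟨hp1, hp2⟩ := mem_Ioo.mp hp
    rw [ih p hp1 hp2, smul_add, smul_add, add_assoc, smul_sum]
    simp only [smul_smul]
  rw [e2, e1 Δ, e1 ι₁, e1 ι₂, e4, e5]
  simp only [mul_add, mul_sum, sub_mul, smul_sub, sum_sub_distrib, smul_mul_assoc, mul_smul_comm,
    mul_sub, mul_one]
  abel

theorem rootVec_tmul (y : Γ →* R) (a : DiagramVertex n → S) (k : Fin t) {i j : Fin (n k + 1)}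
    (hij : i < j) : rootVec (D.braid k) (seq k fun i => y (D.g i) ⊗ₜ[K] a i) i j =
      y (D.gRoot k i j) ⊗ₜ[K] rootVec (D.braid k) (seq k a) i j := by
  have e : ∀ m : ℕ, i.val < m → m ≤ n k →
      rootVec (D.braid k) (seq k fun i => y (D.g i) ⊗ₜ[K] a i) i m =
      y (∏ l ∈ Ico i.val m, if h : l < n k then D.g ⟨k, l, h⟩ else 1) ⊗ₜ[K]
        rootVec (D.braid k) (seq k a) i m := fun m hm => by
    induction m, hm using Nat.le_induction with
    | base =>
      intro hi
      have hi : i.val < n k := hi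
      rw [rootVec_single, rootVec_single, seq_of_lt _ hi, seq_of_lt _ hi, Nat.Ico_succ_singleton,
        prod_singleton, dif_pos hi]
    | succ m hm ih =>
      intro hm'
      have hm' : m < n k := hm'
      have hm : i.val < m := hm
      rw [rootVec_succ hm, rootVec_succ hm, ih hm'.le, seq_of_lt _ hm', seq_of_lt _ hm',
        prod_Ico_succ_top hm.le, dif_pos hm', Algebra.TensorProduct.tmul_mul_tmul,
        Algebra.TensorProduct.tmul_mul_tmul, ← map_mul, ← map_mul, mul_comm (D.g _),
        TensorProduct.tmul_sub, TensorProduct.tmul_smul]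
  rw [e j hij (by have := j.isLt; omega), gRoot, prod_filter_castSucc _ _ _ _ _ fun m => ?_]
  rw [dif_pos m.isLt]

/-- The coproduct of `e_{i,j} ^ N`. -/
theorem comul_e_pow (k : Fin t) {i j : Fin (n k + 1)} (hij : i < j) :
    D.comulU (D.e k i j ^ D.N k) = (D.e k i j ^ D.N k) ⊗ₜ 1 +
      D.grp (D.h k i j) ⊗ₜ (D.e k i j ^ D.N k) +
      ∑ m ∈ Ioo i j, D.C k i m j • ((D.e k i m ^ D.N k * D.grp (D.h k m j)) ⊗ₜ[K]
        (D.e k m j ^ D.N k)) := by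
  have hP := (D.rep_U.tensor_left D.grp).serreA k
  have hQ := (D.rep_U.tensor_right D.grp).serreA k
  have hPQ := D.seq_qcomm (D.rep_U.tensor_qcomm D.a) k
  have key := hP.rootVec_add_pow (D.braidA k) hQ hPQ (D.orderOf_q k) (by have := D.three_lt_N k; omega)
    (show i.val < j.val from hij)
  have eP : ∀ m, i < m → rootVec (D.braid k) (seq k fun i => D.a i ⊗ₜ[K] (1 : D.U)) i m =
      D.e k i m ⊗ₜ[K] (1 : D.U) := fun m hm => by
    have := D.map_e (Algebra.TensorProduct.includeLeft : D.U →ₐ[K] D.U ⊗[K] D.U)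
      (a := fun i => D.a i ⊗ₜ[K] (1 : D.U)) (fun _ => rfl) k hm
    exact this.symm
  have eQ : ∀ m, m < j → rootVec (D.braid k) (seq k fun i => D.grp (D.g i) ⊗ₜ[K] D.a i) m j =
      D.grp (D.gRoot k m j) ⊗ₜ[K] D.e k m j := fun m hm => by
    rw [D.rootVec_tmul D.grp D.a k hm, D.e_eq k hm]
  have e0 : D.comulU (D.e k i j) = rootVec (D.braid k) (fun l =>
      seq k (fun i => D.a i ⊗ₜ[K] (1 : D.U)) l + seq k (fun i => D.grp (D.g i) ⊗ₜ[K] D.a i) l) i j := by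
    rw [D.map_e (R := D.U ⊗[K] D.U) D.comulU D.comulU_a k hij]
    congr 1
    funext l
    exact seq_add _ _ _ _
  have hij' : i.val < j.val := hij
  -- The extreme indices $m=j$ and $m=i$ give the two terms outside the sum.
  rw [map_pow, e0, key, sum_Ico_succ_top hij'.le, Ico_eq_cons_Ioo hij',
    sum_cons, ← Fin.map_valEmbedding_Ioo, sum_map, add_right_comm, add_comm (_ • _) (_ • _)]
  congr 1
  · rw [eP j hij, eQ i hij, rootVec_self, rootVec_self, bichar_self_left, bichar_self_right]
    simp [comulCoeff, Algebra.TensorProduct.tmul_pow, LinkingDatum.h]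
  · refine sum_congr rfl fun m hm => ?_
    obtain ⟨hm1, hm2⟩ := mem_Ioo.mp hm
    change (comulCoeff _ _ _ m.val ^ _ * bichar _ m.val _ _ m.val ^ _) •
      (rootVec _ _ i.val m.val ^ _ * rootVec _ _ m.val j.val ^ _) = _
    rw [eP m hm1, eQ m hm2, ← D.χRoot_gRoot, comulCoeff, if_neg, C,
      Algebra.TensorProduct.tmul_pow, Algebra.TensorProduct.tmul_pow,
      Algebra.TensorProduct.tmul_mul_tmul, one_pow, one_mul, ← map_pow, LinkingDatum.h]
    · simp
    · rw [not_or]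
      exact ⟨fun e => hm1.ne' (Fin.ext e), fun e => hm2.ne (Fin.ext e)⟩

end

end LinkingDatum

/-! ### The Hopf algebra structure on $\mathcal A(\mathcal D,\gamma)$. -/

namespace LinkingDatum

section

variable {K Γ : Type*} [Field K] [CommGroup Γ] {t : ℕ} {n : Fin t → ℕ} (D : LinkingDatum K Γ n)
variable [∀ k, NeZero (n k)] (γ : ∀ k : Fin t, Fin (n k + 1) → Fin (n k + 1) → K)
variable {R : Type*} [Ring R] [Algebra K R]

omit [∀ k, NeZero (n k)] in
@[simp] theorem groupAlgebraToU_of (x : Γ) :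
    D.groupAlgebraToU (MonoidAlgebra.of K Γ x) = D.grp x := by
  simp [groupAlgebraToU]

omit [∀ k, NeZero (n k)] in
@[simp] theorem groupAlgebraToU_single (x : Γ) (c : K) :
    D.groupAlgebraToU (MonoidAlgebra.single x c) = c • D.grp x := by
  simp [groupAlgebraToU]

instance : Ring (D.A γ) := RingQuot.instRing (R := D.U) _

theorem proj_surjective : Function.Surjective (D.proj γ) :=
  RingQuot.mkAlgHom_surjective K _

theorem proj_e_pow (k : Fin t) {i j : Fin (n k + 1)} (hij : i < j) :
    D.proj γ (D.e k i j ^ D.N k) = D.proj γ (D.groupAlgebraToU (D.u k (γ k) i j)) :=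
  RingQuot.mkAlgHom_rel K (RootRel.root k i j hij)

variable {γ} in
/-- The homomorphism on `𝓐(𝓓, γ)` induced by one that respects the root vector relations. -/
def liftA (f : D.U →ₐ[K] R) (hf : ∀ (k : Fin t) (i j : Fin (n k + 1)), i < j →
    f (D.e k i j ^ D.N k) = f (D.groupAlgebraToU (D.u k (γ k) i j))) : D.A γ →ₐ[K] R :=
  RingQuot.liftAlgHom K ⟨f, fun x y hxy => by
    induction hxy with
    | root k i j hij => exact hf k i j hij⟩

variable {γ} in
@[simp] theorem liftA_proj (f : D.U →ₐ[K] R) (hf : ∀ (k : Fin t) (i j : Fin (n k + 1)), i < j →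
    f (D.e k i j ^ D.N k) = f (D.groupAlgebraToU (D.u k (γ k) i j))) (u : D.U) :
    D.liftA f hf (D.proj γ u) = f u := by
  rw [liftA, proj, RingQuot.liftAlgHom_mkAlgHom_apply]

variable {γ} in
theorem A_hom_ext {f g : D.A γ →ₐ[K] R}
    (hgrp : ∀ x, f (D.proj γ (D.grp x)) = g (D.proj γ (D.grp x)))
    (ha : ∀ i, f (D.proj γ (D.a i)) = g (D.proj γ (D.a i))) : f = g := by
  have e : f.comp (D.proj γ) = g.comp (D.proj γ) := D.U_hom_ext hgrp ha
  refine AlgHom.ext fun x => ?_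
  obtain ⟨u, rfl⟩ := D.proj_surjective γ x
  exact DFunLike.congr_fun e u

/-- The comultiplication of `𝓐(𝓓, γ)`. -/
def comulA : D.A γ →ₐ[K] D.A γ ⊗[K] D.A γ :=
  D.liftA (R := D.A γ ⊗[K] D.A γ) ((Algebra.TensorProduct.map (D.proj γ) (D.proj γ)).comp D.comulU)
      fun k i j hij => by
    -- The two coproducts agree term by term, once the root vector relations for $(i,m)$, $(m,j)$
    -- and $(i,j)$ are applied in the tensor factors.
    have e := D.comul_u (T := D.A γ ⊗[K] D.A γ)
      (((Algebra.TensorProduct.map (D.proj γ) (D.proj γ)).comp D.comulU).comp D.groupAlgebraToU)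
      ((Algebra.TensorProduct.includeLeft.comp (D.proj γ)).comp D.groupAlgebraToU)
      ((Algebra.TensorProduct.includeRight.comp (D.proj γ)).comp D.groupAlgebraToU)
      (fun x => by simp) k (γ k) i j hij
    simp only [AlgHom.comp_apply] at e ⊢
    rw [e, D.comul_e_pow k hij]
    simp only [map_add, map_sum, map_smul, Algebra.TensorProduct.map_tmul, groupAlgebraToU_of,
      Algebra.TensorProduct.includeLeft_apply, Algebra.TensorProduct.includeRight_apply,
      Algebra.TensorProduct.tmul_mul_tmul, mul_one, one_mul, map_one, map_mul]
    rw [proj_e_pow _ _ _ hij]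
    congr 1
    refine sum_congr rfl fun m hm => ?_
    obtain ⟨hm1, hm2⟩ := mem_Ioo.mp hm
    rw [proj_e_pow _ _ _ hm1, proj_e_pow _ _ _ hm2]

@[simp] theorem comulA_grp (x : Γ) : D.comulA γ (D.proj γ (D.grp x)) =
    D.proj γ (D.grp x) ⊗ₜ D.proj γ (D.grp x) := by
  simp [comulA]

@[simp] theorem comulA_a (i : DiagramVertex n) : D.comulA γ (D.proj γ (D.a i)) =
    D.proj γ (D.a i) ⊗ₜ 1 + D.proj γ (D.grp (D.g i)) ⊗ₜ D.proj γ (D.a i) := by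
  simp [comulA]

theorem counitU_e_pow (k : Fin t) {i j : Fin (n k + 1)} (hij : i < j) :
    D.counitU (D.e k i j ^ D.N k) = 0 := by
  have hN : D.N k ≠ 0 := by have := D.three_lt_N k; omega
  obtain ⟨m, hm⟩ : ∃ m, j.val = m + 1 := ⟨j.val - 1, by have : i.val < j.val := hij; omega⟩
  rw [map_pow, D.map_e D.counitU D.counitU_a k hij, hm, rootVec_eq_zero, zero_pow hN]
  · have : i.val < j.val := hij
    omega
  · unfold seq
    split_ifs <;> rfl

theorem counitU_u (k : Fin t) (c : Fin (n k + 1) → Fin (n k + 1) → K) (i j : Fin (n k + 1)) :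
    D.counitU (D.groupAlgebraToU (D.u k c i j)) = 0 := by
  induction i using WellFoundedGT.induction with
  | ind i ih =>
  rw [u_eq]
  simp only [map_add, map_smul, map_sub, map_one, groupAlgebraToU_of, counitU_grp, sub_self,
    smul_zero, zero_add, map_sum]
  refine sum_eq_zero fun p hp => ?_
  rw [ih p (mem_Ioo.mp hp).1, smul_zero]

/-- The counit of `𝓐(𝓓, γ)`. -/
def counitA : D.A γ →ₐ[K] K :=
  D.liftA D.counitU fun k i j hij => by rw [D.counitU_e_pow k hij, counitU_u]

@[simp] theorem counitA_proj (u : D.U) : D.counitA γ (D.proj γ u) = D.counitU u := by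
  simp [counitA]

/-- The bialgebra structure on `𝓐(𝓓, γ)`. -/
noncomputable abbrev bialgebraA : Bialgebra K (D.A γ) :=
  Bialgebra.ofAlgHom (D.comulA γ) (D.counitA γ)
    (D.A_hom_ext (R := D.A γ ⊗[K] (D.A γ ⊗[K] D.A γ)) (by simp)
      (by simp [TensorProduct.add_tmul, TensorProduct.tmul_add, add_assoc,
        Algebra.TensorProduct.one_def]))
    (D.A_hom_ext (R := K ⊗[K] D.A γ) (by simp) (by simp))
    (D.A_hom_ext (R := D.A γ ⊗[K] K) (by simp) (by simp))

theorem rep_A : D.Rep ((D.proj γ : D.U →* D.A γ).comp D.grp) (fun i => D.proj γ (D.a i))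
    (fun i j => D.lam i j • (1 - D.proj γ (D.grp (D.g i * D.g j)))) :=
  (D.rep_U.map (S := D.A γ) (D.proj γ)).congr fun i j _ => by simp

/-- For $\ell=\lambda(1-g)$ the right-hand side of `Rep.anti` becomes
$-g^{-1}\lambda(1-g)=\lambda(1-g^{-1})$, as the linking relation requires. -/
theorem rep_antipode : D.Rep (antiGrp ((D.proj γ : D.U →* D.A γ).comp D.grp))
    (fun i => -MulOpposite.op (D.proj γ (D.grp (D.g i)⁻¹) * D.proj γ (D.a i)))
    (fun i j => D.lam i j • (1 - antiGrp ((D.proj γ : D.U →* D.A γ).comp D.grp) (D.g i * D.g j))) :=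
  ((D.rep_A γ).anti _ fun _ => rfl).congr fun i j _ => by
    have e : D.proj γ (D.grp (D.g i * D.g j)⁻¹) * D.proj γ (D.grp (D.g i * D.g j)) = 1 := by
      rw [← map_mul, ← map_mul, inv_mul_cancel, map_one, map_one]
    change -MulOpposite.op (D.proj γ (D.grp (D.g i * D.g j)⁻¹) * _) =
      _ • (1 - MulOpposite.op (D.proj γ (D.grp (D.g i * D.g j)⁻¹)))
    rw [mul_smul_comm, mul_sub (D.proj γ _), e, mul_one, ← MulOpposite.op_one, ← MulOpposite.op_sub,
      ← MulOpposite.op_smul, ← MulOpposite.op_neg, ← smul_neg, neg_sub]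

/-- The antipode, as an antihomomorphism from `𝔘(𝓓)` to `𝓐(𝓓, γ)`. -/
def antipodeU : D.U →ₐ[K] (D.A γ)ᵐᵒᵖ := (D.rep_antipode γ).lift

/-- The convolution of the antipode with the projection. -/
def antipodeLeft : D.U ⊗[K] D.U →ₗ[K] D.A γ :=
  LinearMap.mul' K (D.A γ) ∘ₗ TensorProduct.map
    ((MulOpposite.opLinearEquiv K).symm.toLinearMap ∘ₗ (D.antipodeU γ).toLinearMap)
    (D.proj γ).toLinearMap

/-- The convolution of the projection with the antipode. -/
def antipodeRight : D.U ⊗[K] D.U →ₗ[K] D.A γ :=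
  LinearMap.mul' K (D.A γ) ∘ₗ TensorProduct.map (D.proj γ).toLinearMap
    ((MulOpposite.opLinearEquiv K).symm.toLinearMap ∘ₗ (D.antipodeU γ).toLinearMap)

@[simp] theorem antipodeLeft_tmul (u v : D.U) :
    D.antipodeLeft γ (u ⊗ₜ v) = (D.antipodeU γ u).unop * D.proj γ v := rfl

@[simp] theorem antipodeRight_tmul (u v : D.U) :
    D.antipodeRight γ (u ⊗ₜ v) = D.proj γ u * (D.antipodeU γ v).unop := rfl

@[simp] theorem antipodeU_grp (x : Γ) :
    D.antipodeU γ (D.grp x) = MulOpposite.op (D.proj γ (D.grp x⁻¹)) :=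
  (D.rep_antipode γ).lift_grp x

@[simp] theorem antipodeU_a (i : DiagramVertex n) : D.antipodeU γ (D.a i) =
    -MulOpposite.op (D.proj γ (D.grp (D.g i)⁻¹) * D.proj γ (D.a i)) :=
  (D.rep_antipode γ).lift_a i

/-- The antipode reverses products, so the factor coming from $X$ stands inside that coming from
$Y$; being a scalar, it can be pulled out. The antipode axiom thus has to be checked on generators
only. -/
theorem antipodeLeft_mul {X : D.U ⊗[K] D.U} {c : K}
    (hX : D.antipodeLeft γ X = algebraMap K _ c) (Y : D.U ⊗[K] D.U) :
    D.antipodeLeft γ (X * Y) = c • D.antipodeLeft γ Y := by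
  induction Y with
  | zero => simp
  | add Y Z hY hZ => rw [mul_add, map_add, map_add, hY, hZ, smul_add]
  | tmul v w =>
    have e : D.antipodeLeft γ (X * v ⊗ₜ w) =
        (D.antipodeU γ v).unop * D.antipodeLeft γ X * D.proj γ w := by
      clear hX
      induction X with
      | zero => simp
      | add X X' h h' => rw [add_mul, map_add, map_add, h, h', mul_add, add_mul]
      | tmul x x' => simp [mul_assoc]
    rw [e, hX, antipodeLeft_tmul, Algebra.smul_def, ← mul_assoc, Algebra.commutes]

theorem antipodeRight_mul (X : D.U ⊗[K] D.U) {Y : D.U ⊗[K] D.U} {c : K}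
    (hY : D.antipodeRight γ Y = algebraMap K _ c) :
    D.antipodeRight γ (X * Y) = c • D.antipodeRight γ X := by
  induction X with
  | zero => simp
  | add X Z hX hZ => rw [add_mul, map_add, map_add, hX, hZ, smul_add]
  | tmul v w =>
    have e : D.antipodeRight γ (v ⊗ₜ w * Y) =
        D.proj γ v * D.antipodeRight γ Y * (D.antipodeU γ w).unop := by
      clear hY
      induction Y with
      | zero => simp
      | add X X' h h' => rw [mul_add, map_add, map_add, h, h', mul_add, add_mul]
      | tmul x x' => simp [mul_assoc]
    rw [e, hY, antipodeRight_tmul, Algebra.smul_def, ← mul_assoc, Algebra.commutes]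

theorem antipodeLeft_comul (u : D.U) :
    D.antipodeLeft γ (D.comulU u) = algebraMap K _ (D.counitU u) := by
  induction u using D.U_induction with
  | hgrp x => simp [← map_mul]
  | ha i =>
    simp only [comulU_a, map_add, antipodeLeft_tmul, antipodeU_a, antipodeU_grp, counitU_a,
      map_zero, map_one, mul_one, MulOpposite.unop_neg, MulOpposite.unop_op]
    exact neg_add_cancel (D.proj γ (D.grp (D.g i)⁻¹) * D.proj γ (D.a i))
  | halg c =>
    rw [AlgHom.commutes, AlgHom.commutes, Algebra.algebraMap_eq_smul_one, map_smul,
      Algebra.TensorProduct.one_def]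
    simp [Algebra.algebraMap_eq_smul_one]
  | hadd u v hu hv => simp only [map_add, hu, hv]
  | hmul u v hu hv => rw [map_mul, antipodeLeft_mul _ _ hu, hv, map_mul, map_mul, Algebra.smul_def]

theorem antipodeRight_comul (u : D.U) :
    D.antipodeRight γ (D.comulU u) = algebraMap K _ (D.counitU u) := by
  induction u using D.U_induction with
  | hgrp x => simp [← map_mul]
  | ha i =>
    have e : D.proj γ (D.grp (D.g i)) * D.proj γ (D.grp (D.g i)⁻¹) = 1 := by
      rw [← map_mul, ← map_mul, mul_inv_cancel, map_one, map_one]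
    simp only [comulU_a, map_add, antipodeRight_tmul, antipodeU_a, counitU_a,
      map_zero, map_one, mul_one, MulOpposite.unop_neg, MulOpposite.unop_op, MulOpposite.unop_one]
    rw [mul_neg, ← mul_assoc, e, one_mul]
    exact add_neg_cancel (D.proj γ (D.a i))
  | halg c =>
    rw [AlgHom.commutes, AlgHom.commutes, Algebra.algebraMap_eq_smul_one, map_smul,
      Algebra.TensorProduct.one_def]
    simp [Algebra.algebraMap_eq_smul_one]
  | hadd u v hu hv => simp only [map_add, hu, hv]
  | hmul u v hu hv =>
    rw [map_mul, antipodeRight_mul _ _ _ hv, hu, map_mul, map_mul, Algebra.smul_def,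
      Algebra.commutes]

/-- No power of an antipode value is computed. The axiom $m(S\otimes\mathrm{id})\Delta=\varepsilon$
holds for $e_{i,j}^N$ and for $u_{i,j}$, whose coproducts have the same shape. By induction on $j$
all terms but $S(e_{i,j}^N)$ and $S(u_{i,j})$ coincide, hence so do these. -/
theorem antipodeU_e_pow (k : Fin t) {i j : Fin (n k + 1)} (hij : i < j) :
    D.antipodeU γ (D.e k i j ^ D.N k) =
      D.antipodeU γ (D.groupAlgebraToU (D.u k (γ k) i j)) := by
  induction j using WellFoundedLT.induction with
  | ind j ih =>
  have h1 := D.antipodeLeft_comul γ (D.e k i j ^ D.N k)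
  have h2 := D.antipodeLeft_comul γ (D.groupAlgebraToU (D.u k (γ k) i j))
  have e := D.comul_u (T := D.U ⊗[K] D.U) (D.comulU.comp D.groupAlgebraToU)
      (Algebra.TensorProduct.includeLeft.comp D.groupAlgebraToU)
      (Algebra.TensorProduct.includeRight.comp D.groupAlgebraToU)
      (fun x => by simp) k (γ k) i j hij
  simp only [AlgHom.comp_apply, groupAlgebraToU_of,
    Algebra.TensorProduct.includeLeft_apply, Algebra.TensorProduct.includeRight_apply,
    Algebra.TensorProduct.tmul_mul_tmul, mul_one, one_mul] at e
  rw [D.comul_e_pow k hij, D.counitU_e_pow k hij] at h1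
  rw [e, D.counitU_u] at h2
  simp only [map_add, map_sum, map_smul, antipodeLeft_tmul, map_one, mul_one, proj_e_pow _ _ _ hij]
    at h1 h2
  have e3 : ∑ m ∈ Ioo i j, D.C k i m j • ((D.antipodeU γ (D.e k i m ^ D.N k * D.grp (D.h k m j))).unop *
      D.proj γ (D.e k m j ^ D.N k)) = ∑ m ∈ Ioo i j, D.C k i m j •
      ((D.antipodeU γ (D.groupAlgebraToU (D.u k (γ k) i m) * D.grp (D.h k m j))).unop *
      D.proj γ (D.groupAlgebraToU (D.u k (γ k) m j))) := by
    refine sum_congr rfl fun m hm => ?_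
    obtain ⟨hm1, hm2⟩ := mem_Ioo.mp hm
    rw [map_mul, ih m hm2 hm1, ← map_mul, proj_e_pow _ _ _ hm2]
  rw [e3] at h1
  apply MulOpposite.unop_injective
  have h3 := h1.trans h2.symm
  exact add_right_cancel (add_right_cancel h3)

/-- The antipode of `𝓐(𝓓, γ)`. -/
def antipodeA : D.A γ →ₐ[K] (D.A γ)ᵐᵒᵖ :=
  D.liftA (R := (D.A γ)ᵐᵒᵖ) (D.antipodeU γ) fun k _ _ hij => D.antipodeU_e_pow γ k hij

theorem comulA_proj (u : D.U) : D.comulA γ (D.proj γ u) =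
    TensorProduct.map (D.proj γ).toLinearMap (D.proj γ).toLinearMap (D.comulU u) := by
  rw [comulA, liftA_proj]
  rfl

/-- The Hopf algebra structure on `𝓐(𝓓, γ)`. -/
noncomputable abbrev hopfAlgebraA : HopfAlgebra K (D.A γ) where
  toBialgebra := D.bialgebraA γ
  antipode := (MulOpposite.opLinearEquiv K).symm.toLinearMap ∘ₗ (D.antipodeA γ).toLinearMap
  mul_antipode_rTensor_comul := by
    refine LinearMap.ext fun x => ?_
    obtain ⟨u, rfl⟩ := D.proj_surjective γ x
    refine Eq.trans ?_ ((D.antipodeLeft_comul γ u).trans ?_)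
    · change LinearMap.mul' K _ (LinearMap.rTensor _ _ (D.comulA γ (D.proj γ u))) = _
      rw [comulA_proj, antipodeLeft, LinearMap.comp_apply]
      congr 1
      rw [← LinearMap.comp_apply, LinearMap.rTensor_comp_map]
      congr 2
      refine LinearMap.ext fun v => ?_
      simp [antipodeA]
    · exact congrArg (algebraMap K _) (D.counitA_proj γ u).symm
  mul_antipode_lTensor_comul := by
    refine LinearMap.ext fun x => ?_
    obtain ⟨u, rfl⟩ := D.proj_surjective γ x
    refine Eq.trans ?_ ((D.antipodeRight_comul γ u).trans ?_)
    · change LinearMap.mul' K _ (LinearMap.lTensor _ _ (D.comulA γ (D.proj γ u))) = _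
      rw [comulA_proj, antipodeRight, LinearMap.comp_apply]
      congr 1
      rw [← LinearMap.comp_apply, LinearMap.lTensor_comp_map]
      congr 2
      refine LinearMap.ext fun v => ?_
      simp [antipodeA]
    · exact congrArg (algebraMap K _) (D.counitA_proj γ u).symm

theorem hopfAlgebraA_spec : ∃ H : HopfAlgebra K (D.A γ),
    H.toAlgebra = (inferInstance : Algebra K (D.A γ)) ∧
    @LinkingDatum.CoproductFormulas K Γ _ _ t n D (D.A γ) _ H
      (fun x => D.proj γ (D.grp x)) (fun i => D.proj γ (D.a i)) :=
  ⟨D.hopfAlgebraA γ, rfl, @CoproductFormulas.mk _ _ _ _ _ _ _ _ _ (D.hopfAlgebraA γ) _ _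
    (D.comulA_grp γ) (D.comulA_a γ)⟩

end

end LinkingDatum

/-! ### Spans of ordered monomials in skew-commuting elements. -/

section Spanning

variable {K R : Type*} [Field K] [Ring R] [Algebra K R]

open Submodule

/-- The span of the powers of `x`. -/
def powSpan (K : Type*) {R : Type*} [Field K] [Ring R] [Algebra K R] (x : R) : Submodule K R :=
  span K (Set.range fun m : ℕ => x ^ m)

theorem powSpan_mul_le (x : R) : powSpan K x * span K {x} ≤ powSpan K x := by
  rw [powSpan, span_mul_span, span_le]
  rintro _ ⟨_, ⟨m, rfl⟩, y, rfl, rfl⟩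
  exact subset_span ⟨m + 1, pow_succ _ _⟩

theorem one_mem_powSpan (x : R) : (1 : R) ∈ powSpan K x := subset_span ⟨0, pow_zero _⟩

theorem QComm.powSpan_mul_le {c : K} {x y : R} (h : QComm c x y) :
    powSpan K x * span K {y} ≤ span K {y} * powSpan K x := by
  rw [powSpan, span_mul_span, span_le]
  rintro _ ⟨_, ⟨m, rfl⟩, z, rfl, rfl⟩
  have e : x ^ m * z = _ := h.pow_left m
  change x ^ m * z ∈ _
  rw [e]
  exact smul_mem _ _ (mul_mem_mul (mem_span_singleton_self z) (subset_span ⟨m, rfl⟩))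

/-- The criterion behind all spanning statements: a subspace that contains $1$ and is stable under
right multiplication by the generators contains the algebra. -/
theorem adjoin_le_of_mul_le {S : Set R} {M : Submodule K R} (h1 : (1 : R) ∈ M)
    (h : ∀ s ∈ S, M * span K {s} ≤ M) : Subalgebra.toSubmodule (Algebra.adjoin K S) ≤ M := by
  have key : ∀ x ∈ Algebra.adjoin K S, ∀ m ∈ M, m * x ∈ M := fun x hx => by
    induction hx using Algebra.adjoin_induction with
    | mem x hx => exact fun m hm => h x hx (mul_mem_mul hm (mem_span_singleton_self x))
    | algebraMap c =>
      intro m hm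
      rw [← Algebra.commutes, ← Algebra.smul_def]
      exact M.smul_mem c hm
    | add x y _ _ hx hy =>
      intro m hm
      rw [mul_add]
      exact M.add_mem (hx m hm) (hy m hm)
    | mul x y _ _ hx hy =>
      intro m hm
      rw [← mul_assoc]
      exact hy _ (hx m hm)
  intro x hx
  simpa using key x hx 1 h1

theorem adjoin_mul_span_le (S : Set R) {s : R} (hs : s ∈ S) :
    Subalgebra.toSubmodule (Algebra.adjoin K S) * span K {s} ≤
      Subalgebra.toSubmodule (Algebra.adjoin K S) := by
  rw [mul_le]
  intro m hm z hz
  obtain ⟨c, rfl⟩ := mem_span_singleton.mp hz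
  exact (Algebra.adjoin K S).mul_mem hm
    ((Algebra.adjoin K S).smul_mem (Algebra.subset_adjoin hs) c)

section list

variable {ι : Type*} (f : ι → R)

theorem one_mem_powSpan_prod (l : List ι) : (1 : R) ∈ (l.map fun i => powSpan K (f i)).prod := by
  induction l with
  | nil => exact Submodule.one_le.mp le_rfl
  | cons i l ih =>
    rw [List.map_cons, List.prod_cons]
    simpa using mul_mem_mul (one_mem_powSpan (f i)) ih

theorem powSpan_prod_mul_le_of_qcomm {x : R} (l : List ι) (h : ∀ i ∈ l, ∃ c : K, QComm c (f i) x) :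
    (l.map fun i => powSpan K (f i)).prod * span K {x} ≤
      span K {x} * (l.map fun i => powSpan K (f i)).prod := by
  induction l with
  | nil => simp
  | cons i l ih =>
    rw [List.map_cons, List.prod_cons]
    obtain ⟨c, hc⟩ := h i (by simp)
    calc _ = powSpan K (f i) * ((l.map fun i => powSpan K (f i)).prod * span K {x}) := mul_assoc _ _ _
      _ ≤ powSpan K (f i) * (span K {x} * (l.map fun i => powSpan K (f i)).prod) :=
        mul_le_mul_right (ih fun j hj => h j (by simp [hj])) _
      _ = (powSpan K (f i) * span K {x}) * (l.map fun i => powSpan K (f i)).prod := (mul_assoc _ _ _).symm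
      _ ≤ (span K {x} * powSpan K (f i)) * (l.map fun i => powSpan K (f i)).prod :=
        mul_le_mul_left hc.powSpan_mul_le _
      _ = _ := mul_assoc _ _ _

theorem powSpan_prod_mul_le (l : List ι) (h : ∀ i ∈ l, ∀ j ∈ l, ∃ c : K, QComm c (f i) (f j))
    {i : ι} (hi : i ∈ l) : (l.map fun i => powSpan K (f i)).prod * span K {f i} ≤
      (l.map fun i => powSpan K (f i)).prod := by
  induction l with
  | nil => simp at hi
  | cons j l ih =>
    rw [List.map_cons, List.prod_cons]
    rcases List.mem_cons.mp hi with rfl | hi'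
    · calc _ = powSpan K (f i) * ((l.map fun i => powSpan K (f i)).prod * span K {f i}) := mul_assoc _ _ _
        _ ≤ powSpan K (f i) * (span K {f i} * (l.map fun i => powSpan K (f i)).prod) :=
          mul_le_mul_right (powSpan_prod_mul_le_of_qcomm f l fun j hj => h j (by simp [hj]) i (by simp)) _
        _ = (powSpan K (f i) * span K {f i}) * (l.map fun i => powSpan K (f i)).prod :=
          (mul_assoc _ _ _).symm
        _ ≤ _ := mul_le_mul_left (powSpan_mul_le _) _
    · rw [mul_assoc]
      exact mul_le_mul_right (ih (fun a ha b hb => h a (by simp [ha]) b (by simp [hb])) hi') _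

/-- The algebra generated by skew commuting elements is spanned by the ordered monomials. -/
theorem adjoin_le_powSpan_prod (l : List ι) (h : ∀ i ∈ l, ∀ j ∈ l, ∃ c : K, QComm c (f i) (f j)) :
    Subalgebra.toSubmodule (Algebra.adjoin K (f '' {i | i ∈ l})) ≤
      (l.map fun i => powSpan K (f i)).prod := by
  refine adjoin_le_of_mul_le (one_mem_powSpan_prod f l) ?_
  rintro _ ⟨i, hi, rfl⟩
  exact powSpan_prod_mul_le f l h hi

theorem powSpan_prod_le_span [DecidableEq ι] (l : List ι) (hl : l.Nodup) :
    (l.map fun i => powSpan K (f i)).prod ≤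
      span K (Set.range fun m : ι → ℕ => (l.map fun i => f i ^ m i).prod) := by
  induction l with
  | nil => simp [Submodule.one_eq_span]
  | cons i l ih =>
    rw [List.map_cons, List.prod_cons]
    obtain ⟨hi, hl'⟩ := List.nodup_cons.mp hl
    refine (mul_le_mul_right (ih hl') _).trans ?_
    rw [powSpan, span_mul_span, span_le]
    rintro _ ⟨_, ⟨m, rfl⟩, _, ⟨m', rfl⟩, rfl⟩
    refine subset_span ⟨Function.update m' i m, ?_⟩
    simp only [List.map_cons, List.prod_cons, Function.update_self]
    congr 2
    refine List.map_congr_left fun j hj => ?_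
    rw [Function.update_of_ne]
    rintro rfl
    exact hi hj

end list

/-- Moving a generator `b` past the algebra generated by `S`. -/
theorem adjoin_mul_le_of_commutator {S : Set R} {b : R} {M G : Submodule K R} (h1 : (1 : R) ∈ M)
    (hM : ∀ s ∈ S, M * span K {s} ≤ M)
    (h : ∀ s ∈ S, span K {s} * span K {b} ≤ span K {b} * span K {s} ⊔ G)
    (hG : Subalgebra.toSubmodule (Algebra.adjoin K S) * G ≤ M) :
    Subalgebra.toSubmodule (Algebra.adjoin K S) * span K {b} ≤ span K {b} * M ⊔ M := by
  set A := Subalgebra.toSubmodule (Algebra.adjoin K S) with hA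
  -- The elements $u$ of the algebra for which $ub$ has the required form; they contain $1$ and are
  -- stable under right multiplication by $S$.
  set N : Submodule K R := A ⊓ (span K {b} * M ⊔ M).comap (LinearMap.mulRight K b) with hN
  have hNb : N * span K {b} ≤ span K {b} * M ⊔ M := by
    rw [mul_le]
    intro u hu z hz
    obtain ⟨c, rfl⟩ := mem_span_singleton.mp hz
    rw [mul_smul_comm]
    exact smul_mem _ _ hu.2
  have hAN : A ≤ N := by
    refine adjoin_le_of_mul_le ⟨(Algebra.adjoin K S).one_mem, ?_⟩ fun s hs => ?_
    · change 1 * b ∈ span K {b} * M ⊔ M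
      rw [one_mul]
      refine mem_sup_left ?_
      simpa using mul_mem_mul (mem_span_singleton_self (R := K) b) h1
    · refine le_inf ((mul_le_mul_left (inf_le_left (b := _)) _).trans (adjoin_mul_span_le S hs)) ?_
      have key : N * span K {s} * span K {b} ≤ span K {b} * M ⊔ M := by
        calc _ = N * (span K {s} * span K {b}) := mul_assoc _ _ _
          _ ≤ N * (span K {b} * span K {s} ⊔ G) := mul_le_mul_right (h s hs) _
          _ = N * span K {b} * span K {s} ⊔ N * G := by
            rw [Submodule.mul_sup, mul_assoc]
          _ ≤ (span K {b} * M ⊔ M) * span K {s} ⊔ A * G :=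
            sup_le_sup (mul_le_mul_left hNb _) (mul_le_mul_left inf_le_left _)
          _ ≤ span K {b} * M ⊔ M := by
            rw [Submodule.sup_mul, mul_assoc]
            exact sup_le (sup_le_sup (mul_le_mul_right (hM s hs) _) (hM s hs))
              (hG.trans le_sup_right)
      intro u hu
      have hu' : u * b ∈ N * span K {s} * span K {b} :=
        mul_mem_mul hu (mem_span_singleton_self b)
      exact key hu'
  exact (mul_le_mul_left hAN _).trans hNb

end Spanning

/-! ### Spanning inside one component, column by column. -/

namespace LinkingDatum

section

variable {K Γ : Type*} [Field K] [CommGroup Γ] {t : ℕ} {n : Fin t → ℕ} (D : LinkingDatum K Γ n)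

open Submodule

variable (n) in
/-- The roots `e_{i,j}` with fixed `k` and `j`. -/
noncomputable def columnRoots (k : Fin t) (j : ℕ) : List (Root n) :=
  -- The order inside a column is arbitrary, which is harmless since its root vectors skew-commute.
  (univ.filter fun α : Root n => α.1 = k ∧ α.2.1.2.val = j).toList

variable (n) in
/-- The roots of one component. -/
noncomputable def componentRoots (k : Fin t) : List (Root n) :=
  (List.range (n k + 1)).flatMap (columnRoots n k)

variable (n) in
/-- An ordering of the roots, by components and columns. -/
noncomputable def rootList : List (Root n) := (List.finRange t).flatMap (componentRoots n)

theorem mem_columnRoots {k : Fin t} {j : ℕ} {α : Root n} :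
    α ∈ columnRoots n k j ↔ α.1 = k ∧ α.2.1.2.val = j := by
  simp [columnRoots]

theorem mem_componentRoots {k : Fin t} {α : Root n} : α ∈ componentRoots n k ↔ α.1 = k := by
  simp only [componentRoots, List.mem_flatMap, mem_columnRoots, List.mem_range]
  constructor
  · rintro ⟨_, _, h, _⟩
    exact h
  · rintro rfl
    exact ⟨_, α.2.1.2.isLt, rfl, rfl⟩

theorem mem_rootList (α : Root n) : α ∈ rootList n := by
  simp [rootList, mem_componentRoots]

theorem nodup_rootList : (rootList n).Nodup := by
  refine List.nodup_flatMap.mpr ⟨fun k _ => List.nodup_flatMap.mpr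
    ⟨fun j _ => Finset.nodup_toList _, ?_⟩, ?_⟩
  · refine List.nodup_range.imp fun {j j'} hjj' => ?_
    intro α hα hα'
    exact hjj' ((mem_columnRoots.mp hα).2.symm.trans (mem_columnRoots.mp hα').2)
  · refine (List.nodup_finRange t).imp fun {k k'} hkk' => ?_
    intro α hα hα'
    exact hkk' ((mem_componentRoots.mp hα).symm.trans (mem_componentRoots.mp hα'))

variable [∀ k, NeZero (n k)]

/-- The span of the ordered monomials of one column is the algebra it generates. -/
theorem column_le (k : Fin t) (j : ℕ) :
    Subalgebra.toSubmodule (Algebra.adjoin K (D.rv D.a '' {α | α ∈ columnRoots n k j})) ≤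
      ((columnRoots n k j).map fun α => powSpan K (D.rv D.a α)).prod := by
  have H := D.rep_U.serreA k
  refine adjoin_le_powSpan_prod (D.rv D.a) _ fun α hα β hβ => ?_
  obtain ⟨rfl, rfl⟩ := mem_columnRoots.mp hα
  obtain ⟨k, ⟨i, j⟩, hij⟩ := α
  obtain ⟨k', ⟨i', j'⟩, hij'⟩ := β
  obtain ⟨h1, h2⟩ := mem_columnRoots.mp hβ
  obtain rfl : k' = k := h1
  obtain rfl : j' = j := Fin.ext h2
  rcases lt_trichotomy i.val i'.val with h | h | h
  · exact ⟨_, H.qcomm_same_col (D.braidA k') h⟩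
  · obtain rfl : i = i' := Fin.ext h
    exact ⟨1, QComm.refl _⟩
  · exact ⟨_, (H.qcomm_same_col (D.braidA k') h).symm ((D.braidA k').bichar_ne_zero _ _ _ _)⟩

/-- Moving a generator past a column to its right. -/
theorem column_mul_le (k : Fin t) (j : ℕ) (l : Fin (n k)) (hl : l.val + 1 < j) :
    Subalgebra.toSubmodule (Algebra.adjoin K (D.rv D.a '' {α | α ∈ columnRoots n k j})) *
        span K {D.a ⟨k, l⟩} ≤
      span K {D.a ⟨k, l⟩} *
        Subalgebra.toSubmodule (Algebra.adjoin K (D.rv D.a '' {α | α ∈ columnRoots n k j})) ⊔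
        Subalgebra.toSubmodule (Algebra.adjoin K (D.rv D.a '' {α | α ∈ columnRoots n k j})) := by
  have H := D.rep_U.serreA k
  set A := Algebra.adjoin K (D.rv D.a '' {α | α ∈ columnRoots n k j}) with hA
  refine adjoin_mul_le_of_commutator (G := Subalgebra.toSubmodule A) A.one_mem
    (fun s hs => adjoin_mul_span_le _ hs) ?_ (mul_le.mpr fun _ hx _ hy => A.mul_mem hx hy)
  rintro _ ⟨α, hα, rfl⟩
  obtain ⟨rfl, rfl⟩ := mem_columnRoots.mp hα
  obtain ⟨c, d, e⟩ := H.rootVec_mul_eq (D.braidA _) (show α.2.1.1.val < α.2.1.2.val from α.2.2) hl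
  rw [seq_val] at e
  rw [span_mul_span, Set.singleton_mul_singleton, span_singleton_le_iff_mem]
  change rootVec _ _ _ _ * _ ∈ _
  rw [e]
  refine add_mem (mem_sup_left (smul_mem _ _ (mul_mem_mul (mem_span_singleton_self _)
    (mem_span_singleton_self _)))) (mem_sup_right (smul_mem _ _ (Algebra.subset_adjoin ?_)))
  exact ⟨⟨α.1, (l.castSucc, α.2.1.2), show l.val < α.2.1.2.val by omega⟩,
    mem_columnRoots.mpr ⟨rfl, rfl⟩, rfl⟩

/-- The algebra generated by the first `j` vertices of a component is the product of its first
`j` columns. -/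
theorem component_le (k : Fin t) (j : ℕ) (hj : j ≤ n k) :
    Subalgebra.toSubmodule (Algebra.adjoin K ((fun l : Fin (n k) => D.a ⟨k, l⟩) '' {l | l.val < j})) ≤
      (((List.range (j + 1)).flatMap (columnRoots n k)).map fun α => powSpan K (D.rv D.a α)).prod := by
  induction j with
  | zero =>
    refine adjoin_le_of_mul_le (one_mem_powSpan_prod _ _) ?_
    rintro _ ⟨l, hl, rfl⟩
    exact absurd hl (Nat.not_lt_zero _)
  | succ j ih =>
    set B := Subalgebra.toSubmodule (Algebra.adjoin K
      ((fun l : Fin (n k) => D.a ⟨k, l⟩) '' {l | l.val < j})) with hB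
    set A := Subalgebra.toSubmodule (Algebra.adjoin K
      (D.rv D.a '' {α | α ∈ columnRoots n k (j + 1)})) with hA
    rw [List.range_succ, List.flatMap_append, List.map_append, List.prod_append]
    have h1 : ((List.flatMap (columnRoots n k) [j + 1]).map fun α => powSpan K (D.rv D.a α)).prod =
        ((columnRoots n k (j + 1)).map fun α => powSpan K (D.rv D.a α)).prod := by simp
    rw [h1]
    refine le_trans ?_ (mul_le_mul' (ih (by omega)) (D.column_le k (j + 1)))
    have hB1 : (1 : D.U) ∈ B := Subalgebra.one_mem _
    have hA1 : (1 : D.U) ∈ A := Subalgebra.one_mem _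
    refine adjoin_le_of_mul_le (by simpa using mul_mem_mul hB1 hA1) ?_
    rintro _ ⟨l, hl, rfl⟩
    rw [mul_assoc]
    have hl : l.val < j + 1 := hl
    rcases Nat.lt_succ_iff_lt_or_eq.mp hl with hl' | hl'
    -- An older generator moves left past the new column and is absorbed by $B$; the generator of
    -- the new vertex is itself a root vector of the new column.
    · calc _ ≤ B * (span K {D.a ⟨k, l⟩} * A ⊔ A) :=
            mul_le_mul_right (D.column_mul_le k (j + 1) l (by omega)) _
        _ = B * span K {D.a ⟨k, l⟩} * A ⊔ B * A := by rw [Submodule.mul_sup, mul_assoc]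
        _ ≤ B * A := sup_le (mul_le_mul_left (adjoin_mul_span_le _
          (Set.mem_image_of_mem (fun l : Fin (n k) => D.a ⟨k, l⟩) hl')) _) le_rfl
    · refine mul_le_mul_right (adjoin_mul_span_le _ ?_) _
      refine ⟨⟨k, (l.castSucc, l.succ), Fin.castSucc_lt_succ⟩,
        mem_columnRoots.mpr ⟨rfl, by simp [hl']⟩, ?_⟩
      change rootVec _ _ l.val (l.val + 1) = _
      rw [rootVec_single, seq_val]

end

end LinkingDatum

/-! ### Spanning across the components and the group. -/

namespace LinkingDatum

section

variable {K Γ : Type*} [Field K] [CommGroup Γ] {t : ℕ} {n : Fin t → ℕ} (D : LinkingDatum K Γ n)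

open Submodule

/-- The span of the group elements. -/
def grpSpan : Submodule K D.U := span K (Set.range D.grp)

/-- The subalgebra generated by one component. -/
def componentAlg (k : Fin t) : Submodule K D.U :=
  Subalgebra.toSubmodule (Algebra.adjoin K (Set.range fun l : Fin (n k) => D.a ⟨k, l⟩))

theorem one_mem_grpSpan : 1 ∈ D.grpSpan := subset_span ⟨1, map_one _⟩

theorem one_mem_componentAlg (k : Fin t) : 1 ∈ D.componentAlg k := Subalgebra.one_mem _

theorem componentAlg_mul_self_le (k : Fin t) :
    D.componentAlg k * D.componentAlg k ≤ D.componentAlg k :=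
  mul_le.mpr fun _ hx _ hy => Subalgebra.mul_mem _ hx hy

theorem grpSpan_mul_self_le : D.grpSpan * D.grpSpan ≤ D.grpSpan := by
  rw [grpSpan, span_mul_span, span_le]
  rintro _ ⟨_, ⟨x, rfl⟩, _, ⟨z, rfl⟩, rfl⟩
  exact subset_span ⟨x * z, map_mul _ _ _⟩

theorem grpSpan_mul_gen_le (i : DiagramVertex n) :
    D.grpSpan * span K {D.a i} ≤ span K {D.a i} * D.grpSpan := by
  rw [grpSpan, span_mul_span, span_le]
  rintro _ ⟨_, ⟨x, rfl⟩, _, rfl, rfl⟩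
  have e : D.grp x * D.a i = _ := D.rep_U.grp x i
  change D.grp x * D.a i ∈ _
  rw [e]
  exact smul_mem _ _ (mul_mem_mul (mem_span_singleton_self _) (subset_span ⟨x, rfl⟩))

theorem grpSpan_mul_componentAlg_le (k : Fin t) :
    D.grpSpan * D.componentAlg k ≤ D.componentAlg k * D.grpSpan := by
  rw [mul_le]
  intro w hw x hx
  have hx' : x ∈ Algebra.adjoin K (Set.range fun l : Fin (n k) => D.a ⟨k, l⟩) := hx
  clear hx
  induction hx' using Algebra.adjoin_induction generalizing w with
  | mem x hx =>
    obtain ⟨l, rfl⟩ := hx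
    have h1 : span K {D.a ⟨k, l⟩} ≤ D.componentAlg k := by
      rw [span_singleton_le_iff_mem]
      exact Algebra.subset_adjoin ⟨l, rfl⟩
    exact mul_le_mul_left h1 _
      (D.grpSpan_mul_gen_le ⟨k, l⟩ (mul_mem_mul hw (mem_span_singleton_self _)))
  | algebraMap c =>
    rw [← Algebra.commutes]
    exact mul_mem_mul (Subalgebra.algebraMap_mem _ c) hw
  | add x y _ _ hx hy =>
    rw [mul_add]
    exact add_mem (hx w hw) (hy w hw)
  | mul x y hx' _ hx hy =>
    rw [← mul_assoc]
    have h2 : ∀ v ∈ D.componentAlg k * D.grpSpan, v * y ∈ D.componentAlg k * D.grpSpan := by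
      intro v hv
      induction hv using Submodule.mul_induction_on' with
      | mem_mul_mem b hb g hg =>
        rw [mul_assoc]
        have : b * (g * y) ∈ D.componentAlg k * (D.componentAlg k * D.grpSpan) :=
          mul_mem_mul hb (hy g hg)
        rw [← mul_assoc] at this
        exact mul_le_mul_left (D.componentAlg_mul_self_le k) _ this
      | add u _ v _ hu hv =>
        rw [add_mul]
        exact add_mem hu hv
    exact h2 _ (hx w hw)

/-- The product of the algebras generated by the components in `l` and the group algebra. -/
def componentProd (l : List (Fin t)) : Submodule K D.U := (l.map D.componentAlg).prod * D.grpSpan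

theorem componentProd_cons (k : Fin t) (l : List (Fin t)) :
    D.componentProd (k :: l) = D.componentAlg k * D.componentProd l := by
  rw [componentProd, List.map_cons, List.prod_cons, mul_assoc, componentProd]

theorem one_mem_componentProd (l : List (Fin t)) : 1 ∈ D.componentProd l := by
  induction l with
  | nil => simpa [componentProd] using D.one_mem_grpSpan
  | cons k l ih =>
    rw [componentProd_cons]
    simpa using mul_mem_mul (D.one_mem_componentAlg k) ih

theorem grpSpan_mul_componentProd_le (l : List (Fin t)) :
    D.grpSpan * D.componentProd l ≤ D.componentProd l := by
  induction l with
  | nil => simpa [componentProd] using D.grpSpan_mul_self_le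
  | cons k l ih =>
    rw [componentProd_cons]
    calc _ = D.grpSpan * D.componentAlg k * D.componentProd l := (mul_assoc _ _ _).symm
      _ ≤ D.componentAlg k * D.grpSpan * D.componentProd l :=
        mul_le_mul_left (D.grpSpan_mul_componentAlg_le k) _
      _ = D.componentAlg k * (D.grpSpan * D.componentProd l) := mul_assoc _ _ _
      _ ≤ _ := mul_le_mul_right ih _

theorem componentProd_mul_grpSpan_le (l : List (Fin t)) :
    D.componentProd l * D.grpSpan ≤ D.componentProd l := by
  rw [componentProd, mul_assoc]
  exact mul_le_mul_right D.grpSpan_mul_self_le _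

/-- Moving a generator past another component. -/
theorem componentAlg_mul_gen_le {k : Fin t} {i : DiagramVertex n} (hi : i.1 ≠ k) :
    D.componentAlg k * span K {D.a i} ≤ span K {D.a i} * (D.componentAlg k * D.grpSpan) ⊔
      D.componentAlg k * D.grpSpan := by
  refine adjoin_mul_le_of_commutator (G := D.grpSpan) ?_ ?_ ?_ le_rfl
  · simpa using mul_mem_mul (D.one_mem_componentAlg k) D.one_mem_grpSpan
  · rintro _ ⟨l, rfl⟩
    calc _ = D.componentAlg k * (D.grpSpan * span K {D.a ⟨k, l⟩}) := mul_assoc _ _ _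
      _ ≤ D.componentAlg k * (span K {D.a ⟨k, l⟩} * D.grpSpan) :=
        mul_le_mul_right (D.grpSpan_mul_gen_le _) _
      _ = (D.componentAlg k * span K {D.a ⟨k, l⟩}) * D.grpSpan := (mul_assoc _ _ _).symm
      _ ≤ _ := mul_le_mul_left (adjoin_mul_span_le _
        (Set.mem_range_self (f := fun l : Fin (n k) => D.a ⟨k, l⟩) l)) _
  · rintro _ ⟨l, rfl⟩
    rw [span_mul_span, Set.singleton_mul_singleton, span_singleton_le_iff_mem]
    have e := D.rep_U.link ⟨k, l⟩ i (Ne.symm hi)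
    rw [sub_eq_iff_eq_add'] at e
    change D.a ⟨k, l⟩ * D.a i ∈ _
    rw [e]
    exact add_mem (mem_sup_left (smul_mem _ _ (mul_mem_mul (mem_span_singleton_self _)
      (mem_span_singleton_self _)))) (mem_sup_right (smul_mem _ _
        (sub_mem D.one_mem_grpSpan (subset_span ⟨_, rfl⟩))))

/-- The linking relations let a generator pass foreign components; the error terms lie in the group
algebra, which itself moves to the right end. -/
theorem componentProd_mul_gen_le_of_notMem {i : DiagramVertex n} {l : List (Fin t)} (hi : i.1 ∉ l) :
    D.componentProd l * span K {D.a i} ≤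
      span K {D.a i} * D.componentProd l ⊔ D.componentProd l := by
  induction l with
  | nil =>
    refine le_trans ?_ le_sup_left
    simpa [componentProd] using D.grpSpan_mul_gen_le i
  | cons k l ih =>
    have hk : i.1 ≠ k := fun e => hi (by simp [e])
    have hl : i.1 ∉ l := fun e => hi (by simp [e])
    rw [componentProd_cons]
    calc _ = D.componentAlg k * (D.componentProd l * span K {D.a i}) := mul_assoc _ _ _
      _ ≤ D.componentAlg k * (span K {D.a i} * D.componentProd l ⊔ D.componentProd l) :=
        mul_le_mul_right (ih hl) _
      _ = D.componentAlg k * span K {D.a i} * D.componentProd l ⊔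
          D.componentAlg k * D.componentProd l := by rw [Submodule.mul_sup, mul_assoc]
      _ ≤ (span K {D.a i} * (D.componentAlg k * D.grpSpan) ⊔ D.componentAlg k * D.grpSpan) *
          D.componentProd l ⊔ D.componentAlg k * D.componentProd l :=
        sup_le_sup_right (mul_le_mul_left (D.componentAlg_mul_gen_le hk) _) _
      _ = (span K {D.a i} * (D.componentAlg k * (D.grpSpan * D.componentProd l)) ⊔
          D.componentAlg k * (D.grpSpan * D.componentProd l)) ⊔
          D.componentAlg k * D.componentProd l := by
        rw [Submodule.sup_mul]
        simp only [mul_assoc]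
      _ ≤ (span K {D.a i} * (D.componentAlg k * D.componentProd l) ⊔
          D.componentAlg k * D.componentProd l) ⊔ D.componentAlg k * D.componentProd l := by
        have := mul_le_mul_right (D.grpSpan_mul_componentProd_le l) (D.componentAlg k)
        exact sup_le_sup_right (sup_le_sup (mul_le_mul_right this _) this) _
      _ ≤ _ := sup_le le_rfl le_sup_right

theorem componentProd_mul_gen_le {i : DiagramVertex n} {l : List (Fin t)} (hl : l.Nodup)
    (hi : i.1 ∈ l) : D.componentProd l * span K {D.a i} ≤ D.componentProd l := by
  induction l with
  | nil => simp at hi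
  | cons k l ih =>
    obtain ⟨hk, hl⟩ := List.nodup_cons.mp hl
    rw [componentProd_cons, mul_assoc]
    rcases List.mem_cons.mp hi with rfl | hi'
    · calc _ ≤ D.componentAlg i.1 * (span K {D.a i} * D.componentProd l ⊔ D.componentProd l) :=
          mul_le_mul_right (D.componentProd_mul_gen_le_of_notMem hk) _
        _ = D.componentAlg i.1 * span K {D.a i} * D.componentProd l ⊔
            D.componentAlg i.1 * D.componentProd l := by rw [Submodule.mul_sup, mul_assoc]
        _ ≤ _ := sup_le (mul_le_mul_left (adjoin_mul_span_le _
          (Set.mem_range_self (f := fun l : Fin (n i.1) => D.a ⟨i.1, l⟩) i.2)) _) le_rfl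
    · exact mul_le_mul_right (ih hl hi') _

theorem componentProd_eq_top : D.componentProd (List.finRange t) = ⊤ := by
  set T := D.componentProd (List.finRange t) with hT
  have key : ∀ u : D.U, ∀ m ∈ T, m * u ∈ T := fun u => by
    induction u using D.U_induction with
    | hgrp x =>
      exact fun m hm => D.componentProd_mul_grpSpan_le _ (mul_mem_mul hm (subset_span ⟨x, rfl⟩))
    | ha i =>
      exact fun m hm => D.componentProd_mul_gen_le (List.nodup_finRange t) (List.mem_finRange i.1)
        (mul_mem_mul hm (mem_span_singleton_self _))
    | halg c =>
      intro m hm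
      rw [← Algebra.commutes, ← Algebra.smul_def]
      exact T.smul_mem c hm
    | hadd u v hu hv =>
      intro m hm
      rw [mul_add]
      exact T.add_mem (hu m hm) (hv m hm)
    | hmul u v hu hv =>
      intro m hm
      rw [← mul_assoc]
      exact hv _ (hu m hm)
  refine eq_top_iff.mpr fun u _ => ?_
  simpa using key u 1 (D.one_mem_componentProd _)

variable [∀ k, NeZero (n k)]

/-- The ordered monomials in the root vectors. -/
noncomputable def mono {R : Type*} [Ring R] [Algebra K R] (a : DiagramVertex n → R)
    (m : Root n → ℕ) : R := ((rootList n).map fun α => D.rv a α ^ m α).prod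

/-- The ordered monomials in the root vectors, times the group elements, span `𝔘(𝓓)`. -/
theorem span_mono_mul_grp :
    span K (Set.range fun p : (Root n → ℕ) × Γ => D.mono D.a p.1 * D.grp p.2) = ⊤ := by
  classical
  rw [eq_top_iff, ← D.componentProd_eq_top]
  have h1 : ((List.finRange t).map D.componentAlg).prod ≤
      ((rootList n).map fun α => powSpan K (D.rv D.a α)).prod := by
    rw [rootList]
    induction List.finRange t with
    | nil => simp
    | cons k l ih =>
      rw [List.map_cons, List.prod_cons, List.flatMap_cons, List.map_append, List.prod_append]
      refine mul_le_mul' ?_ ih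
      refine le_trans (le_of_eq ?_) (D.component_le k (n k) le_rfl)
      rw [componentAlg]
      congr 2
      ext u
      simp
  refine (mul_le_mul_left (h1.trans (powSpan_prod_le_span (D.rv D.a) _ nodup_rootList)) _).trans ?_
  rw [grpSpan, span_mul_span, span_le]
  rintro _ ⟨_, ⟨m, rfl⟩, _, ⟨x, rfl⟩, rfl⟩
  exact subset_span ⟨(m, x), rfl⟩

end

end LinkingDatum

/-! ### Linear independence through leading coefficients. -/

section HasTop

open Polynomial

variable {K R : Type*} [Field K] [Ring R] [Algebra K R]

/-- The polynomial `f` has degree at most `d`, and its coefficient in degree `d` is `x`. -/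
structure HasTop (d : ℕ) (x : R) (f : R[X]) : Prop where
  natDegree_le : f.natDegree ≤ d
  coeff_eq : f.coeff d = x

namespace HasTop

variable {d e : ℕ} {x y : R} {f g : R[X]}

theorem mul (h : HasTop d x f) (h' : HasTop e y g) : HasTop (d + e) (x * y) (f * g) where
  natDegree_le := natDegree_mul_le_of_le h.natDegree_le h'.natDegree_le
  coeff_eq := by
    rw [coeff_mul_add_eq_of_natDegree_le h.natDegree_le h'.natDegree_le, h.coeff_eq, h'.coeff_eq]

theorem sub (h : HasTop d x f) (h' : HasTop d y g) : HasTop d (x - y) (f - g) where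
  natDegree_le := natDegree_sub_le_of_le h.natDegree_le h'.natDegree_le |>.trans (max_self d).le
  coeff_eq := by rw [coeff_sub, h.coeff_eq, h'.coeff_eq]

theorem smul (h : HasTop d x f) (c : K) : HasTop d (c • x) (c • f) where
  natDegree_le := (natDegree_smul_le c f).trans h.natDegree_le
  coeff_eq := by rw [coeff_smul, h.coeff_eq]

theorem one : HasTop 0 (1 : R) 1 := ⟨natDegree_one.le, by simp⟩

theorem C (x : R) : HasTop 0 x (Polynomial.C x) := ⟨(natDegree_C x).le, by simp⟩

theorem pow (h : HasTop d x f) (m : ℕ) : HasTop (m * d) (x ^ m) (f ^ m) := by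
  induction m with
  | zero => simpa using one
  | succ m ih => rw [pow_succ, pow_succ, add_mul, one_mul]; exact ih.mul h

theorem list_prod {ι : Type*} {d : ι → ℕ} {x : ι → R} {f : ι → R[X]} (l : List ι)
    (h : ∀ i, HasTop (d i) (x i) (f i)) :
    HasTop (l.map d).sum (l.map x).prod (l.map f).prod := by
  induction l with
  | nil => simpa using one
  | cons i l ih => simpa using (h i).mul ih

theorem rootVec {p : ℕ → ℕ → K} {x : ℕ → R} {f : ℕ → R[X]} {i j : ℕ} (hij : i < j)
    (h : ∀ l, i ≤ l → l < j → HasTop d (x l) (f l)) :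
    HasTop ((j - i) * d) (rootVec p x i j) (rootVec p f i j) := by
  induction j, hij using Nat.le_induction with
  | base =>
    rw [rootVec_single, rootVec_single, Nat.succ_eq_add_one, Nat.add_sub_cancel_left, one_mul]
    exact h i le_rfl (Nat.lt_succ_self i)
  | succ j hj ih =>
    have hij : i < j := hj
    have h1 := ih fun l hl hl' => h l hl (by omega)
    have h2 := h j hij.le (Nat.lt_succ_self j)
    rw [rootVec_succ hij, rootVec_succ hij, Nat.sub_add_comm hij.le, add_mul, one_mul]
    have h3 := (h2.mul h1).smul (bichar p i j j (j + 1))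
    rw [add_comm d] at h3
    exact (h1.mul h2).sub h3

end HasTop

/-- Polynomials are linearly independent if their top coefficients are. -/
theorem linearIndependent_of_hasTop {ι : Type*} {v : ι → R[X]} {d : ι → ℕ} {x : ι → R}
    (h : ∀ i, HasTop (d i) (x i) (v i)) (hx : LinearIndependent K x) : LinearIndependent K v := by
  classical
  rw [linearIndependent_iff'] at hx ⊢
  intro s c hc
  by_contra! hne
  obtain ⟨i, hi, hci⟩ := hne
  -- Among the terms with nonzero coefficient, one of largest formal degree is taken. The relation
  -- in that degree involves only leading coefficients.
  obtain ⟨i₀, hi₀, hmax⟩ := exists_max_image (s.filter fun i => c i ≠ 0) d ⟨i, by simp [hi, hci]⟩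
  obtain ⟨hi₀s, hci₀⟩ := mem_filter.mp hi₀
  refine hci₀ (hx (s.filter fun i => c i ≠ 0 ∧ d i = d i₀) c ?_ i₀ (by simp [hi₀s, hci₀]))
  have e := congrArg (fun f : R[X] => f.coeff (d i₀)) hc
  simp only [finsetSum_coeff, coeff_smul, coeff_zero] at e
  rw [← e, sum_filter]
  refine sum_congr rfl fun i hi => ?_
  split_ifs with hd
  · rw [← (h i).coeff_eq, hd.2]
  · by_cases hci : c i = 0
    · rw [hci, zero_smul]
    · have h1 := hmax i (by simp [hi, hci])
      have h2 : d i ≠ d i₀ := fun e => hd ⟨hci, e⟩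
      rw [coeff_eq_zero_of_natDegree_lt ((h i).natDegree_le.trans_lt (lt_of_le_of_ne h1 h2)),
        smul_zero]

end HasTop

/-! ### Weighted shift operators and the skew polynomial realization. -/

section WeightedShift

variable {K ι : Type*} [Field K]

/-- The operator that maps the basis vector `p` to `w p` times the basis vector `f p`. -/
noncomputable def weightedShift (f : ι → ι) (w : ι → K) : Module.End K (ι →₀ K) :=
  Finsupp.linearCombination K fun p => Finsupp.single (f p) (w p)

@[simp] theorem weightedShift_single (f : ι → ι) (w : ι → K) (p : ι) (c : K) :
    weightedShift f w (Finsupp.single p c) = Finsupp.single (f p) (c * w p) := by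
  rw [weightedShift, Finsupp.linearCombination_single, Finsupp.smul_single, smul_eq_mul]

theorem weightedShift_mul (f f' : ι → ι) (w w' : ι → K) :
    weightedShift f w * weightedShift f' w' =
      weightedShift (fun p => f (f' p)) fun p => w' p * w (f' p) := by
  refine Finsupp.lhom_ext fun p c => ?_
  rw [Module.End.mul_apply, weightedShift_single, weightedShift_single, weightedShift_single,
    mul_assoc]

theorem weightedShift_smul (f : ι → ι) (w : ι → K) (c : K) :
    c • weightedShift f w = weightedShift f fun p => c * w p := by
  refine Finsupp.lhom_ext fun p b => ?_
  rw [LinearMap.smul_apply, weightedShift_single, weightedShift_single, Finsupp.smul_single,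
    smul_eq_mul, mul_left_comm]

theorem weightedShift_one : weightedShift (fun p : ι => p) (fun _ => (1 : K)) = 1 := by
  refine Finsupp.lhom_ext fun p b => ?_
  simp

end WeightedShift

namespace LinkingDatum

section

variable {K Γ : Type*} [Field K] [CommGroup Γ] {t : ℕ} {n : Fin t → ℕ} {D : LinkingDatum K Γ n}
variable {R : Type*} [Ring R] [Algebra K R]

/-- The families are added in increasing order of their keys, so that each new one skew-commutes in
the direction demanded by `Rep.add`. -/
theorem Rep.sum {ι α : Type*} [DecidableEq ι] [LinearOrder α] {y : Γ →* R}
    {Q : ι → DiagramVertex n → R} (key : ι → α)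
    (hkey : Function.Injective key) (h : ∀ s, D.Rep y (Q s) fun _ _ => 0)
    (hQ : ∀ r s, key r < key s → ∀ i j, QComm (D.br j i) (Q s j) (Q r i)) (S : Finset ι) :
    D.Rep y (fun i => ∑ s ∈ S, Q s i) fun _ _ => 0 := by
  induction S using Finset.induction_on_max_value key with
  | empty => simpa using Rep.zero y
  | insert a S ha hmax ih =>
    have := ih.add (h a) fun i j => QComm.sum_right fun r hr =>
      hQ r a (lt_of_le_of_ne (hmax r hr) fun e => ha (hkey e ▸ hr)) i j
    simp only [sum_insert ha, add_comm (Q a _)]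
    simpa using this

end

end LinkingDatum

namespace LinkingDatum

section

variable {K Γ : Type*} [Field K] [CommGroup Γ] {t : ℕ} {n : Fin t → ℕ} (D : LinkingDatum K Γ n)

/-- The lowest vertex of a root. -/
def rootVtx (α : Root n) : DiagramVertex n :=
  ⟨α.1, α.2.1.1.val, by
    have h1 : α.2.1.1.val < α.2.1.2.val := α.2.2
    have h2 := α.2.1.2.isLt
    omega⟩

/-- The order of the variables: by components, then by decreasing `j`, then by increasing `i`. -/
def rootKey (α : Root n) : ℕ ×ₗ (ℕ ×ₗ ℕ) :=
  toLex (α.1.val, toLex (n α.1 - α.2.1.2.val, α.2.1.1.val))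

theorem rootKey_injective : Function.Injective (rootKey (n := n)) := by
  rintro ⟨k, ⟨i, j⟩, hij⟩ ⟨k', ⟨i', j'⟩, hij'⟩ h
  simp only [rootKey, EmbeddingLike.apply_eq_iff_eq, Prod.mk.injEq] at h
  obtain ⟨h1, h2, h3⟩ := h
  obtain rfl : k = k' := Fin.ext h1
  obtain rfl : i = i' := Fin.ext h3
  obtain rfl : j = j' := Fin.ext (by omega)
  rfl

theorem rootKey_lt {r s : Root n} (hk : r.1 = s.1)
    (h : s.2.1.2.val < r.2.1.2.val ∨ s.2.1.2.val = r.2.1.2.val ∧ r.2.1.1.val < s.2.1.1.val) :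
    rootKey r < rootKey s := by
  obtain ⟨k, ⟨i, j⟩, hij⟩ := r
  obtain ⟨k', ⟨i', j'⟩, hij'⟩ := s
  obtain rfl : k = k' := hk
  simp only [rootKey, lt_self_iff_false, true_and, false_or, Prod.Lex.toLex_lt_toLex] at h ⊢
  have h1 := j.isLt
  have h2 := j'.isLt
  omega

/-- The space on which the variables act. -/
abbrev ShiftSpace (_D : LinkingDatum K Γ n) : Type _ := ((Root n → ℕ) × Γ) →₀ K

theorem prod_pow_add_single {ι M : Type*} [DecidableEq ι] [CommMonoid M] (S : Finset ι) (f : ι → M)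
    (m : ι → ℕ) (s : ι) : ∏ r ∈ S, f r ^ (m + Pi.single s 1 : ι → ℕ) r =
      (∏ r ∈ S, f r ^ m r) * if s ∈ S then f s else 1 := by
  rw [← prod_ite_eq' S s f, ← prod_mul_distrib]
  refine prod_congr rfl fun r _ => ?_
  rw [Pi.add_apply, pow_add, Pi.single_apply]
  split_ifs <;> simp

open Classical in
/-- The variable attached to a root: multiplication in a skew polynomial ring. -/
noncomputable def shiftVar (s : Root n) : Module.End K D.ShiftSpace :=
  weightedShift (fun p => (p.1 + Pi.single s 1, p.2))
    fun p => ∏ r with rootKey r < rootKey s, D.br (rootVtx s) (rootVtx r) ^ p.1 r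

/-- The action of `Γ` on the skew polynomial ring. -/
noncomputable def shiftGrp : Γ →* Module.End K D.ShiftSpace where
  toFun x := weightedShift (fun p => (p.1, x * p.2))
    fun p => ∏ r, ((D.χ (rootVtx r) x : Kˣ) : K) ^ p.1 r
  map_one' := by simpa using weightedShift_one
  map_mul' x z := by
    rw [weightedShift_mul]
    congr 1
    · funext p
      simp [mul_assoc]
    · funext p
      rw [← prod_mul_distrib]
      refine prod_congr rfl fun r _ => ?_
      rw [map_mul, Units.val_mul, mul_pow, mul_comm]

theorem shiftGrp_shiftVar (x : Γ) (s : Root n) :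
    QComm ((D.χ (rootVtx s) x : Kˣ) : K) (D.shiftGrp x) (D.shiftVar s) := by
  classical
  change weightedShift _ _ * weightedShift _ _ = _ • (weightedShift _ _ * weightedShift _ _)
  rw [weightedShift_mul, weightedShift_mul, weightedShift_smul]
  congr 1
  funext p
  simp only [prod_pow_add_single, mem_univ, if_true]
  ring

theorem shiftVar_shiftVar {r s : Root n} (h : rootKey r < rootKey s) :
    QComm (D.br (rootVtx s) (rootVtx r)) (D.shiftVar s) (D.shiftVar r) := by
  classical
  rw [QComm, shiftVar, shiftVar, weightedShift_mul, weightedShift_mul, weightedShift_smul]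
  congr 1
  · funext p
    simp [add_right_comm]
  · funext p
    simp only [prod_pow_add_single, mem_filter, mem_univ, true_and, h, h.not_gt, if_true, if_false]
    ring

open Polynomial

/-- Polynomials in one variable over the operators. -/
abbrev ShiftPoly : Type _ := @Polynomial (Module.End K D.ShiftSpace) Ring.toSemiring

/-- The contribution of one variable to the generators. -/
noncomputable def slot (s : Root n) (i : DiagramVertex n) : D.ShiftPoly :=
  -- The degree $n_k+1-j$ decreases with $j$: among the columns $\ge j$, the column $j$ has the
  -- highest degree.
  if i = rootVtx s then monomial (n s.1 + 1 - s.2.1.2.val) (D.shiftVar s) else 0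

/-- The action of `Γ`, with values in constant polynomials. -/
noncomputable def polyGrp : Γ →* D.ShiftPoly where
  toFun x := monomial 0 (D.shiftGrp x)
  map_one' := by rw [map_one]; rfl
  map_mul' x z := by rw [map_mul, monomial_mul_monomial]

theorem QComm.monomial {R : Type*} [Ring R] [Algebra K R] {c : K} {x y : R} (h : QComm c x y)
    (d e : ℕ) : QComm c (monomial d x) (monomial e y) := by
  have h' : x * y = _ := h
  rw [QComm, monomial_mul_monomial, monomial_mul_monomial, h', smul_monomial, add_comm]

theorem slot_slot {r s : Root n} (h : rootKey r < rootKey s) (i j : DiagramVertex n) :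
    QComm (D.br j i) (D.slot s j) (D.slot r i) := by
  unfold slot
  split_ifs with h1 h2
  · rw [h1, h2]
    exact QComm.monomial (D.shiftVar_shiftVar h) _ _
  · exact QComm.zero_right _ _
  · exact QComm.zero_left _ _
  · exact QComm.zero_left _ _

/-- Every Serre, commutation or linking relation has in each monomial two different generators, one
of which is zero. -/
theorem Rep.single {R : Type*} [Ring R] [Algebra K R] {y : Γ →* R} {v : DiagramVertex n} {b : R}
    (h : ∀ x, QComm ((D.χ v x : Kˣ) : K) (y x) b) :
    D.Rep y (fun i => if i = v then b else 0) fun _ _ => 0 := by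
  have key : ∀ i j : DiagramVertex n, i ≠ j →
      (if i = v then b else 0) = 0 ∨ (if j = v then b else 0) = 0 := fun i j hij => by
    by_cases hi : i = v
    · exact Or.inr (if_neg fun hj => hij (hi.trans hj.symm))
    · exact Or.inl (if_neg hi)
  have hne : ∀ (k : Fin t) (l m : Fin (n k)), l.val ≠ m.val →
      (⟨k, l⟩ : DiagramVertex n) ≠ ⟨k, m⟩ := fun k l m hlm e =>
    hlm (by simpa using congrArg (fun v : DiagramVertex n => v.2.val) e)
  constructor
  · intro x i
    split_ifs with hi
    · rw [hi]
      exact h x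
    · exact QComm.zero_right _ _
  · intro k l m hlm
    rcases key _ _ (hne k l m (by omega)) with e | e <;> rw [e]
    exacts [QComm.zero_left _ _, QComm.zero_right _ _]
  · intro k l m hlm
    rcases key _ _ (hne k l m (by omega)) with e | e <;> rw [e]
    exacts [qSerre_zero_left _ _ _, qSerre_zero_right _ _ _]
  · intro i j hij
    rcases key i j (fun e => hij (congrArg Sigma.fst e)) with e | e <;> rw [e] <;> simp

theorem rep_slot (s : Root n) : D.Rep D.polyGrp (D.slot s) fun _ _ => 0 :=
  Rep.single (D := D) fun x => QComm.monomial (D.shiftGrp_shiftVar x s) 0 _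

theorem rep_slots (S : Finset (Root n)) :
    D.Rep D.polyGrp (fun i => ∑ s ∈ S, D.slot s i) fun _ _ => 0 := by
  classical
  exact Rep.sum rootKey rootKey_injective D.rep_slot (fun r s h => D.slot_slot h) S

/-- Operators that map each basis vector to a nonzero multiple of its translate. -/
def IsShift (ω : Root n → ℕ) (x : Γ) (T : Module.End K D.ShiftSpace) : Prop :=
  ∀ p : (Root n → ℕ) × Γ, ∃ c : K, c ≠ 0 ∧
    T (Finsupp.single p 1) = Finsupp.single (p.1 + ω, x * p.2) c

variable {D}

namespace IsShift

variable {ω ω' : Root n → ℕ} {x x' : Γ} {T T' : Module.End K D.ShiftSpace}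

theorem mul (h : D.IsShift ω x T) (h' : D.IsShift ω' x' T') :
    D.IsShift (ω + ω') (x * x') (T * T') := fun p => by
  obtain ⟨c', hc', e'⟩ := h' p
  obtain ⟨c, hc, e⟩ := h (p.1 + ω', x' * p.2)
  refine ⟨c' * c, mul_ne_zero hc' hc, ?_⟩
  have e2 : Finsupp.single (p.1 + ω', x' * p.2) c' =
      c' • Finsupp.single (p.1 + ω', x' * p.2) (1 : K) := by simp
  rw [Module.End.mul_apply, e', e2, map_smul, e, Finsupp.smul_single, smul_eq_mul]
  simp only [add_assoc, add_comm ω ω', mul_assoc]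

theorem smul (h : D.IsShift ω x T) {b : K} (hb : b ≠ 0) : D.IsShift ω x (b • T) := fun p => by
  obtain ⟨c, hc, e⟩ := h p
  exact ⟨b * c, mul_ne_zero hb hc, by rw [LinearMap.smul_apply, e, Finsupp.smul_single, smul_eq_mul]⟩

theorem one : D.IsShift 0 1 1 := fun p => ⟨1, one_ne_zero, by simp⟩

theorem pow (h : D.IsShift ω 1 T) (m : ℕ) : D.IsShift (m • ω) 1 (T ^ m) := by
  induction m with
  | zero => simpa using one
  | succ m ih => simpa [pow_succ, add_mul] using ih.mul h

theorem list_prod {ι : Type*} {ω : ι → Root n → ℕ} {T : ι → Module.End K D.ShiftSpace} (l : List ι)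
    (h : ∀ i, D.IsShift (ω i) 1 (T i)) : D.IsShift (l.map ω).sum 1 (l.map T).prod := by
  induction l with
  | nil => simpa using one
  | cons i l ih => simpa using (h i).mul ih

/-- Applied to the basis vector $(0,1)$, these operators give nonzero multiples of distinct basis
vectors. -/
theorem linearIndependent {ι : Type*} {ω : ι → Root n → ℕ} {x : ι → Γ}
    {T : ι → Module.End K D.ShiftSpace} (h : ∀ i, D.IsShift (ω i) (x i) (T i))
    (hinj : Function.Injective fun i => (ω i, x i)) : LinearIndependent K T := by
  refine LinearIndependent.of_comp (LinearMap.applyₗ (Finsupp.single (0, 1) 1)) ?_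
  choose c hc e using fun i => h i (0, 1)
  have h1 : LinearIndependent K fun i => Finsupp.single (ω i, x i) (1 : K) :=
    (Finsupp.linearIndependent_single_one K _).comp _ hinj
  convert h1.units_smul (fun i => Units.mk0 (c i) (hc i)) using 1
  funext i
  simp [e, Units.smul_def]

end IsShift

theorem isShift_shiftGrp (x : Γ) : D.IsShift 0 x (D.shiftGrp x) := fun p =>
  ⟨∏ r, ((D.χ (rootVtx r) x : Kˣ) : K) ^ p.1 r,
    prod_ne_zero_iff.mpr fun _ _ => pow_ne_zero _ (Units.ne_zero _), by
      change weightedShift _ _ _ = _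
      simp⟩

open Classical in
theorem isShift_shiftVar (s : Root n) : D.IsShift (Pi.single s 1) 1 (D.shiftVar s) := fun p =>
  ⟨∏ r with rootKey r < rootKey s, D.br (rootVtx s) (rootVtx r) ^ p.1 r,
    prod_ne_zero_iff.mpr fun _ _ => pow_ne_zero _ (D.br_ne_zero _ _), by
      simp [shiftVar]⟩

end

end LinkingDatum

/-- The root vectors of skew commuting elements are monomials. -/
theorem rootVec_succ_of_qcomm {K R : Type*} [Field K] [Ring R] [Algebra K R] {q : K}
    {p : ℕ → ℕ → K} (B : BraidA q p) {x : ℕ → R} {i j : ℕ} (hij : i < j)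
    (h : ∀ l, i ≤ l → l < j → QComm (p j l) (x j) (x l)) :
    rootVec p x i (j + 1) = (1 - q⁻¹) • (rootVec p x i j * x j) := by
  have e : x j * rootVec p x i j = _ := rootVec_qcomm_right h
  rw [rootVec_succ hij, e, ← bichar_eq_prod_right, smul_smul, B.bichar_adj hij (Nat.lt_succ_self j),
    sub_smul, one_smul]

/-! ### Independence of the ordered monomials without linking. -/

namespace LinkingDatum

section

variable {K Γ : Type*} [Field K] [CommGroup Γ] {t : ℕ} {n : Fin t → ℕ} (D : LinkingDatum K Γ n)

open Polynomial

/-- The variables in the column `j` of the component `k`. -/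
noncomputable def columnVar (k : Fin t) (j : Fin (n k + 1)) (l : ℕ) : Module.End K D.ShiftSpace :=
  if h : l < j.val then D.shiftVar ⟨k, (⟨l, h.trans j.isLt⟩, j), h⟩ else 0

theorem root_eq_iff {k : Fin t} {i j : Fin (n k + 1)} (h : i < j) (β : Root n) :
    β = ⟨k, (i, j), h⟩ ↔ β.1 = k ∧ β.2.1.2.val = j.val ∧ β.2.1.1.val = i.val := by
  constructor
  · rintro rfl
    exact ⟨rfl, rfl, rfl⟩
  · obtain ⟨k', ⟨i', j'⟩, h'⟩ := β
    rintro ⟨h1, h2, h3⟩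
    obtain rfl : k' = k := h1
    obtain rfl : j' = j := Fin.ext h2
    obtain rfl : i' = i := Fin.ext h3
    rfl

theorem isShift_columnVar (k : Fin t) (j : Fin (n k + 1)) {l : ℕ} (hl : l < j.val) :
    D.IsShift (fun β => if β.1 = k ∧ β.2.1.2.val = j.val ∧ β.2.1.1.val = l then 1 else 0) 1
      (D.columnVar k j l) := by
  classical
  rw [columnVar, dif_pos hl]
  convert D.isShift_shiftVar ⟨k, (⟨l, hl.trans j.isLt⟩, j), hl⟩ using 1
  funext β
  rw [Pi.single_apply]
  exact if_congr (root_eq_iff (k := k) (i := ⟨l, hl.trans j.isLt⟩) (j := j) hl β).symm rfl rfl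

variable [∀ k, NeZero (n k)]

theorem columnVar_qcomm (k : Fin t) (j : Fin (n k + 1)) {l m : ℕ} (hlm : l < m) :
    QComm (D.braid k m l) (D.columnVar k j m) (D.columnVar k j l) := by
  unfold columnVar
  by_cases hm : m < j.val
  · have hj := j.isLt
    rw [dif_pos hm, dif_pos (hlm.trans hm), D.braid_of_lt (by omega) (by omega)]
    exact D.shiftVar_shiftVar (rootKey_lt rfl (Or.inr ⟨rfl, hlm⟩))
  · rw [dif_neg hm]
    exact QComm.zero_left _ _

/-- The variables of a column skew-commute, so each bracket is $1-q^{-1}\ne0$ times a product; the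
result is a nonzero multiple of $x_{i,j}x_{i+1,j}\cdots x_{m-1,j}$. -/
theorem isShift_rootVec_columnVar (k : Fin t) (j : Fin (n k + 1)) {i m : ℕ} (him : i < m)
    (hm : m ≤ j.val) :
    D.IsShift (fun β => if β.1 = k ∧ β.2.1.2.val = j.val ∧ i ≤ β.2.1.1.val ∧ β.2.1.1.val < m
      then 1 else 0) 1 (rootVec (D.braid k) (D.columnVar k j) i m) := by
  induction m, him using Nat.le_induction with
  | base =>
    rw [rootVec_single]
    convert D.isShift_columnVar k j (l := i) hm using 1
    funext β
    refine if_congr ?_ rfl rfl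
    omega
  | succ m him ih =>
    have him : i < m := him
    have B := D.braidA k
    have h1 := ((ih (by omega)).mul (D.isShift_columnVar k j (l := m) (by omega))).smul
      (b := 1 - (D.q k : K)⁻¹) (sub_ne_zero.mpr fun e => D.q_ne_one k (inv_eq_one.mp e.symm))
    rw [rootVec_succ_of_qcomm B him fun l _ hl' => D.columnVar_qcomm k j hl', ← mul_one (1 : Γ)]
    convert h1 using 1
    funext β
    simp only [Pi.add_apply]
    by_cases hβ : β.1 = k ∧ β.2.1.2.val = j.val
    · simp only [hβ.1, hβ.2, true_and]
      split_ifs <;> omega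
    · rw [if_neg (by tauto), if_neg (by tauto), if_neg (by tauto)]

/-- The exponent of the leading monomial of a root vector. -/
def rootExp (α β : Root n) : ℕ :=
  if β.1 = α.1 ∧ β.2.1.2.val = α.2.1.2.val ∧ α.2.1.1.val ≤ β.2.1.1.val then 1 else 0

/-- The generators, in terms of the variables. -/
noncomputable def shiftGen (i : DiagramVertex n) : D.ShiftPoly := ∑ s, D.slot s i

omit [∀ k, NeZero (n k)] in
theorem rep_shiftGen : D.Rep D.polyGrp D.shiftGen fun _ _ => 0 := D.rep_slots univ

omit [∀ k, NeZero (n k)] in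
theorem hasTop_slot_sum (k : Fin t) (j : Fin (n k + 1)) {l : ℕ} (hl : l < j.val) :
    HasTop (n k + 1 - j.val) (D.columnVar k j l)
      (seq k (fun i => ∑ s with s.1 = k ∧ j.val ≤ s.2.1.2.val, D.slot s i) l) := by
  have hj := j.isLt
  rw [seq_of_lt _ (show l < n k by omega)]
  constructor
  · refine natDegree_sum_le_of_forall_le _ _ fun s hs => ?_
    obtain ⟨rfl, hs⟩ := (mem_filter.mp hs).2
    unfold slot
    split_ifs
    · exact (natDegree_monomial_le _).trans (by omega)
    · simp
  · rw [finsetSum_coeff, columnVar, dif_pos hl, sum_eq_single ⟨k, (⟨l, hl.trans j.isLt⟩, j), hl⟩]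
    · exact (congrArg (fun f : D.ShiftPoly => f.coeff _) (if_pos rfl)).trans
        (coeff_monomial_same _ _)
    · intro s hs hne
      obtain ⟨hs1, hs2⟩ := (mem_filter.mp hs).2
      unfold slot
      split_ifs with hv
      · rw [coeff_monomial, if_neg]
        intro hd
        refine hne ((root_eq_iff _ s).mpr ⟨hs1, ?_, ?_⟩)
        · subst hs1
          have := s.2.1.2.isLt
          omega
        · subst hs1
          have := congrArg (fun v : DiagramVertex n => v.2.val) hv
          exact this.symm
      · simp
    · intro hs
      simp at hs

/-- The generators are split as $P+Q$ into columns $\ge j$ and columns $<j$. No root in a column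
$<j$ has lowest vertex $j-1$, so $Q_{j-1}=0$, and the coproduct formula shows that $e_{i,j}$ depends
on $P$ only. In $P$ the column $j$ has the top degree, which gives the leading coefficient. -/
theorem exists_isShift_hasTop_rv (α : Root n) : ∃ T, D.IsShift (rootExp α) 1 T ∧
    HasTop ((α.2.1.2.val - α.2.1.1.val) * (n α.1 + 1 - α.2.1.2.val)) T (D.rv D.shiftGen α) := by
  obtain ⟨k, ⟨i, j⟩, hij⟩ := α
  have hij' : i.val < j.val := hij
  refine ⟨rootVec (D.braid k) (D.columnVar k j) i j, ?_, ?_⟩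
  · convert D.isShift_rootVec_columnVar k j hij' le_rfl using 1
    funext β
    refine if_congr ?_ rfl rfl
    constructor
    · rintro ⟨h1, h2, h3⟩
      have h4 : β.2.1.1.val < β.2.1.2.val := β.2.2
      exact ⟨h1, h2, h3, h2 ▸ h4⟩
    · rintro ⟨h1, h2, h3, _⟩
      exact ⟨h1, h2, h3⟩
  · set P : DiagramVertex n → D.ShiftPoly :=
      fun i => ∑ s with s.1 = k ∧ j.val ≤ s.2.1.2.val, D.slot s i with hP
    set Q : DiagramVertex n → D.ShiftPoly :=
      fun i => ∑ s with s.1 = k ∧ s.2.1.2.val < j.val, D.slot s i with hQ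
    have e : seq k D.shiftGen = fun l => seq k P l + seq k Q l := by
      funext l
      by_cases hl : l < n k
      · rw [seq_of_lt _ hl, seq_of_lt _ hl, seq_of_lt _ hl, hP, hQ]
        have h1 : ∀ s : Root n, s ∈ univ → D.slot s ⟨k, l, hl⟩ ≠ 0 → s.1 = k := fun s _ hs => by
          by_contra hk
          refine hs (if_neg fun hv => hk ?_)
          exact (congrArg Sigma.fst hv).symm
        rw [shiftGen, ← sum_filter_of_ne h1, ← sum_filter_add_sum_filter_not _
          (fun s : Root n => j.val ≤ s.2.1.2.val), filter_filter, filter_filter]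
        simp only [not_le]
      · rw [seq_of_le _ (by omega), seq_of_le _ (by omega), seq_of_le _ (by omega), add_zero]
    have hrP : D.Rep D.polyGrp P fun _ _ => 0 := D.rep_slots _
    have hQP : ∀ i j, QComm (D.br j i) (Q j) (P i) := fun i j =>
      QComm.sum_left fun s hs => QComm.sum_right fun r hr => by
        obtain ⟨hs1, hs2⟩ := (mem_filter.mp hs).2
        obtain ⟨hr1, hr2⟩ := (mem_filter.mp hr).2
        exact D.slot_slot (rootKey_lt (hr1.trans hs1.symm) (Or.inl (by omega))) i j
    have hQ0 : seq k Q (j.val - 1) = 0 := by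
      have hj := j.isLt
      rw [seq_of_lt _ (show j.val - 1 < n k by omega), hQ]
      refine sum_eq_zero fun s hs => ?_
      obtain ⟨hs1, hs2⟩ := (mem_filter.mp hs).2
      refine if_neg fun hv => ?_
      subst hs1
      have h1 : j.val - 1 = s.2.1.1.val := congrArg (fun v : DiagramVertex n => v.2.val) hv
      have h2 : s.2.1.1.val < s.2.1.2.val := s.2.2
      omega
    have key : D.rv D.shiftGen ⟨k, (i, j), hij⟩ = rootVec (D.braid k) (seq k P) i j := by
      change rootVec (D.braid k) (seq k D.shiftGen) i j = _
      rw [e, rootVec_add (D.braidA k) (hrP.serreA k).far (seq_qcomm (D := D) hQP k) hij',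
        sum_Ico_succ_top hij'.le, sum_eq_zero, zero_add]
      · simp [comulCoeff]
      · intro m hm
        obtain ⟨hm1, hm2⟩ := mem_Ico.mp hm
        have e2 : j.val = j.val - 1 + 1 := by omega
        rw [e2, rootVec_eq_zero (by omega) hQ0, mul_zero, smul_zero]
    rw [key]
    exact HasTop.rootVec hij' fun l _ hl => D.hasTop_slot_sum k j hl

omit [∀ k, NeZero (n k)] in
-- The coordinate at $(i,j)$ is the sum of the $m_{(i',j)}$ with $i'\le i$ in the same component, a
-- triangular system solved by induction on $i$.
theorem rootExp_injective {m m' : Root n → ℕ}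
    (h : ∑ α, m α • rootExp α = ∑ α, m' α • rootExp α) : m = m' := by
  have key : ∀ (N : ℕ) (α : Root n), α.2.1.1.val = N → m α = m' α := fun N => by
    induction N using Nat.strong_induction_on with
    | _ N ih =>
    intro α hα
    have e := congrFun h α
    simp only [Finset.sum_apply, Pi.smul_apply, smul_eq_mul] at e
    rw [← add_sum_erase _ _ (mem_univ α), ← add_sum_erase (a := α) univ (fun β => m' β * _) (mem_univ α)] at e
    have e2 : ∑ β ∈ univ.erase α, m β * rootExp β α = ∑ β ∈ univ.erase α, m' β * rootExp β α := by
      refine sum_congr rfl fun β hβ => ?_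
      by_cases hr : rootExp β α = 0
      · rw [hr, mul_zero, mul_zero]
      · have h3 : α.1 = β.1 ∧ α.2.1.2.val = β.2.1.2.val ∧ β.2.1.1.val ≤ α.2.1.1.val := by
          by_contra hh
          exact hr (if_neg hh)
        have hne : β.2.1.1.val ≠ α.2.1.1.val := fun e => (mem_erase.mp hβ).1
          ((root_eq_iff α.2.2 β).mpr ⟨h3.1.symm, h3.2.1.symm, e⟩)
        rw [ih β.2.1.1.val (by omega) β rfl]
    have e3 : rootExp α α = 1 := if_pos ⟨rfl, rfl, le_rfl⟩
    rw [e2, e3] at e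
    omega
  exact funext fun α => key _ α rfl

omit [∀ k, NeZero (n k)] in
theorem list_sum_rootList {M : Type*} [AddCommMonoid M] (f : Root n → M) :
    ((rootList n).map f).sum = ∑ α, f α := by
  classical
  rw [← List.sum_toFinset _ nodup_rootList]
  congr 1
  ext α
  simp [mem_rootList]

/-- The ordered monomials are linearly independent in the algebra of polynomials over the
operators. -/
theorem linearIndependent_shift : LinearIndependent K fun p : (Root n → ℕ) × Γ =>
    D.mono D.shiftGen p.1 * D.polyGrp p.2 := by
  choose T hT hT' using D.exists_isShift_hasTop_rv
  refine linearIndependent_of_hasTop (fun p : (Root n → ℕ) × Γ =>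
    (HasTop.list_prod (rootList n) fun α => (hT' α).pow (p.1 α)).mul (HasTop.C (D.shiftGrp p.2))) ?_
  refine IsShift.linearIndependent (fun p : (Root n → ℕ) × Γ =>
    (IsShift.list_prod (rootList n) fun α => (hT α).pow (p.1 α)).mul (isShift_shiftGrp p.2)) ?_
  rintro ⟨m, x⟩ ⟨m', x'⟩ h
  simp only [list_sum_rootList, add_zero, one_mul, Prod.mk.injEq] at h
  rw [rootExp_injective h.1, h.2]

end

end LinkingDatum

/-! ### Skew derivations of the unlinked algebra. -/

section SkewDerivation

variable {K R : Type*} [Field K] [Ring R] [Algebra K R] {A B x : R} {α β r s : K}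

/-- For skew derivations $A$, $B$ and a left multiplication $x$, the hypotheses on $r$ and $s$ say
that the inhomogeneous terms cancel. The skew commutator then passes $x$ up to a scalar, and is
determined by its value at $1$. `qSerre_mul` does the same for the Serre polynomial. -/
theorem skewCommutator_mul {c : K} (hA : A * x = α • (x * A) + r • 1)
    (hB : B * x = β • (x * B) + s • 1) (hr : r * (β - c) = 0) (hs : s * (1 - c * α) = 0) :
    (A * B - c • (B * A)) * x = (α * β) • (x * (A * B - c • (B * A))) := by
  have hA' : ∀ z, A * (x * z) = α • (x * (A * z)) + r • z := fun z => by
    rw [← mul_assoc, hA, add_mul, smul_mul_assoc, smul_mul_assoc, one_mul, mul_assoc]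
  have hB' : ∀ z, B * (x * z) = β • (x * (B * z)) + s • z := fun z => by
    rw [← mul_assoc, hB, add_mul, smul_mul_assoc, smul_mul_assoc, one_mul, mul_assoc]
  have h1 : (r * (β - c)) • B = 0 := by rw [hr, zero_smul]
  have h2 : (s * (1 - c * α)) • A = 0 := by rw [hs, zero_smul]
  simp only [sub_mul, smul_mul_assoc, mul_assoc, hA, hB, mul_add, mul_smul_comm, hA', hB', smul_add,
    smul_smul, mul_one, mul_sub]
  linear_combination (norm := module) h1 + h2

theorem qSerre_mul {q p : K} (hA : A * x = α • (x * A) + r • 1)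
    (hB : B * x = β • (x * B) + s • 1) (hr : r * (β * (1 + α) - (1 + q) * p) = 0)
    (hr' : r * (q * p ^ 2 * (1 + α) - (1 + q) * p * α * β) = 0) (hs : s * (1 - p * α) = 0) :
    qSerre q p A B * x = (α * α * β) • (x * qSerre q p A B) := by
  have hA' : ∀ z, A * (x * z) = α • (x * (A * z)) + r • z := fun z => by
    rw [← mul_assoc, hA, add_mul, smul_mul_assoc, smul_mul_assoc, one_mul, mul_assoc]
  have hB' : ∀ z, B * (x * z) = β • (x * (B * z)) + s • z := fun z => by
    rw [← mul_assoc, hB, add_mul, smul_mul_assoc, smul_mul_assoc, one_mul, mul_assoc]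
  have h1 : (r * (β * (1 + α) - (1 + q) * p)) • (A * B) = 0 := by rw [hr, zero_smul]
  have h2 : (r * (q * p ^ 2 * (1 + α) - (1 + q) * p * α * β)) • (B * A) = 0 := by
    rw [hr', zero_smul]
  have h3 : (s * (1 - p * α) * (1 - q * p * α)) • (A * A) = 0 := by rw [hs, zero_mul, zero_smul]
  simp only [qSerre, sub_mul, add_mul, smul_mul_assoc, mul_assoc, hA, hB, mul_add, mul_smul_comm,
    hA', hB', smul_add, smul_smul, mul_one, mul_sub, smul_sub]
  linear_combination (norm := module) h1 + h2 + h3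

end SkewDerivation

namespace LinkingDatum

section

variable {K Γ : Type*} [Field K] [CommGroup Γ] {t : ℕ} {n : Fin t → ℕ} (D : LinkingDatum K Γ n)
variable {R : Type*} [Ring R] [Algebra K R] {S : Type*} [Ring S] [Algebra K S]

/-- The linking datum with trivial linking parameters. -/
def unlinked : LinkingDatum K Γ n where
  g := D.g
  χ := D.χ
  lam _ _ := 0
  odd_order := D.odd_order
  three_lt_order := D.three_lt_order
  cartan_condition := D.cartan_condition
  lam_eq_zero_of_connected _ _ _ := rfl
  lam_eq_zero _ _ _ _ := rfl
  lam_symm _ _ := by simp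

variable {D}

theorem Rep.unlinked {y : Γ →* R} {a : DiagramVertex n → R}
    {ℓ : DiagramVertex n → DiagramVertex n → R} (h : D.Rep y a ℓ) : D.unlinked.Rep y a ℓ :=
  ⟨h.grp, h.comm, h.serre, h.link⟩

theorem Rep.of_unlinked {y : Γ →* R} {a : DiagramVertex n → R}
    {ℓ : DiagramVertex n → DiagramVertex n → R} (h : D.unlinked.Rep y a ℓ) : D.Rep y a ℓ :=
  ⟨h.grp, h.comm, h.serre, h.link⟩

theorem Rep.prod {y : Γ →* R} {a : DiagramVertex n → R}
    {ℓ : DiagramVertex n → DiagramVertex n → R} (h : D.Rep y a ℓ)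
    {y' : Γ →* S} {a' : DiagramVertex n → S}
    {ℓ' : DiagramVertex n → DiagramVertex n → S} (h' : D.Rep y' a' ℓ') :
    D.Rep (y.prod y') (fun i => (a i, a' i)) fun i j => (ℓ i j, ℓ' i j) where
  grp x i := Prod.ext (h.grp x i) (h'.grp x i)
  comm k l m hlm := Prod.ext (h.comm k l m hlm) (h'.comm k l m hlm)
  serre k l m hlm := Prod.ext (h.serre k l m hlm) (h'.serre k l m hlm)
  link i j hij := Prod.ext (h.link i j hij) (h'.link i j hij)

variable (D)

theorem br_mul_br_of_lam_ne_zero {i j : DiagramVertex n} (h : D.lam i j ≠ 0)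
    (l : DiagramVertex n) : D.br l i * D.br l j = 1 := by
  have hij : i.1 ≠ j.1 := fun e => h (D.lam_eq_zero_of_connected i j e)
  have h1 : D.χ i * D.χ j = 1 := by
    by_contra hne
    exact h (D.lam_eq_zero i j hij fun hh => hne hh.2)
  have := congrArg (fun f : Γ →* Kˣ => ((f (D.g l) : Kˣ) : K)) h1
  simpa [br] using this

/-- Diagonal matrices. -/
def diagHom : R × R →ₐ[K] Matrix (Fin 2) (Fin 2) R where
  toFun z := !![z.1, 0; 0, z.2]
  map_one' := by ext i j; fin_cases i <;> fin_cases j <;> simp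
  map_mul' z w := by simp
  map_zero' := by ext i j; fin_cases i <;> fin_cases j <;> simp
  map_add' z w := by simp
  commutes' c := by
    ext i j
    fin_cases i <;> fin_cases j <;> simp [Matrix.algebraMap_matrix_apply]

/-- The skew derivation `∂_j` of the unlinked algebra. -/
theorem exists_skewDerivation (j : DiagramVertex n) : ∃ d : Module.End K D.unlinked.U,
    d 1 = 0 ∧
    (∀ x u, d (D.unlinked.grp x * u) = ((D.χ j x : Kˣ) : K)⁻¹ • (D.unlinked.grp x * d u)) ∧
    ∀ i u, d (D.unlinked.a i * u) = (D.br i j)⁻¹ • (D.unlinked.a i * d u) + D.lam j i • u := by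
  set y := D.unlinked.grp
  set a := D.unlinked.a
  have h0 : D.Rep y a fun _ _ => 0 := (D.unlinked.rep_U.congr fun i j _ => zero_smul _ _).of_unlinked
  set y₁ : Γ →* D.unlinked.U :=
    { toFun := fun x => ((D.χ j x : Kˣ) : K)⁻¹ • y x
      map_one' := by simp
      map_mul' := fun x z => by simp [mul_comm, smul_smul] } with hy₁
  have h1 : D.Rep y₁ (fun i => (D.br i j)⁻¹ • a i) fun _ _ => 0 := by
    have := h0.twist (AlgHom.id K D.unlinked.U) (fun i => algebraMap K _ (D.br i j)⁻¹)
      (fun x => algebraMap K _ ((D.χ j x : Kˣ) : K)⁻¹) y₁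
      (fun x => by rw [← Algebra.commutes, ← Algebra.smul_def]; rfl)
      (fun i r => Algebra.commutes _ _) (fun x r => Algebra.commutes _ _)
      (fun i r => Algebra.commutes _ _) (fun x r => Algebra.commutes _ _)
    simpa [← Algebra.smul_def] using this
  have hQ := (h1.prod h0).map (diagHom (K := K))
  set Y := ((diagHom (K := K) (R := D.unlinked.U) : D.unlinked.U × D.unlinked.U →*
    Matrix (Fin 2) (Fin 2) D.unlinked.U)).comp (y₁.prod y) with hY
  set Q : DiagramVertex n → Matrix (Fin 2) (Fin 2) D.unlinked.U :=
    fun i => diagHom (K := K) ((D.br i j)⁻¹ • a i, a i) with hQdef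
  -- A skew derivation is the off-diagonal entry of a homomorphism to upper triangular matrices with
  -- diagonal $(\text{twist of }u,\,u)$. `Rep.add` adds the off-diagonal part $P$ to the diagonal
  -- part $Q$; the required commutations follow from $\chi_j\chi_i=1$ whenever $\lambda_{ji}\ne0$.
  set P : DiagramVertex n → Matrix (Fin 2) (Fin 2) D.unlinked.U :=
    fun i => !![0, D.lam j i • 1; 0, 0] with hPdef
  have hPP : ∀ i i', P i * P i' = 0 := fun i i' => by
    ext r s
    fin_cases r <;> fin_cases s <;> simp [hPdef]
  have hP : D.Rep Y P fun _ _ => 0 := by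
    refine ⟨fun x i => ?_, fun k l m _ => ?_, fun k l m _ => ?_, fun i i' _ => ?_⟩
    · have e : D.lam j i * ((D.χ j x : Kˣ) : K)⁻¹ = ((D.χ i x : Kˣ) : K) * D.lam j i := by
        by_cases hji : D.lam j i = 0
        · simp [hji]
        · have hne : j.1 ≠ i.1 := fun e => hji (D.lam_eq_zero_of_connected j i e)
          have h1 : D.χ j * D.χ i = 1 := by
            by_contra hne'
            exact hji (D.lam_eq_zero j i hne fun hh => hne' hh.2)
          have := congrArg (fun f : Γ →* Kˣ => ((f x : Kˣ) : K)) h1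
          simp only [MonoidHom.mul_apply, Units.val_mul, MonoidHom.one_apply, Units.val_one] at this
          rw [eq_inv_of_mul_eq_one_right this, mul_comm]
      ext r s
      fin_cases r <;> fin_cases s <;>
        simp [hPdef, hY, diagHom, hy₁, smul_smul, e, Matrix.mul_apply, Fin.sum_univ_two]
    · rw [QComm, hPP, hPP, smul_zero]
    · simp [qSerre, hPP]
    · simp [hPP]
  have hQP : ∀ i i', QComm (D.br i' i) (Q i') (P i) := fun i i' => by
    have e : D.lam j i * (D.br i' j)⁻¹ = D.br i' i * D.lam j i := by
      by_cases hji : D.lam j i = 0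
      · simp [hji]
      · rw [eq_inv_of_mul_eq_one_right (D.br_mul_br_of_lam_ne_zero hji i'), mul_comm]
    ext r s
    fin_cases r <;> fin_cases s <;>
      simp [hPdef, hQdef, diagHom, smul_smul, e, Matrix.mul_apply, Fin.sum_univ_two]
  have hPQ : D.unlinked.Rep Y (fun i => P i + Q i)
      (fun i i' => D.unlinked.lam i i' • (1 - Y (D.unlinked.g i * D.unlinked.g i'))) :=
    ((hP.add hQ hQP).congr fun i i' _ => by
      change 0 + diagHom (0, 0) = (0 : K) • _
      rw [zero_smul, zero_add]
      exact map_zero _).unlinked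
  set Φ := hPQ.lift with hΦ
  have hy : ∀ x, Φ (y x) = Y x := hPQ.lift_grp
  have ha : ∀ i, Φ (a i) = P i + Q i := hPQ.lift_a
  have hΦ1 : ∀ u, Φ u 1 0 = 0 ∧ Φ u 1 1 = u := fun u => by
    induction u using D.unlinked.U_induction with
    | hgrp x => 
      change Φ (y x) 1 0 = 0 ∧ Φ (y x) 1 1 = y x
      rw [hy]; simp [hY, diagHom]
    | ha i => 
      change Φ (a i) 1 0 = 0 ∧ Φ (a i) 1 1 = a i
      rw [ha]; simp [hPdef, hQdef, diagHom]
    | halg c => simp [Matrix.algebraMap_matrix_apply]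
    | hadd u v hu hv => simp [hu.1, hu.2, hv.1, hv.2]
    | hmul u v hu hv => simp [Matrix.mul_apply, Fin.sum_univ_two, hu.1, hu.2, hv.1, hv.2]
  refine ⟨{ toFun := fun u => Φ u 0 1, map_add' := by simp, map_smul' := by simp }, ?_, ?_, ?_⟩
  · simp
  · intro x u
    change Φ (y x * u) 0 1 = _ • (y x * Φ u 0 1)
    rw [map_mul, hy]
    simp [Matrix.mul_apply, Fin.sum_univ_two, hY, diagHom, hy₁]
  · intro i u
    change Φ (a i * u) 0 1 = _ • (a i * Φ u 0 1) + _
    rw [map_mul, ha]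
    simp [Matrix.mul_apply, Fin.sum_univ_two, hPdef, hQdef, diagHom, hΦ1]

end

end LinkingDatum

/-! ### The Fock representation with constant linking relations. -/

namespace LinkingDatum

section

variable {K Γ : Type*} [Field K] [CommGroup Γ] {t : ℕ} {n : Fin t → ℕ} {D : LinkingDatum K Γ n}
variable {W : Type*} [Ring W] [Algebra K W]

open Classical in
/-- Elements of a set of components act by multiplication, those of the other components by skew
derivations. -/
theorem rep_fock {y : Γ →* W} {a : DiagramVertex n → W} (h : D.Rep y a fun _ _ => 0)
    (hind : ∀ T : Module.End K W, T 1 = 0 →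
      (∀ x, ∃ c : K, T * Algebra.lmul K W (y x) = c • (Algebra.lmul K W (y x) * T)) →
      (∀ i, ∃ c : K, T * Algebra.lmul K W (a i) = c • (Algebra.lmul K W (a i) * T)) → T = 0)
    (d : DiagramVertex n → Module.End K W) (hd1 : ∀ j, d j 1 = 0)
    (hdy : ∀ j x u, d j (y x * u) = ((D.χ j x : Kˣ) : K)⁻¹ • (y x * d j u))
    (hda : ∀ j i u, d j (a i * u) = (D.br i j)⁻¹ • (a i * d j u) + D.lam j i • u)
    (pos : Fin t → Prop) (hpos : ∀ i j, D.lam i j ≠ 0 → (pos i.1 ↔ ¬ pos j.1)) :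
    D.Rep ((Algebra.lmul K W : W →* Module.End K W).comp y)
      (fun i => if pos i.1 then Algebra.lmul K W (a i) else d i) fun i j => D.lam i j • 1 := by
  have hy : ∀ j x, d j * Algebra.lmul K W (y x) =
      ((D.χ j x : Kˣ) : K)⁻¹ • (Algebra.lmul K W (y x) * d j) + (0 : K) • 1 := fun j x => by
    rw [zero_smul, add_zero]
    exact LinearMap.ext fun u => hdy j x u
  have ha : ∀ j i, d j * Algebra.lmul K W (a i) =
      (D.br i j)⁻¹ • (Algebra.lmul K W (a i) * d j) + D.lam j i • 1 := fun j i =>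
    LinearMap.ext fun u => hda j i u
  have hlam : ∀ i j, D.lam i j ≠ 0 → i.1 ≠ j.1 := fun i j hij e =>
    hij (D.lam_eq_zero_of_connected i j e)
  -- The skew commutator kills $1$ and passes multiplications by generators up to scalars, so it
  -- vanishes by `hind`.
  have hcomm : ∀ l m, (∀ i, D.lam l i ≠ 0 → i.1 ≠ m.1) → (∀ i, D.lam m i ≠ 0 → i.1 ≠ l.1) →
      D.br l m * D.br m l = 1 → QComm (D.br l m) (d l) (d m) := fun l m hl hm hlm => by
    refine sub_eq_zero.mp (hind _ ?_ (fun x => ⟨_, skewCommutator_mul (hy l x) (hy m x) (zero_mul _)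
      (zero_mul _)⟩) fun i => ⟨_, skewCommutator_mul (ha l i) (ha m i) ?_ ?_⟩)
    · simp [hd1]
    · by_cases hli : D.lam l i = 0
      · rw [hli, zero_mul]
      · have h1 := D.br_mul_br_of_ne (hl i hli)
        have h2 := D.br_mul_br_of_lam_ne_zero hli m
        rw [inv_eq_of_mul_eq_one_right h1, eq_inv_of_mul_eq_one_right h2,
          eq_inv_of_mul_eq_one_left hlm, sub_self, mul_zero]
    · by_cases hmi : D.lam m i = 0
      · rw [hmi, zero_mul]
      · have h1 := D.br_mul_br_of_ne (hm i hmi)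
        have h2 := D.br_mul_br_of_lam_ne_zero hmi l
        rw [inv_eq_of_mul_eq_one_right h1, h2, sub_self, mul_zero]
  refine ⟨fun x i => ?_, fun k l m hlm => ?_, fun k l m hlm => ?_, fun i j hij => ?_⟩
  · split_ifs with hi
    · exact (h.grp x i).map (Algebra.lmul K W)
    · have e := hy i x
      rw [zero_smul, add_zero] at e
      change Algebra.lmul K W (y x) * d i = _ • (d i * Algebra.lmul K W (y x))
      rw [e, smul_inv_smul₀ (Units.ne_zero _)]
  · dsimp only
    split_ifs with hk
    · exact (h.comm k l m hlm).map (Algebra.lmul K W)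
    · exact hcomm _ _ (fun i hi => (hlam _ _ hi).symm) (fun i hi => (hlam _ _ hi).symm)
        (D.br_far hlm)
  · dsimp only
    split_ifs with hk
    · have := congrArg (Algebra.lmul K W) (h.serre k l m hlm)
      simpa only [qSerre, map_sub, map_add, map_smul, map_mul, map_zero] using this
    · have e := D.br_adj hlm.symm
      have hq := D.br_ne_zero ⟨k, l⟩ ⟨k, l⟩
      have hp := D.br_ne_zero ⟨k, l⟩ ⟨k, m⟩
      have e' : (D.br ⟨k, m⟩ ⟨k, l⟩)⁻¹ = D.br ⟨k, l⟩ ⟨k, l⟩ * D.br ⟨k, l⟩ ⟨k, m⟩ := by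
        have hp' := D.br_ne_zero ⟨k, m⟩ ⟨k, l⟩
        field_simp at e ⊢
        linear_combination -e
      refine hind _ ?_ (fun x => ⟨_, qSerre_mul (hy _ x) (hy _ x) (zero_mul _)
        (zero_mul _) (zero_mul _)⟩) fun i => ⟨_, qSerre_mul (ha _ i) (ha _ i) ?_ ?_ ?_⟩
      · simp [qSerre, hd1]
      · by_cases hli : D.lam ⟨k, l⟩ i = 0
        · rw [hli, zero_mul]
        · have hne := (hlam _ _ hli).symm
          have h1 := inv_eq_of_mul_eq_one_right (D.br_mul_br_of_ne (j := ⟨k, l⟩) hne)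
          have h2 := inv_eq_of_mul_eq_one_right (D.br_mul_br_of_ne (j := ⟨k, m⟩) hne)
          have h3 := eq_inv_of_mul_eq_one_right (D.br_mul_br_of_lam_ne_zero hli ⟨k, l⟩)
          have h4 := eq_inv_of_mul_eq_one_right (D.br_mul_br_of_lam_ne_zero hli ⟨k, m⟩)
          rw [h1, h2, h3, h4, e']
          field_simp
          ring
      · by_cases hli : D.lam ⟨k, l⟩ i = 0
        · rw [hli, zero_mul]
        · have hne := (hlam _ _ hli).symm
          have h1 := inv_eq_of_mul_eq_one_right (D.br_mul_br_of_ne (j := ⟨k, l⟩) hne)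
          have h2 := inv_eq_of_mul_eq_one_right (D.br_mul_br_of_ne (j := ⟨k, m⟩) hne)
          have h3 := eq_inv_of_mul_eq_one_right (D.br_mul_br_of_lam_ne_zero hli ⟨k, l⟩)
          have h4 := eq_inv_of_mul_eq_one_right (D.br_mul_br_of_lam_ne_zero hli ⟨k, m⟩)
          rw [h1, h2, h3, h4, e']
          field_simp
          ring
      · by_cases hmi : D.lam ⟨k, m⟩ i = 0
        · rw [hmi, zero_mul]
        · have hne := (hlam _ _ hmi).symm
          have h1 := inv_eq_of_mul_eq_one_right (D.br_mul_br_of_ne (j := ⟨k, l⟩) hne)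
          have h2 := D.br_mul_br_of_lam_ne_zero hmi ⟨k, l⟩
          rw [h1, h2, sub_self, mul_zero]
  · have hbr := D.br_mul_br_of_ne hij
    have h0 := congrArg (Algebra.lmul K W) (h.link i j hij)
    split_ifs with hi hj hj
    · have hl : D.lam i j = 0 := by
        by_contra hne
        exact (hpos i j hne).mp hi hj
      rw [hl, zero_smul]
      simpa only [map_sub, map_smul, map_mul, map_zero] using h0
    · rw [ha, smul_add, smul_smul, smul_smul, mul_inv_cancel₀ (D.br_ne_zero i j), one_smul,
        sub_add_cancel_left, ← neg_smul, ← neg_mul]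
      congr 1
      exact (D.lam_symm i j).symm
    · rw [ha, inv_eq_of_mul_eq_one_left hbr]
      abel
    · have hl : D.lam i j = 0 := by
        by_contra hne
        exact hi ((hpos i j hne).mpr hj)
      rw [hl, zero_smul, sub_eq_zero]
      -- Both $i$ and $j$ act by derivations, and every vertex linked to one of them lies in a
      -- component acting by multiplication, hence not in the component of the other.
      refine hcomm i j (fun r hr e => ?_) (fun r hr e => ?_) hbr
      · have h1 := hpos i r hr
        rw [e] at h1
        tauto
      · have h1 := hpos j r hr
        rw [e] at h1
        tauto

variable (D)

variable [∀ k, NeZero (n k)]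

/-- Evaluating $\chi_i\chi_j=1$ at $g_i$ and $g_j$ and multiplying gives
$q_iq_j\cdot\chi_j(g_i)\chi_i(g_j)=1$; the braiding of different components is symmetric. -/
theorem q_mul_q_of_lam_ne_zero {i j : DiagramVertex n} (h : D.lam i j ≠ 0) :
    D.q i.1 * D.q j.1 = 1 := by
  have hij : i.1 ≠ j.1 := fun e => h (D.lam_eq_zero_of_connected i j e)
  have h1 := D.br_mul_br_of_lam_ne_zero h i
  have h2 := D.br_mul_br_of_lam_ne_zero h j
  have h3 := D.br_mul_br_of_ne hij
  have e1 : D.br i i = D.q i.1 := D.br_self i.1 i.2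
  have e2 : D.br j j = D.q j.1 := D.br_self j.1 j.2
  rw [e1] at h1
  rw [e2] at h2
  ext
  push_cast
  calc (D.q i.1 : K) * D.q j.1 = D.q i.1 * D.q j.1 * (D.br i j * D.br j i) := by rw [h3, mul_one]
    _ = (D.q i.1 * D.br i j) * (D.br j i * D.q j.1) := by ring
    _ = 1 := by rw [h1, h2, mul_one]

/-- Linked components can be separated. -/
theorem exists_polarization : ∃ pos : Fin t → Prop,
    ∀ i j : DiagramVertex n, D.lam i j ≠ 0 → (pos i.1 ↔ ¬ pos j.1) := by
  -- Linked components have inverse parameters, distinct since $q^2\ne1$. A component counts as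
  -- positive if its $q$ precedes $q^{-1}$ in a fixed well-ordering.
  refine ⟨fun k => WellOrderingRel (D.q k) (D.q k)⁻¹, fun i j hij => ?_⟩
  have e := D.q_mul_q_of_lam_ne_zero hij
  have e1 : (D.q i.1)⁻¹ = D.q j.1 := inv_eq_of_mul_eq_one_right e
  have e2 : (D.q j.1)⁻¹ = D.q i.1 := inv_eq_of_mul_eq_one_left e
  have hne : D.q i.1 ≠ D.q j.1 := fun h => D.q_mul_q_ne_one i.1 (by
    rw [← h] at e
    rw [← Units.val_mul, e, Units.val_one])
  dsimp only
  rw [e1, e2]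
  rcases trichotomous_of WellOrderingRel (D.q i.1) (D.q j.1) with h | h | h
  · exact ⟨fun _ h' => asymm_of WellOrderingRel h h', fun _ => h⟩
  · exact absurd h hne
  · exact ⟨fun h' => absurd h (asymm_of WellOrderingRel h'), fun h' => absurd h h'⟩

/-- The linking relations with constant right hand side can be realized. -/
theorem exists_rep_const : ∃ (yE : Γ →* Module.End K D.unlinked.U)
    (aE : DiagramVertex n → Module.End K D.unlinked.U),
    D.Rep yE aE fun i j => D.lam i j • 1 := by
  obtain ⟨pos, hpos⟩ := D.exists_polarization
  choose d hd1 hdy hda using D.exists_skewDerivation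
  have h0 : D.Rep D.unlinked.grp D.unlinked.a fun _ _ => 0 :=
    (D.unlinked.rep_U.congr fun i j _ => zero_smul _ _).of_unlinked
  refine ⟨_, _, rep_fock h0 (fun T h1 hTy hTa => ?_) d hd1 hdy hda pos hpos⟩
  have key : ∀ u v, T v = 0 → T (u * v) = 0 := fun u => by
    induction u using D.unlinked.U_induction with
    | hgrp x =>
      intro v hv
      obtain ⟨c, hc⟩ := hTy x
      have := LinearMap.congr_fun hc v
      simpa [hv] using this
    | ha i =>
      intro v hv
      obtain ⟨c, hc⟩ := hTa i
      have := LinearMap.congr_fun hc v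
      simpa [hv] using this
    | halg c =>
      intro v hv
      rw [← Algebra.smul_def, map_smul, hv, smul_zero]
    | hadd u w hu hw =>
      intro v hv
      rw [add_mul, map_add, hu v hv, hw v hv, add_zero]
    | hmul u w hu hw =>
      intro v hv
      rw [mul_assoc]
      exact hu _ (hw v hv)
  refine LinearMap.ext fun u => ?_
  simpa using key u 1 h1

end

end LinkingDatum

/-- The outer factors may vary with the index: the $i$-th coordinate functional in the middle
isolates the $i$-th term, and functionals nonzero at $x_i$ and $z_i$ detect its coefficient. -/
theorem LinearIndependent.tmul_tmul_of_ne_zero {K ι V V₁ V₂ : Type*} [Field K] [AddCommGroup V]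
    [Module K V] [AddCommGroup V₁] [Module K V₁] [AddCommGroup V₂] [Module K V₂] {u : ι → V}
    (hu : LinearIndependent K u) {x : ι → V₁} {z : ι → V₂} (hx : ∀ i, x i ≠ 0)
    (hz : ∀ i, z i ≠ 0) : LinearIndependent K fun i => x i ⊗ₜ[K] (u i ⊗ₜ[K] z i) := by
  classical
  obtain ⟨g, hg⟩ := LinearMap.exists_leftInverse_of_injective (Finsupp.linearCombination K u)
    (LinearMap.ker_eq_bot.mpr hu)
  rw [linearIndependent_iff']
  intro s c hc i hi
  obtain ⟨φ, hφ⟩ : ∃ φ : Module.Dual K V₁, φ (x i) ≠ 0 := by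
    by_contra! h
    exact hx i ((Module.forall_dual_apply_eq_zero_iff K _).mp h)
  obtain ⟨ψ, hψ⟩ : ∃ ψ : Module.Dual K V₂, ψ (z i) ≠ 0 := by
    by_contra! h
    exact hz i ((Module.forall_dual_apply_eq_zero_iff K _).mp h)
  have hgu : ∀ j, g (u j) i = if i = j then 1 else 0 := fun j => by
    have := LinearMap.congr_fun hg (Finsupp.single j 1)
    rw [LinearMap.comp_apply, Finsupp.linearCombination_single, one_smul, LinearMap.id_apply] at this
    rw [this, Finsupp.single_apply]
    exact if_congr eq_comm rfl rfl
  have e := congrArg (LinearMap.mul' K K ∘ₗ TensorProduct.map φ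
    (LinearMap.mul' K K ∘ₗ TensorProduct.map (Finsupp.lapply i ∘ₗ g) ψ)) hc
  simp only [map_sum, map_smul, map_zero, LinearMap.comp_apply, TensorProduct.map_tmul,
    LinearMap.mul'_apply, Finsupp.lapply_apply, hgu, ite_mul, one_mul, zero_mul, mul_ite, mul_zero,
    smul_ite, smul_zero, sum_ite_eq, hi, if_true] at e
  exact (smul_eq_zero.mp e).resolve_right (mul_ne_zero hφ hψ)

/-! ### From the unlinked to the linked algebra. -/

namespace LinkingDatum

section

variable {K Γ : Type*} [Field K] [CommGroup Γ] {t : ℕ} {n : Fin t → ℕ} {D : LinkingDatum K Γ n}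
variable {E R₀ : Type*} [Ring E] [Algebra K E] [Ring R₀] [Algebra K R₀]

open Polynomial

theorem map_grp_ne_zero [Nontrivial E] (y : Γ →* E) (x : Γ) : y x ≠ 0 := fun h => by
  have : y x * y x⁻¹ = 1 := by rw [← map_mul, mul_inv_cancel, map_one]
  rw [h, zero_mul] at this
  exact zero_ne_one this

/-- Given three realizations of the relations in `T` whose sum satisfies the relations of `𝔘(𝓓)`,
the middle one being unlinked, one can scale the latter by a variable. -/
theorem Rep.add_X_mul_add {T : Type*} [Ring T] [Algebra K T] {y : Γ →* T}
    {P₁ P₂ P₃ : DiagramVertex n → T} {ℓ₁ ℓ₃ : DiagramVertex n → DiagramVertex n → T}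
    (h₁ : D.Rep y P₁ ℓ₁) (h₂ : D.Rep y P₂ fun _ _ => 0) (h₃ : D.Rep y P₃ ℓ₃)
    (q₁₂ : ∀ i j, QComm (D.br j i) (P₂ j) (P₁ i)) (q₁₃ : ∀ i j, QComm (D.br j i) (P₃ j) (P₁ i))
    (q₂₃ : ∀ i j, QComm (D.br j i) (P₃ j) (P₂ i))
    (hℓ : ∀ i j, ℓ₁ i j + ℓ₃ i j = D.lam i j • (1 - y (D.g i * D.g j))) :
    D.Rep (((CAlgHom : T →ₐ[K] T[X]) : T →* T[X]).comp y)
      (fun i => CAlgHom (R := K) (P₁ i) + X * CAlgHom (R := K) (P₂ i) + CAlgHom (R := K) (P₃ i))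
      fun i j => D.lam i j •
        (1 - (((CAlgHom : T →ₐ[K] T[X]) : T →* T[X]).comp y) (D.g i * D.g j)) := by
  have h1 := h₁.map (CAlgHom : T →ₐ[K] T[X])
  have h2 := h₂.twist (CAlgHom : T →ₐ[K] T[X]) (fun _ => X) (fun _ => 1)
    (((CAlgHom : T →ₐ[K] T[X]) : T →* T[X]).comp y)
    (fun x => (mul_one _).symm) (fun _ r => commute_X _) (fun _ _ => Commute.one_left _)
    (fun _ _ => Commute.refl _) (fun _ _ => Commute.one_left _)
  have h3 := h₃.map (CAlgHom : T →ₐ[K] T[X])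
  have hX : ∀ r : T, QComm (1 : K) X (CAlgHom (R := K) r) := fun r => by
    rw [QComm, one_smul]
    exact (commute_X _).eq
  have hX' : ∀ r : T, QComm (1 : K) (CAlgHom (R := K) r) X := fun r => by
    rw [QComm, one_smul]
    exact (commute_X _).eq.symm
  refine ((h1.add h2 fun i j => ?_).add h3 fun i j => ?_).congr fun i j _ => ?_
  · refine ((hX _).mul_left ((q₁₂ i j).map CAlgHom)).of_eq (one_mul _)
  · have e₁ : _ * _ = _ := (q₁₃ i j).map (CAlgHom : T →ₐ[K] T[X])
    have e₂ : _ * _ = _ :=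
      (((hX' (P₃ j)).mul_right ((q₂₃ i j).map (CAlgHom : T →ₐ[K] T[X]))).of_eq (one_mul _))
    rw [QComm, mul_add, e₁, e₂, add_mul, smul_add]
  · rw [map_zero, mul_zero, add_zero, ← map_add, hℓ, map_smul, map_sub, map_one]
    rfl

variable [∀ k, NeZero (n k)]

/-- With the middle summand scaled by $X$, the leading coefficient in $X$ of each monomial is the
same monomial in $P_2$. -/
theorem linearIndependent_mono_of_add {T : Type*} [Ring T] [Algebra K T] {y : Γ →* T}
    {P₁ P₂ P₃ : DiagramVertex n → T} {ℓ₁ ℓ₃ : DiagramVertex n → DiagramVertex n → T}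
    (h₁ : D.Rep y P₁ ℓ₁) (h₂ : D.Rep y P₂ fun _ _ => 0) (h₃ : D.Rep y P₃ ℓ₃)
    (q₁₂ : ∀ i j, QComm (D.br j i) (P₂ j) (P₁ i)) (q₁₃ : ∀ i j, QComm (D.br j i) (P₃ j) (P₁ i))
    (q₂₃ : ∀ i j, QComm (D.br j i) (P₃ j) (P₂ i))
    (hℓ : ∀ i j, ℓ₁ i j + ℓ₃ i j = D.lam i j • (1 - y (D.g i * D.g j)))
    (hind : LinearIndependent K fun p : (Root n → ℕ) × Γ => D.mono P₂ p.1 * y p.2) :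
    LinearIndependent K fun p : (Root n → ℕ) × Γ => D.mono D.a p.1 * D.grp p.2 := by
  have H := Rep.add_X_mul_add h₁ h₂ h₃ q₁₂ q₁₃ q₂₃ hℓ
  set a' : DiagramVertex n → T[X] := fun i =>
    CAlgHom (R := K) (P₁ i) + X * CAlgHom (R := K) (P₂ i) + CAlgHom (R := K) (P₃ i) with ha'
  have htop : ∀ i, HasTop 1 (P₂ i) (a' i) := fun i => by
    constructor
    · refine natDegree_add_le_of_degree_le (natDegree_add_le_of_degree_le ?_ ?_) ?_
      · exact (natDegree_C _).le.trans zero_le_one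
      · exact natDegree_mul_le_of_le natDegree_X_le (natDegree_C _).le
      · exact (natDegree_C _).le.trans zero_le_one
    · rw [ha', coeff_add, coeff_add, show (1 : ℕ) = 0 + 1 from rfl, coeff_X_mul]
      simp [CAlgHom_apply, coeff_C_succ]
  have hrv : ∀ α : Root n, HasTop (α.2.1.2.val - α.2.1.1.val) (D.rv P₂ α) (D.rv a' α) := fun α => by
    have := HasTop.rootVec (p := D.braid α.1) (show α.2.1.1.val < α.2.1.2.val from α.2.2)
      (d := 1) (x := seq α.1 P₂) (f := seq α.1 a') fun l _ hl => by
        have hl' : l < n α.1 := by have := α.2.1.2.isLt; omega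
        rw [seq_of_lt _ hl', seq_of_lt _ hl']
        exact htop _
    rwa [mul_one] at this
  have key : LinearIndependent K fun p : (Root n → ℕ) × Γ =>
      D.mono a' p.1 * CAlgHom (R := K) (y p.2) :=
    linearIndependent_of_hasTop (fun p : (Root n → ℕ) × Γ =>
      (HasTop.list_prod (rootList n) fun α => (hrv α).pow (p.1 α)).mul (HasTop.C (y p.2))) hind
  have e : (H.lift.toLinearMap ∘ fun p : (Root n → ℕ) × Γ => D.mono D.a p.1 * D.grp p.2) =
      fun p => D.mono a' p.1 * CAlgHom (R := K) (y p.2) := by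
    funext p
    simp only [Function.comp_apply, AlgHom.toLinearMap_apply, map_mul, Rep.lift_grp]
    rw [mono, mono, map_list_prod, List.map_map]
    refine congrArg₂ _ (congrArg _ (List.map_congr_left fun α _ => ?_)) rfl
    simp only [Function.comp_apply, map_pow, map_rv, Rep.lift_a]
  exact LinearIndependent.of_comp H.lift.toLinearMap (e ▸ key)

/-- The ordered monomials are linearly independent in `𝔘(𝓓)` if they are so in an algebra where
the generators satisfy the unlinked relations, and the linking relations with constant right hand
sides can be realized. -/
theorem linearIndependent_mono_of_rep [Nontrivial E] {yE : Γ →* E} {aE : DiagramVertex n → E}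
    (hE : D.Rep yE aE fun i j => D.lam i j • 1) {y₀ : Γ →* R₀} {a₀ : DiagramVertex n → R₀}
    (h₀ : D.Rep y₀ a₀ fun _ _ => 0)
    (hind : LinearIndependent K fun p : (Root n → ℕ) × Γ => D.mono a₀ p.1 * y₀ p.2) :
    LinearIndependent K fun p : (Root n → ℕ) × Γ => D.mono D.a p.1 * D.grp p.2 := by
  have hop := hE.anti (antiGrp yE) fun _ => rfl
  set y' := antiGrp yE with hy'
  set c : DiagramVertex n → Eᵐᵒᵖ := fun i => -MulOpposite.op (yE (D.g i)⁻¹ * aE i) with hc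
  set Y := tensorGrp (K := K) yE (tensorGrp (K := K) y₀ y') with hY
  have h₂ : D.Rep Y (fun i => yE (D.g i) ⊗ₜ[K] (a₀ i ⊗ₜ[K] (1 : Eᵐᵒᵖ))) fun _ _ => 0 :=
    ((h₀.tensor_left y').tensor_right yE).congr fun i j _ => by
      rw [TensorProduct.zero_tmul, TensorProduct.tmul_zero]
  -- The three summands are $a_i\otimes1\otimes1$, $g_i\otimes a_i\otimes1$ and $g_i\otimes
  -- g_i\otimes S(a_i)$. The outer ones contribute $\lambda_{ij}$ and $-\lambda_{ij}\,g\otimes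
  -- g\otimes g^{-1}$ with $g=g_ig_j$. Since $\Gamma$ acts through inverses in $E^{op}$, these add
  -- up to the linking relation of $\mathfrak U(\mathcal D)$.
  refine linearIndependent_mono_of_add (hE.tensor_left (tensorGrp (K := K) y₀ y')) h₂
    ((hop.tensor_right y₀).tensor_right yE)
    (hE.tensor_qcomm _) (hE.tensor_qcomm _) (fun i j => by
      have e := h₀.tensor_qcomm c i j
      unfold QComm at e ⊢
      rw [Algebra.TensorProduct.tmul_mul_tmul, e, Algebra.TensorProduct.tmul_mul_tmul (yE (D.g i)),
        ← map_mul, ← map_mul, mul_comm (D.g j), TensorProduct.tmul_smul]) (fun i j => by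
      change _ = D.lam i j • (1 - yE (D.g i * D.g j) ⊗ₜ[K]
        (y₀ (D.g i * D.g j) ⊗ₜ[K] MulOpposite.op (yE (D.g i * D.g j)⁻¹)))
      rw [mul_smul_comm, mul_one, MulOpposite.op_smul, ← smul_neg, TensorProduct.tmul_smul,
        TensorProduct.tmul_smul, ← TensorProduct.smul_tmul', ← smul_add, TensorProduct.tmul_neg,
        TensorProduct.tmul_neg, ← sub_eq_add_neg]
      rfl) ?_
  set b : DiagramVertex n → E ⊗[K] (R₀ ⊗[K] Eᵐᵒᵖ) :=
    fun i => yE (D.g i) ⊗ₜ[K] (a₀ i ⊗ₜ[K] (1 : Eᵐᵒᵖ)) with hb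
  have hbrv : ∀ α : Root n, D.rv b α = yE (D.rg α) ⊗ₜ[K] (D.rv a₀ α ⊗ₜ[K] (1 : Eᵐᵒᵖ)) := fun α => by
    have e1 := D.rootVec_tmul yE (fun i => a₀ i ⊗ₜ[K] (1 : Eᵐᵒᵖ)) α.1 α.2.2
    have e2 := D.map_rv (Algebra.TensorProduct.includeLeft : R₀ →ₐ[K] R₀ ⊗[K] Eᵐᵒᵖ) a₀ α
    refine e1.trans ?_
    congr 1
    exact e2.symm
  have hmono : ∀ (m : Root n → ℕ), ∃ w : Γ, D.mono b m =
      yE w ⊗ₜ[K] (D.mono a₀ m ⊗ₜ[K] (1 : Eᵐᵒᵖ)) := fun m => by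
    rw [mono, mono]
    induction rootList n with
    | nil => exact ⟨1, by simp [Algebra.TensorProduct.one_def]⟩
    | cons α l ih =>
      obtain ⟨w, hw⟩ := ih
      refine ⟨D.rg α ^ m α * w, ?_⟩
      simp only [List.map_cons, List.prod_cons]
      rw [hw, hbrv, Algebra.TensorProduct.tmul_pow, Algebra.TensorProduct.tmul_pow,
        Algebra.TensorProduct.tmul_mul_tmul, Algebra.TensorProduct.tmul_mul_tmul, one_pow, one_mul,
        map_mul, map_pow]
  choose w hw using hmono
  have e : (fun p : (Root n → ℕ) × Γ => D.mono b p.1 * Y p.2) = fun p =>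
      yE (w p.1 * p.2) ⊗ₜ[K] ((D.mono a₀ p.1 * y₀ p.2) ⊗ₜ[K] y' p.2) := by
    funext p
    change D.mono b p.1 * (yE p.2 ⊗ₜ[K] (y₀ p.2 ⊗ₜ[K] y' p.2)) = _
    rw [hw, Algebra.TensorProduct.tmul_mul_tmul, Algebra.TensorProduct.tmul_mul_tmul, one_mul,
      map_mul]
  refine e ▸ ?_
  exact hind.tmul_tmul_of_ne_zero (fun p => map_grp_ne_zero _ _) fun p => map_grp_ne_zero _ _

variable (D)

/-- The ordered monomials in the root vectors, times the group elements, are linearly independent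
in `𝔘(𝓓)`. -/
theorem linearIndependent_mono :
    LinearIndependent K fun p : (Root n → ℕ) × Γ => D.mono D.a p.1 * D.grp p.2 := by
  obtain ⟨yE, aE, hE⟩ := D.exists_rep_const
  have : Nontrivial D.unlinked.U := D.unlinked.counitU.toRingHom.domain_nontrivial
  exact linearIndependent_mono_of_rep hE D.rep_shiftGen D.linearIndependent_shift

end

end LinkingDatum

/-! ### The root vector relations and the dimension of the quotient. -/

theorem RingQuot.map_eq_zero_of_mkAlgHom_eq_zero {K A M : Type*} [CommRing K] [Ring A] [Algebra K A]
    [AddCommGroup M] [Module K M] {r : A → A → Prop} (f : A →ₗ[K] M)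
    (hf : ∀ x y, r x y → ∀ b c, f (b * (x - y) * c) = 0) {x : A}
    (hx : RingQuot.mkAlgHom K r x = 0) : f x = 0 := by
  let I : Ideal A :=
    { carrier := {x | ∀ b c, f (b * x * c) = 0}
      add_mem' := fun {x y} hx hy b c => by rw [mul_add, add_mul, map_add, hx, hy, add_zero]
      zero_mem' := fun b c => by rw [mul_zero, zero_mul, map_zero]
      smul_mem' := fun a x hx b c => by rw [smul_eq_mul, ← mul_assoc b, hx] }
  have : I.IsTwoSided := ⟨fun {x} a hx b c => by
    rw [← mul_assoc, mul_assoc _ a, hx]⟩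
  have hI : ∀ ⦃x y : A⦄, r x y → Ideal.Quotient.mkₐ K I x = Ideal.Quotient.mkₐ K I y :=
    fun x y hxy => Ideal.Quotient.eq.mpr (hf x y hxy)
  have e := RingQuot.liftAlgHom_mkAlgHom_apply K (Ideal.Quotient.mkₐ K I) hI x
  rw [hx, map_zero] at e
  have h : x ∈ I := Ideal.Quotient.eq_zero_iff_mem.mp e.symm
  simpa using h 1 1

theorem QComm.pow_mul_list_prod {K R ι : Type*} [Field K] [Ring R] [Algebra K R] [DecidableEq ι]
    {f : ι → R} {N : ℕ} {α : ι} {s : ι → K} (hs : ∀ β, QComm (s β) (f α ^ N) (f β)) (m : ι → ℕ)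
    {l : List ι} (hl : l.Nodup) (hα : α ∈ l) : ∃ c : K, ((∀ β, s β = 1) → c = 1) ∧
      f α ^ N * (l.map fun β => f β ^ m β).prod =
        c • (l.map fun β => f β ^ (m + Pi.single α N : ι → ℕ) β).prod := by
  induction l with
  | nil => simp at hα
  | cons β l ih =>
    simp only [List.map_cons, List.prod_cons, List.nodup_cons, List.mem_cons] at *
    by_cases hβ : β = α
    · subst hβ
      refine ⟨1, fun _ => rfl, ?_⟩
      rw [one_smul, ← mul_assoc, ← pow_add, Pi.add_apply, Pi.single_eq_same, add_comm N]
      refine congrArg _ (congrArg _ (List.map_congr_left fun δ hδ => ?_))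
      rw [Pi.add_apply, Pi.single_eq_of_ne (by rintro rfl; exact hl.1 hδ), add_zero]
    · obtain ⟨c, hc, e⟩ := ih hl.2 (hα.resolve_left (Ne.symm hβ))
      refine ⟨s β ^ m β * c, fun h => by rw [h, hc h, one_pow, one_mul], ?_⟩
      have e' : _ * _ = _ := (hs β).pow_right (m β)
      rw [← mul_assoc, e', smul_mul_assoc, mul_assoc, e, mul_smul_comm, smul_smul, Pi.add_apply,
        Pi.single_eq_of_ne hβ, add_zero]

namespace LinkingDatum

section

variable {K Γ : Type*} [Field K] [CommGroup Γ] {t : ℕ} {n : Fin t → ℕ} (D : LinkingDatum K Γ n)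
variable [∀ k, NeZero (n k)] {γ : ∀ k : Fin t, Fin (n k + 1) → Fin (n k + 1) → K}

/-- Since $\chi_{i,j}=\chi_{i,p}\chi_{p,j}$, one of the two factors has nontrivial $N$-th power; so
$\gamma_{i,p}=0$, or $u_{p,j}=0$ by induction. -/
theorem u_eq_zero (hγ : D.Admissible γ) (k : Fin t) {i j : Fin (n k + 1)} (hij : i < j)
    (h : D.χRoot k i j ^ D.N k ≠ 1) : D.u k (γ k) i j = 0 := by
  induction i using WellFoundedGT.induction with
  | ind i ih =>
  rw [u_eq, hγ k i j hij (Or.inl h), zero_smul, zero_add]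
  refine sum_eq_zero fun p hp => ?_
  obtain ⟨h1, h2⟩ := mem_Ioo.mp hp
  by_cases hip : D.χRoot k i p ^ D.N k = 1
  · rw [ih p h1 h2 fun hpj => h ?_, smul_zero]
    rw [← D.χRoot_mul h1.le h2.le]
    refine MonoidHom.ext fun x => ?_
    have e1 := DFunLike.congr_fun hip x
    have e2 := DFunLike.congr_fun hpj x
    rw [MonoidHom.pow_apply] at e1 e2 ⊢
    rw [MonoidHom.mul_apply, mul_pow, e1, e2, MonoidHom.one_apply, mul_one]
  · rw [hγ k i p h1 (Or.inl hip), mul_zero, zero_smul]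

/-- Unrolled, $u_{i,j}$ involves only those $h_{p,j}$ with $\gamma_{p,j}\ne0$; then
$\chi_{p,j}^N=1$, and $h_{p,j}$ is central by `χ_rg_pow`. -/
theorem commute_u (hγ : D.Admissible γ) (k : Fin t) {i j : Fin (n k + 1)} (hij : i < j) (x : D.U) :
    Commute (D.groupAlgebraToU (D.u k (γ k) i j)) x := by
  induction x using D.U_induction with
  | hgrp x =>
    rw [← D.groupAlgebraToU_of x]
    exact (Commute.all _ _).map D.groupAlgebraToU
  | halg c => exact (Algebra.commutes c _).symm
  | hadd x y hx hy => exact hx.add_right hy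
  | hmul x y hx hy => exact hx.mul_right hy
  | ha l =>
    induction i using WellFoundedGT.induction with
    | ind i ih =>
    rw [u_eq, map_add, map_sum, map_smul, map_sub, map_one, groupAlgebraToU_of]
    refine Commute.add_left ?_ (Commute.sum_left _ _ _ fun p hp => ?_)
    · by_cases h : D.χRoot k i j ^ D.N k = 1
      · refine ((Commute.one_left _).sub_left ?_).smul_left _
        have e : _ * _ = _ := D.rep_U.grp (D.h k i j) l
        have e1 : D.χ l (D.h k i j) = 1 := χ_rg_pow (α := ⟨k, ⟨i, j⟩, hij⟩) h l
        rw [e1, Units.val_one, one_smul] at e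
        exact e
      · rw [hγ k i j hij (Or.inl h), zero_smul]
        exact Commute.zero_left _
    · rw [map_smul]
      exact (ih p (mem_Ioo.mp hp).1 (mem_Ioo.mp hp).2).smul_left _

/-- The element `u_α` of the group algebra attached to a positive root. -/
noncomputable def uR (γ : ∀ k : Fin t, Fin (n k + 1) → Fin (n k + 1) → K) (α : Root n) :
    MonoidAlgebra K Γ := D.u α.1 (γ α.1) α.2.1.1 α.2.1.2

theorem commute_uR (hγ : D.Admissible γ) (α : Root n) (x : D.U) :
    Commute (D.groupAlgebraToU (D.uR γ α)) x := D.commute_u hγ α.1 α.2.2 x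

theorem uR_eq_zero (hγ : D.Admissible γ) {α : Root n} (h : D.rχ α ^ D.N α.1 ≠ 1) :
    D.uR γ α = 0 := D.u_eq_zero hγ α.1 α.2.2 h

theorem N_pos (k : Fin t) : 0 < D.N k := pos_of_gt (D.three_lt_N k)

/-- The basis of `𝔘(𝓓)` given by the ordered monomials in the root vectors and the group. -/
noncomputable def basisU : Module.Basis ((Root n → ℕ) × Γ) K D.U :=
  .mk D.linearIndependent_mono D.span_mono_mul_grp.ge

/-- The reduction of the exponents of the root vectors modulo the root vector relations. -/
noncomputable def reduce (γ : ∀ k : Fin t, Fin (n k + 1) → Fin (n k + 1) → K) :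
    D.U →ₗ[K] (Root n → ℕ) →₀ MonoidAlgebra K Γ :=
  D.basisU.constr K fun p => .single (fun α => p.1 α % D.N α.1)
    ((∏ α, D.uR γ α ^ (p.1 α / D.N α.1)) * MonoidAlgebra.of K Γ p.2)

theorem reduce_mono_mul_grp (m : Root n → ℕ) (x : Γ) : D.reduce γ (D.mono D.a m * D.grp x) =
    .single (fun α => m α % D.N α.1)
      ((∏ α, D.uR γ α ^ (m α / D.N α.1)) * MonoidAlgebra.of K Γ x) := by
  rw [← D.basisU.constr_basis K (fun p : (Root n → ℕ) × Γ => Finsupp.single (fun α => p.1 α % D.N α.1)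
    ((∏ α, D.uR γ α ^ (p.1 α / D.N α.1)) * MonoidAlgebra.of K Γ p.2)) (m, x), reduce, basisU,
    Module.Basis.mk_apply]

theorem reduce_mono_mul (m : Root n → ℕ) (w : MonoidAlgebra K Γ) :
    D.reduce γ (D.mono D.a m * D.groupAlgebraToU w) = .single (fun α => m α % D.N α.1)
      ((∏ α, D.uR γ α ^ (m α / D.N α.1)) * w) := by
  induction w using MonoidAlgebra.induction_on with
  | of x => rw [groupAlgebraToU_of, reduce_mono_mul_grp]
  | add v w hv hw => rw [map_add, mul_add, map_add, hv, hw, mul_add, Finsupp.single_add]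
  | smul c w hw => rw [map_smul, mul_smul_comm, map_smul, hw, mul_smul_comm, Finsupp.smul_single]

theorem rv_pow_qcomm (α β : Root n) : QComm (((D.rχ α (D.rg β) : Kˣ) : K) ^ D.N α.1)⁻¹
    (D.rv D.a α ^ D.N α.1) (D.rv D.a β) :=
  (D.rep_U.rv_rv_pow α β).symm (pow_ne_zero _ (Units.ne_zero _))

/-- Moving $e_\alpha^N$ to its place in an ordered monomial costs a scalar. If $\chi_\alpha^N=1$ the
scalar is $1$; otherwise $u_\alpha=0$ and both sides vanish. -/
theorem reduce_rv_pow_sub_mul (hγ : D.Admissible γ) (α : Root n) (x : D.U) :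
    D.reduce γ ((D.rv D.a α ^ D.N α.1 - D.groupAlgebraToU (D.uR γ α)) * x) = 0 := by
  classical
  suffices h : D.reduce γ ∘ₗ LinearMap.mulLeft K
      (D.rv D.a α ^ D.N α.1 - D.groupAlgebraToU (D.uR γ α)) = 0 from LinearMap.congr_fun h x
  refine D.basisU.ext fun ⟨m, y⟩ => ?_
  rw [basisU, Module.Basis.mk_apply, LinearMap.comp_apply, LinearMap.mulLeft_apply,
    LinearMap.zero_apply, sub_mul, map_sub, sub_eq_zero]
  obtain ⟨c, hc, e⟩ := QComm.pow_mul_list_prod (D.rv_pow_qcomm α) m (nodup_rootList (n := n))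
    (mem_rootList α)
  have e' : D.rv D.a α ^ D.N α.1 * D.mono D.a m = c • D.mono D.a (m + Pi.single α (D.N α.1)) := e
  have hmod : (fun β => (m + Pi.single α (D.N α.1) : Root n → ℕ) β % D.N β.1) =
      fun β => m β % D.N β.1 := by
    funext β
    by_cases hβ : β = α
    · subst hβ
      simp
    · simp [Pi.single_eq_of_ne hβ]
  have hdiv : ∏ β, D.uR γ β ^ ((m + Pi.single α (D.N α.1) : Root n → ℕ) β / D.N β.1) =
      D.uR γ α * ∏ β, D.uR γ β ^ (m β / D.N β.1) := by
    rw [← mul_prod_erase univ _ (mem_univ α), ← mul_prod_erase univ _ (mem_univ α), ← mul_assoc]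
    congr 1
    · rw [Pi.add_apply, Pi.single_eq_same, Nat.add_div_right _ (D.N_pos _), pow_succ']
    · refine prod_congr rfl fun β hβ => ?_
      rw [Pi.add_apply, Pi.single_eq_of_ne (mem_erase.mp hβ).1, add_zero]
  rw [← mul_assoc, e', smul_mul_assoc, map_smul, reduce_mono_mul_grp, hmod, hdiv,
    ← mul_assoc, (D.commute_uR hγ α _).eq, mul_assoc (D.mono _ _), ← D.groupAlgebraToU_of, ← map_mul]
  rw [reduce_mono_mul]
  by_cases hα : D.rχ α ^ D.N α.1 = 1
  · rw [hc fun β => ?_, one_smul]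
    · congr 1
      ring
    · rw [← Units.val_pow_eq_pow_val, ← MonoidHom.pow_apply, hα, MonoidHom.one_apply,
        Units.val_one, inv_one]
  · rw [D.uR_eq_zero hγ hα]
    simp

/-- Normality of $e_\alpha^N-u_\alpha$: factors on its left can be moved to its right, so one-sided
multiples are enough in `reduce_eq_zero`. -/
theorem exists_mul_rv_pow_sub (hγ : D.Admissible γ) (α : Root n) (x : D.U) : ∃ x' : D.U,
    x * (D.rv D.a α ^ D.N α.1 - D.groupAlgebraToU (D.uR γ α)) =
      (D.rv D.a α ^ D.N α.1 - D.groupAlgebraToU (D.uR γ α)) * x' := by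
  have key : ∀ (x : D.U) (y : Γ), QComm (((D.rχ α y : Kˣ) : K) ^ D.N α.1) x (D.rv D.a α ^ D.N α.1) →
      ∃ x' : D.U, x * (D.rv D.a α ^ D.N α.1 - D.groupAlgebraToU (D.uR γ α)) =
      (D.rv D.a α ^ D.N α.1 - D.groupAlgebraToU (D.uR γ α)) * x' := fun x y h => by
    refine ⟨((D.rχ α y : Kˣ) : K) ^ D.N α.1 • x, ?_⟩
    have h' : _ * _ = _ := h
    rw [mul_sub, h', sub_mul, mul_smul_comm]
    congr 1
    by_cases hα : D.rχ α ^ D.N α.1 = 1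
    · rw [← Units.val_pow_eq_pow_val, ← MonoidHom.pow_apply, hα, MonoidHom.one_apply,
        Units.val_one, one_smul]
      exact (D.commute_uR hγ α x).eq.symm
    · rw [D.uR_eq_zero hγ hα]
      simp
  induction x using D.U_induction with
  | hgrp y => exact key _ y ((D.rep_U.grp_rv y α).pow_right _)
  | ha i => exact key _ (D.g i) (D.rep_U.gen_rv_pow i α)
  | halg c => exact ⟨_, Algebra.commutes c _⟩
  | hadd x y hx hy =>
    obtain ⟨x', hx⟩ := hx
    obtain ⟨y', hy⟩ := hy
    exact ⟨x' + y', by rw [add_mul, hx, hy, mul_add]⟩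
  | hmul x y hx hy =>
    obtain ⟨x', hx⟩ := hx
    obtain ⟨y', hy⟩ := hy
    exact ⟨x' * y', by rw [mul_assoc, hy, ← mul_assoc, hx, mul_assoc]⟩

theorem reduce_eq_zero (hγ : D.Admissible γ) {x : D.U} (hx : D.proj γ x = 0) :
    D.reduce γ x = 0 := by
  refine RingQuot.map_eq_zero_of_mkAlgHom_eq_zero (D.reduce γ) (fun x y hxy b c => ?_) hx
  induction hxy with
  | root k i j hij =>
    let α : Root n := ⟨k, ⟨i, j⟩, hij⟩
    obtain ⟨b', hb⟩ := D.exists_mul_rv_pow_sub hγ α b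
    rw [show D.e k i j = D.rv D.a α from D.e_eq_rv α]
    change D.reduce γ (b * (D.rv D.a α ^ D.N α.1 - D.groupAlgebraToU (D.uR γ α)) * c) = 0
    rw [hb, mul_assoc, D.reduce_rv_pow_sub_mul hγ]

/-- The reduced monomials in `𝓐(𝓓, γ)`. -/
noncomputable def reducedMono (γ : ∀ k : Fin t, Fin (n k + 1) → Fin (n k + 1) → K)
    (p : (∀ α : Root n, Fin (D.N α.1)) × Γ) : D.A γ :=
  D.proj γ (D.mono D.a (fun α => p.1 α) * D.grp p.2)

theorem linearIndependent_reducedMono (hγ : D.Admissible γ) :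
    LinearIndependent K (D.reducedMono γ) := by
  have h : LinearIndependent K fun p : (∀ α : Root n, Fin (D.N α.1)) × Γ =>
      D.reduce γ (D.mono D.a (fun α => (p.1 α : ℕ)) * D.grp p.2) := by
    have e : (fun p : (∀ α : Root n, Fin (D.N α.1)) × Γ =>
        D.reduce γ (D.mono D.a (fun α => (p.1 α : ℕ)) * D.grp p.2)) =
        Finsupp.basis (fun _ : Root n → ℕ => MonoidAlgebra.basis Γ K) ∘
          fun p => (⟨fun α => p.1 α, p.2⟩ : Σ _ : Root n → ℕ, Γ) := by
      funext p
      rw [reduce_mono_mul_grp]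
      simp [Nat.mod_eq_of_lt, Nat.div_eq_of_lt]
    rw [e]
    refine (Module.Basis.linearIndependent _).comp _ fun p p' hp => ?_
    rw [Sigma.mk.injEq] at hp
    exact Prod.ext (funext fun α => Fin.ext (congrFun hp.1 α)) (eq_of_heq hp.2)
  rw [linearIndependent_iff'] at h ⊢
  intro s c hc
  refine h s c ?_
  rw [← D.reduce_eq_zero hγ (x := ∑ p ∈ s, c p • (D.mono D.a (fun α => (p.1 α : ℕ)) * D.grp p.2)) ?_]
  · simp
  · rw [← hc]
    simp [reducedMono]

/-- Each exponent is divided by $N$ with remainder; the powers of $e_\alpha^N$ become powers of the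
central $u_\alpha$ and are collected on the right. -/
theorem proj_mono (hγ : D.Admissible γ) (m : Root n → ℕ) : D.proj γ (D.mono D.a m) =
    D.proj γ (D.mono D.a (fun α => m α % D.N α.1) *
      D.groupAlgebraToU (((rootList n).map fun α => D.uR γ α ^ (m α / D.N α.1)).prod)) := by
  rw [mono, mono]
  induction rootList n with
  | nil => simp
  | cons α l ih =>
    simp only [List.map_cons, List.prod_cons]
    have e1 : D.rv D.a α ^ m α =
        D.rv D.a α ^ (m α % D.N α.1) * (D.rv D.a α ^ D.N α.1) ^ (m α / D.N α.1) := by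
      rw [← pow_mul, ← pow_add, Nat.mod_add_div]
    have e2 : D.proj γ (D.rv D.a α ^ D.N α.1) = D.proj γ (D.groupAlgebraToU (D.uR γ α)) := by
      rw [← D.e_eq_rv]
      exact D.proj_e_pow γ α.1 α.2.2
    rw [map_mul, ih, ← map_mul, e1, map_mul, map_mul, map_pow _ (_ ^ _), e2, ← map_pow, ← map_mul,
      ← map_mul, map_mul D.groupAlgebraToU, map_pow]
    have e3 := ((D.commute_uR hγ α (l.map fun β => D.rv D.a β ^ (m β % D.N β.1)).prod).pow_left
      (m α / D.N α.1)).eq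
    congr 1
    rw [mul_assoc, mul_assoc, ← mul_assoc (_ ^ (m α / D.N α.1)), e3, mul_assoc]

theorem span_reducedMono (hγ : D.Admissible γ) :
    Submodule.span K (Set.range (D.reducedMono γ)) = ⊤ := by
  have hw : ∀ (s : ∀ α : Root n, Fin (D.N α.1)) (w : MonoidAlgebra K Γ),
      D.proj γ (D.mono D.a (fun α => (s α : ℕ)) * D.groupAlgebraToU w) ∈
        Submodule.span K (Set.range (D.reducedMono γ)) := fun s w => by
    induction w using MonoidAlgebra.induction_on with
    | of x =>
      rw [groupAlgebraToU_of]
      exact Submodule.subset_span ⟨(s, x), rfl⟩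
    | add v w hv hw =>
      rw [map_add, mul_add, map_add]
      exact Submodule.add_mem _ hv hw
    | smul c w hw =>
      rw [map_smul, mul_smul_comm, map_smul]
      exact Submodule.smul_mem _ _ hw
  rw [eq_top_iff]
  intro y _
  obtain ⟨x, rfl⟩ := D.proj_surjective γ y
  have hx : x ∈ Submodule.span K (Set.range fun p : (Root n → ℕ) × Γ => D.mono D.a p.1 * D.grp p.2) :=
    D.span_mono_mul_grp ▸ Submodule.mem_top
  induction hx using Submodule.span_induction with
  | zero => rw [map_zero]; exact Submodule.zero_mem _
  | add x y _ _ hx hy => rw [map_add]; exact Submodule.add_mem _ (hx trivial) (hy trivial)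
  | smul c x _ hx => rw [map_smul]; exact Submodule.smul_mem _ _ (hx trivial)
  | mem x hx =>
    obtain ⟨⟨m, y⟩, rfl⟩ := hx
    rw [map_mul, D.proj_mono hγ, ← map_mul, mul_assoc, ← D.groupAlgebraToU_of, ← map_mul]
    exact hw (fun α => ⟨m α % D.N α.1, Nat.mod_lt _ (D.N_pos _)⟩) _

omit [∀ k, NeZero (n k)] in
theorem prod_root (f : Fin t → ℕ) : ∏ α : Root n, f α.1 = ∏ k, f k ^ (n k + 1).choose 2 := by
  rw [Fintype.prod_sigma]
  refine prod_congr rfl fun k _ => ?_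
  change ∏ _, f k = _
  rw [prod_const, card_univ, Fintype.card_subtype, Fintype.card_product_filter_lt, Fintype.card_fin]

theorem finite_A [Finite Γ] (hγ : D.Admissible γ) : Module.Finite K (D.A γ) :=
  ⟨Submodule.fg_def.mpr ⟨_, Set.finite_range _, D.span_reducedMono hγ⟩⟩

theorem finrank_A (hγ : D.Admissible γ) :
    Module.finrank K (D.A γ) = Nat.card Γ * ∏ k, D.N k ^ (n k + 1).choose 2 := by
  rw [Module.finrank_eq_nat_card_basis
    (Module.Basis.mk (D.linearIndependent_reducedMono hγ) (D.span_reducedMono hγ).ge),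
    Nat.card_prod, Nat.card_pi, mul_comm, ← prod_root]
  simp

end

end LinkingDatum

theorem mainTheorem4 {K Γ : Type*} [Field K] [CommGroup Γ] [Finite Γ]
    {t : ℕ} (ht : 0 < t) (n : Fin t → ℕ) [∀ k, NeZero (n k)]
    (D : LinkingDatum K Γ n)
    (γ : ∀ k : Fin t, Fin (n k + 1) → Fin (n k + 1) → K) (hγ : D.Admissible γ) :
    (∃ H : HopfAlgebra K (D.A γ),
      H.toAlgebra = (inferInstance : Algebra K (D.A γ)) ∧
      @LinkingDatum.CoproductFormulas K Γ _ _ t n D (D.A γ) _ H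
        (fun x => D.proj γ (D.grp x)) (fun i => D.proj γ (D.a i))) ∧
    Module.Finite K (D.A γ) ∧
    Module.finrank K (D.A γ) = Nat.card Γ * ∏ k, D.N k ^ (n k + 1).choose 2 := by
  exact ⟨D.hopfAlgebraA_spec γ, D.finite_A hγ, D.finrank_A hγ⟩
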